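/- Let $n\ge 1$, $m\ge 0$. Let $\hat M$ be a smooth manifold of dimension $n+m$ with a smooth pseudo-Riemannian metric $\hat g$ of signature $(n,m)$, Levi-Civita connection $\hat D$ and Riemann curvature tensor $$\hat R(X,Y,Z,W)=-\hat g(\hat D_X\hat D_YZ-\hat D_Y\hat D_XZ-\hat D_{[X,Y]}Z,\,W).$$ Let $\hat S$ be a smooth positive definite symmetric $(0,2)$-tensor field on $\hat M$, and let $\hat\varphi:\hat M\to[0,\infty)$ be a smooth function. Let $M$ be an $n$-dimensional smooth (immersed) submanifold of $\hat M$ that is spacelike, i.e. the restriction $g$ of $\hat g$ to $M$ is positive definite, and that has vanishing mean curvature, i.e. the trace with respect to $g$ of its second fundamental form $I\!I(X,Y)=\hat D_XY-D_XY$ vanishes identically, where $D$ is the Levi-Civita connection of $g$. Denote by $S$ and $\varphi$ the restrictions of $\hat S$ and $\hat\varphi$ to $M$. Suppose that $p_0\in M$ is a point with $\varphi(p_0)>0$ at which the largest eigenvalue of $\varphi^{2n-2}S$ with respect to $g$, as a function on $M$, attains its maximum. Let $\{e_1,\dots,e_n\}\subset T_{p_0}M$ be a basis that is orthonormal with respect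 to $g$ and diagonalizes $S$, labelled so that $S(e_n,e_n)$ is the largest eigenvalue of $S$ with respect to $g$ at $p_0$. Then, at $p_0$, $$\sum_{l=1}^n\hat R(e_l,e_n,e_l,e_n)\le C\,\varphi^{-2}\,S(e_n,e_n),$$ where $C$ depends only on $n$, $m$ and an upper bound $K$ for $\|\hat g,\hat g^{-1},\hat S,\hat\varphi\|_{C^2(\{p_0\})}$. Here the $C^2$ norm at $p_0$ is taken in an arbitrary smooth coordinate chart of $\hat M$ around $p_0$: $K$ bounds $\hat g$, $\hat g^{-1}$, $\hat S$, $\hat\varphi$ and their first and second coordinate derivatives at $p_0$, where the size of these multilinear expressions is measured by the inner product $\hat S$ at $p_0$, that is, evaluated on vectors (and directions of differentiation) of $\hat S$-length at most $1$ and on covectors of dual $\hat S$-length at most $1$. -/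

import Mathlib

open scoped Manifold ContDiff

universe u v

noncomputable section

namespace MaximalSpacelike

/-- The model space `ℝ^N`. -/
abbrev Eu (N : ℕ) : Type := EuclideanSpace ℝ (Fin N)

/-- The `i`-th coordinate vector of `ℝ^N`. -/
def basisVec {N : ℕ} (i : Fin N) : Eu N := EuclideanSpace.single i 1

/-- The partial derivative `∂ᵢ h` of a real function on `ℝ^N`. -/
def pd {N : ℕ} (i : Fin N) (h : Eu N → ℝ) (y : Eu N) : ℝ := fderiv ℝ h y (basisVec i)

/-! ### Bilinear forms on tangent spaces -/

/-- A field of real-valued functions of two tangent vectors (used only for bilinear ones). -/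
abbrev TwoForm (N : ℕ) (X : Type*) [TopologicalSpace X] [ChartedSpace (Eu N) X] : Type _ :=
  ∀ p : X, TangentSpace (𝓡 N) p → TangentSpace (𝓡 N) p → ℝ

/-- A smooth pseudo-Riemannian metric of signature `(n, m)` on a manifold of dimension `n + m`. -/
structure PseudoMetric (n m : ℕ) (X : Type*) [TopologicalSpace X] [ChartedSpace (Eu (n + m)) X]
    [IsManifold (𝓡 (n + m)) ∞ X] where
  /-- The scalar product on each tangent space. -/
  val (p : X) : TangentSpace (𝓡 (n + m)) p →L[ℝ] TangentSpace (𝓡 (n + m)) p →L[ℝ] ℝ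
  symm (p : X) (v w : TangentSpace (𝓡 (n + m)) p) : val p v w = val p w v
  /-- Each tangent space has an orthogonal basis of `n` vectors with square `1` and `m` vectors
  with square `-1`. -/
  signature (p : X) : ∃ b : Module.Basis (Fin n ⊕ Fin m) ℝ (TangentSpace (𝓡 (n + m)) p),
    (∀ i j, i ≠ j → val p (b i) (b j) = 0) ∧
    (∀ i, val p (b (Sum.inl i)) (b (Sum.inl i)) = 1) ∧
    (∀ i, val p (b (Sum.inr i)) (b (Sum.inr i)) = -1)
  contMDiff : ContMDiff (𝓡 (n + m))
    ((𝓡 (n + m)).prod 𝓘(ℝ, Eu (n + m) →L[ℝ] Eu (n + m) →L[ℝ] ℝ)) ∞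
    (fun p => Bundle.TotalSpace.mk' (Eu (n + m) →L[ℝ] Eu (n + m) →L[ℝ] ℝ)
      (E := fun p : X =>
        (TangentSpace (𝓡 (n + m)) p →L[ℝ] TangentSpace (𝓡 (n + m)) p →L[ℝ] ℝ)) p (val p))

/-- A smooth Riemannian metric (a positive definite smooth symmetric `(0,2)`-tensor field). -/
abbrev RiemMetric (N : ℕ) (X : Type*) [TopologicalSpace X] [ChartedSpace (Eu N) X]
    [IsManifold (𝓡 N) ∞ X] : Type _ :=
  Bundle.ContMDiffRiemannianMetric (IB := 𝓡 N) (n := ∞) (F := Eu N)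
    (E := fun p : X => TangentSpace (𝓡 N) p)

/-- The underlying form of a pseudo-metric. -/
def PseudoMetric.form {n m : ℕ} {X : Type*} [TopologicalSpace X] [ChartedSpace (Eu (n + m)) X]
    [IsManifold (𝓡 (n + m)) ∞ X] (g : PseudoMetric n m X) : TwoForm (n + m) X :=
  fun p v w => g.val p v w

/-- The underlying form of a Riemannian metric. -/
def riemForm {N : ℕ} {X : Type*} [TopologicalSpace X] [ChartedSpace (Eu N) X]
    [IsManifold (𝓡 N) ∞ X] (S : RiemMetric N X) : TwoForm N X :=
  fun p v w => S.inner p v w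

/-- The pullback `f^* T`, i.e. the restriction of `T` to the immersed submanifold `f : X → Y`. -/
def pullback {n N : ℕ} {X Y : Type*} [TopologicalSpace X] [ChartedSpace (Eu n) X]
    [TopologicalSpace Y] [ChartedSpace (Eu N) Y] (f : X → Y) (T : TwoForm N Y) : TwoForm n X :=
  fun q v w => T (f q) (mfderiv (𝓡 n) (𝓡 N) f q v) (mfderiv (𝓡 n) (𝓡 N) f q w)

/-- `f` is spacelike for `g`: the restriction of `g` is positive definite. (In particular the
differential of `f` is injective, so a smooth spacelike map is an immersion.) -/
def Spacelike {n N : ℕ} {X Y : Type*} [TopologicalSpace X] [ChartedSpace (Eu n) X]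
    [TopologicalSpace Y] [ChartedSpace (Eu N) Y] (f : X → Y) (g : TwoForm N Y) : Prop :=
  ∀ (q : X) (v : TangentSpace (𝓡 n) q), v ≠ 0 → 0 < pullback f g q v v

/-! ### Eigenvalues of one form with respect to another -/

/-- The set of eigenvalues of the form `B` with respect to the form `g`. -/
def eigenvalues {V : Type*} [Zero V] (g B : V → V → ℝ) : Set ℝ :=
  {c | ∃ v : V, v ≠ 0 ∧ ∀ w : V, B v w = c * g v w}

/-- The largest eigenvalue of `B` with respect to `g` (the set of eigenvalues is finite and
nonempty when `B` is symmetric and `g` is an inner product on a nonzero finite-dimensional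
space). -/
def largestEigenvalue {V : Type*} [Zero V] (g B : V → V → ℝ) : ℝ := sSup (eigenvalues g B)

/-! ### Local coordinates -/

/-- The matrix `T(∂ᵢ, ∂ⱼ)` of `T` in the chart `ψ`, as a function of the coordinates `y`. -/
def coordMatrix {N : ℕ} {X : Type*} [TopologicalSpace X] [ChartedSpace (Eu N) X]
    (ψ : OpenPartialHomeomorph X (Eu N)) (T : TwoForm N X) (y : Eu N) :
    Matrix (Fin N) (Fin N) ℝ :=
  Matrix.of fun i j => T (ψ.symm y)
    (mfderiv (𝓡 N) (𝓡 N) ψ.symm y (basisVec i)) (mfderiv (𝓡 N) (𝓡 N) ψ.symm y (basisVec j))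

/-- The components `v^i` of a tangent vector `v` at `p` in the chart `ψ`. -/
def coordVec {N : ℕ} {X : Type*} [TopologicalSpace X] [ChartedSpace (Eu N) X]
    (ψ : OpenPartialHomeomorph X (Eu N)) (p : X) (v : TangentSpace (𝓡 N) p) (i : Fin N) : ℝ :=
  (show Eu N from mfderiv (𝓡 N) (𝓡 N) ψ p v) i

/-- The Christoffel symbols `Γ^a_{bc}` of the Levi-Civita connection of the metric with
matrix `G`. -/
def christoffel {N : ℕ} (G : Eu N → Matrix (Fin N) (Fin N) ℝ) (y : Eu N) (a b c : Fin N) : ℝ :=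
  (1 / 2) * ∑ d, (G y)⁻¹ a d *
    (pd b (fun z => G z d c) y + pd c (fun z => G z d b) y - pd d (fun z => G z b c) y)

/-- The components `R^a_{bcd}` given by `D_c D_d ∂_b - D_d D_c ∂_b = ∑ a, R^a_{bcd} ∂_a`. -/
def curvCoord {N : ℕ} (G : Eu N → Matrix (Fin N) (Fin N) ℝ) (y : Eu N) (a b c d : Fin N) : ℝ :=
  pd c (fun z => christoffel G z a d b) y - pd d (fun z => christoffel G z a c b) y
    + ∑ e, (christoffel G y a c e * christoffel G y e d b
      - christoffel G y a d e * christoffel G y e c b)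

/-- The Riemann curvature tensor `R(X,Y,Z,W) = -g(D_X D_Y Z - D_Y D_X Z - D_[X,Y] Z, W)` at `p`,
evaluated in the chart `ψ` around `p` (its value does not depend on the chart). -/
def riemann {N : ℕ} {X : Type*} [TopologicalSpace X] [ChartedSpace (Eu N) X]
    (g : TwoForm N X) (ψ : OpenPartialHomeomorph X (Eu N)) (p : X)
    (x y z w : TangentSpace (𝓡 N) p) : ℝ :=
  -∑ a, ∑ b, ∑ c, ∑ d, ∑ e,
    coordMatrix ψ g (ψ p) a e * curvCoord (coordMatrix ψ g) (ψ p) a b c d *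
      coordVec ψ p x c * coordVec ψ p y d * coordVec ψ p z b * coordVec ψ p w e

/-- The components `II(∂ᵢ, ∂ⱼ)^α` of `II(X, Y) = D̂_X Y - D_X Y` for the immersion `f` into
`(Y, g)`, where `D̂`, `D` are the Levi-Civita connections of `g` and `f^* g`, in a chart `χ` of the
submanifold and a chart `ψ` of the ambient manifold, at the point with coordinates `x` in `χ`. -/
def secondFundamentalForm {n N : ℕ} {X Y : Type*} [TopologicalSpace X] [ChartedSpace (Eu n) X]
    [TopologicalSpace Y] [ChartedSpace (Eu N) Y] (f : X → Y) (g : TwoForm N Y)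
    (χ : OpenPartialHomeomorph X (Eu n)) (ψ : OpenPartialHomeomorph Y (Eu N))
    (x : Eu n) (i j : Fin n) (α : Fin N) : ℝ :=
  let F : Fin N → Eu n → ℝ := fun β x' => ψ (f (χ.symm x')) β
  let y : Eu N := ψ (f (χ.symm x))
  pd i (pd j (F α)) x
    + ∑ β, ∑ γ, christoffel (coordMatrix ψ g) y α β γ * pd i (F β) x * pd j (F γ) x
    - ∑ k, christoffel (coordMatrix χ (pullback f g)) x k i j * pd k (F α) x

/-- The mean curvature vector `∑ᵢⱼ g^{ij} II(∂ᵢ, ∂ⱼ)`, in components. -/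
def meanCurvature {n N : ℕ} {X Y : Type*} [TopologicalSpace X] [ChartedSpace (Eu n) X]
    [TopologicalSpace Y] [ChartedSpace (Eu N) Y] (f : X → Y) (g : TwoForm N Y)
    (χ : OpenPartialHomeomorph X (Eu n)) (ψ : OpenPartialHomeomorph Y (Eu N))
    (x : Eu n) (α : Fin N) : ℝ :=
  ∑ i, ∑ j, (coordMatrix χ (pullback f g) x)⁻¹ i j * secondFundamentalForm f g χ ψ x i j α

/-- The mean curvature vector of the immersion `f` vanishes at every point (computed in smooth
charts around the point and its image; its vanishing does not depend on the charts). -/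
def ZeroMeanCurvature {n N : ℕ} {X Y : Type*} [TopologicalSpace X] [ChartedSpace (Eu n) X]
    [TopologicalSpace Y] [ChartedSpace (Eu N) Y] (f : X → Y) (g : TwoForm N Y) : Prop :=
  ∀ χ ∈ IsManifold.maximalAtlas (𝓡 n) ∞ X, ∀ ψ ∈ IsManifold.maximalAtlas (𝓡 N) ∞ Y,
    ∀ q ∈ χ.source, f q ∈ ψ.source → ∀ α, meanCurvature f g χ ψ (χ q) α = 0

/-! ### `C²` norms at a point -/

/-- The closed unit ball of the quadratic form of the matrix `A`. -/
def unitBall {N : ℕ} (A : Matrix (Fin N) (Fin N) ℝ) : Set (Eu N) :=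
  {v | ∑ i, ∑ j, A i j * v i * v j ≤ 1}

/-- The dual unit ball, a set of covectors. -/
def dualBall {N : ℕ} (A : Matrix (Fin N) (Fin N) ℝ) : Set (Eu N) :=
  {ξ | ∀ v ∈ unitBall A, |∑ i, ξ i * v i| ≤ 1}

/-- `h` and its first and second derivatives at `y` in directions in `B` are bounded by `K`. -/
def JetBound {N : ℕ} (B : Set (Eu N)) (h : Eu N → ℝ) (y : Eu N) (K : ℝ) : Prop :=
  |h y| ≤ K ∧ (∀ u ∈ B, |fderiv ℝ h y u| ≤ K) ∧
    ∀ u ∈ B, ∀ v ∈ B, |fderiv ℝ (fun z => fderiv ℝ h z v) y u| ≤ K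

/-- `‖g, g⁻¹, S, φ‖_{C²({p})} ≤ K`: in the chart `ψ`, the tensors `g`, `g⁻¹`, `S`, the function `φ`
and their first and second coordinate derivatives are bounded by `K` at `p`, where the size of
multilinear expressions is measured by the Riemannian metric `S` at `p`. -/
def C2Bound {N : ℕ} {X : Type*} [TopologicalSpace X] [ChartedSpace (Eu N) X]
    (g S : TwoForm N X) (φ : X → ℝ) (ψ : OpenPartialHomeomorph X (Eu N)) (p : X) (K : ℝ) : Prop :=
  let G := coordMatrix ψ g
  let A := coordMatrix ψ S
  let B := unitBall (A (ψ p))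
  let B' := dualBall (A (ψ p))
  (∀ v ∈ B, ∀ w ∈ B, JetBound B (fun z => ∑ i, ∑ j, G z i j * v i * w j) (ψ p) K) ∧
  (∀ ξ ∈ B', ∀ η ∈ B', JetBound B (fun z => ∑ i, ∑ j, (G z)⁻¹ i j * ξ i * η j) (ψ p) K) ∧
  (∀ v ∈ B, ∀ w ∈ B, JetBound B (fun z => ∑ i, ∑ j, A z i j * v i * w j) (ψ p) K) ∧
  JetBound B (fun z => φ (ψ.symm z)) (ψ p) K

end MaximalSpacelike

end

/-! The largest eigenvalue of `φ ^ P • S` (with `P = 2n - 2`, though any exponent works) need not be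
smooth, so it is replaced by a Rayleigh quotient. In a chart of `M` centred at `p₀` with `∂ₖ = eₖ`
there, put `s = S(∂_top, ∂_top)` and `γ = g(∂_top, ∂_top)`. Maximality gives `φ ^ P * s ≤ φ(p₀) ^ P
* s(p₀) * γ` near `p₀`, with equality at `p₀`. The chart is chosen (`exists_normal_chart`) so that
the second covariant derivative of the immersion is normal at `p₀`; then `g` is the identity to
first order. The second derivative test for `log (φ ^ P * s / γ)` along each coordinate line
(`second_deriv_test_quotient`), summed over the lines, bounds `φ² (∑ s'' - s ∑ γ'')` above by a
constant times `s²`.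

Curvature enters through `∑ γ''` (`sum_second_deriv_eq`). Commuting covariant derivatives turns `∑
∇ₖ∇ₖ∂_top` into `∇_top ∑ ∇ₖ∂ₖ` plus a curvature term, and vanishing mean curvature makes the first
of these tangential, so `∑ γ'' = 2 (∑ ĝ(II, II) + θ - ∑ R̂)` with an uncontrolled number `θ`. The
first sum is nonpositive because the normal space of a spacelike `n`-dimensional subspace is
negative definite (`PseudoMetric.nonpos_of_orthogonal`).

The third derivatives in `∑ s''` are eliminated by the same differentiated equation. They contribute
`2θs`, which cancels against `s ∑ γ''`. The second derivatives `Xₖ = ∂ₖ∂_top F` have no a priori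
bound, but `∑ s''` contains the nonnegative terms `2 Ŝ(Xₖ, Xₖ)`, and these absorb all terms linear
in `Xₖ` by completing squares (`sum_curvTerm_le`). What remains is of size `s²`, since no `S(eₗ,
eₗ)` exceeds `s`; dividing by `s` and by `φ²` gives the estimate. The `C²` bounds are used through
estimates of the Christoffel symbols and their derivatives (`abs_chrMap_le`,
`abs_fderiv_chrMap_le`). -/

noncomputable section

open Filter
open scoped Topology

namespace MaximalSpacelike

set_option maxSynthPendingDepth 3

/-! ### One-variable second derivative tests and derivatives along curves. -/

section Calculus

/-- Second-order necessary condition at a local maximum. -/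
theorem second_deriv_nonpos_of_isLocalMax {u u' : ℝ → ℝ} {u2 : ℝ}
    (hmax : ∀ᶠ t in 𝓝 (0 : ℝ), u t ≤ u 0)
    (h1 : ∀ᶠ t in 𝓝 (0 : ℝ), HasDerivAt u (u' t) t) (h2 : HasDerivAt u' u2 0) :
    u' 0 = 0 ∧ u2 ≤ 0 := by
  have h0 : u' 0 = 0 := by
    have hl : IsLocalMax u 0 := hmax
    exact hl.hasDerivAt_eq_zero h1.self_of_nhds
  refine ⟨h0, ?_⟩
  by_contra! hpos
  -- A positive second derivative would make `0` a local minimum as well, hence `u` locally constant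
  -- with second derivative zero.
  have hd : deriv u =ᶠ[𝓝 0] u' := h1.mono fun t ht => ht.deriv
  have hdd : deriv (deriv u) 0 = u2 := by rw [hd.deriv_eq, h2.deriv]
  have hmin : IsLocalMin u 0 :=
    isLocalMin_of_deriv_deriv_pos (by rw [hdd]; exact hpos)
      (by rw [h1.self_of_nhds.deriv, h0]) h1.self_of_nhds.continuousAt
  have hconst : u =ᶠ[𝓝 0] fun _ => u 0 := by
    filter_upwards [hmax, hmin] with t h1 h2 using le_antisymm h1 h2
  have h3 : deriv u =ᶠ[𝓝 0] fun _ => 0 := by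
    filter_upwards [hconst.eventually_nhds] with t ht
    rw [Filter.EventuallyEq.deriv_eq ht]; simp
  have : deriv (deriv u) 0 = 0 := by rw [h3.deriv_eq]; simp
  linarith

/-- The second-order condition at a maximum of `p ^ P * s / γ`, where `γ` is `1` to first order. -/
theorem second_deriv_test_quotient {p s γ p' s' γ' : ℝ → ℝ} {p2 s2 γ2 : ℝ} (P : ℕ)
    (hp : ∀ᶠ t in 𝓝 (0 : ℝ), HasDerivAt p (p' t) t) (hs : ∀ᶠ t in 𝓝 (0 : ℝ), HasDerivAt s (s' t) t)
    (hγ : ∀ᶠ t in 𝓝 (0 : ℝ), HasDerivAt γ (γ' t) t)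
    (hp2 : HasDerivAt p' p2 0) (hs2 : HasDerivAt s' s2 0) (hγ2 : HasDerivAt γ' γ2 0)
    (p0 : 0 < p 0) (s0 : 0 < s 0) (γ0 : γ 0 = 1) (γ0' : γ' 0 = 0)
    (hmax : ∀ᶠ t in 𝓝 (0 : ℝ), p t ^ P * s t ≤ p 0 ^ P * s 0 * γ t) :
    p 0 ^ 2 * (s2 - s 0 * γ2) ≤ s 0 * ((P + P ^ 2) * p' 0 ^ 2 - P * p 0 * p2) := by
  have hpc := hp.self_of_nhds.continuousAt
  have hsc := hs.self_of_nhds.continuousAt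
  have hγc := hγ.self_of_nhds.continuousAt
  have ep : ∀ᶠ t in 𝓝 (0 : ℝ), 0 < p t := hpc.eventually (lt_mem_nhds p0)
  have es : ∀ᶠ t in 𝓝 (0 : ℝ), 0 < s t := hsc.eventually (lt_mem_nhds s0)
  have eγ : ∀ᶠ t in 𝓝 (0 : ℝ), 0 < γ t := hγc.eventually (lt_mem_nhds (by rw [γ0]; norm_num))
  -- Taking logarithms turns the product inequality into a local maximum of a sum.
  let u : ℝ → ℝ := fun t => P * Real.log (p t) + Real.log (s t) - Real.log (γ t)
  let u' : ℝ → ℝ := fun t => P * (p' t / p t) + s' t / s t - γ' t / γ t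
  have hu : ∀ᶠ t in 𝓝 (0 : ℝ), HasDerivAt u (u' t) t := by
    filter_upwards [ep, es, eγ, hp, hs, hγ] with t h1 h2 h3 h4 h5 h6
    exact (((h4.log h1.ne').const_mul _).add (h5.log h2.ne')).sub (h6.log h3.ne')
  have hu2 : HasDerivAt u' (P * ((p2 * p 0 - p' 0 * p' 0) / p 0 ^ 2)
      + (s2 * s 0 - s' 0 * s' 0) / s 0 ^ 2 - (γ2 * γ 0 - γ' 0 * γ' 0) / γ 0 ^ 2) 0 :=
    (((hp2.div hp.self_of_nhds p0.ne').const_mul _).add (hs2.div hs.self_of_nhds s0.ne')).sub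
      (hγ2.div hγ.self_of_nhds (by rw [γ0]; norm_num))
  have hm : ∀ᶠ t in 𝓝 (0 : ℝ), u t ≤ u 0 := by
    filter_upwards [ep, es, eγ, hmax] with t h1 h2 h3 h4
    have := Real.log_le_log (by positivity) h4
    rw [Real.log_mul (by positivity) (by positivity), Real.log_mul (by positivity) (by positivity),
      Real.log_mul (by positivity) (by positivity), Real.log_pow, Real.log_pow] at this
    simp only [u, γ0, Real.log_one]
    linarith
  obtain ⟨a1, a2⟩ := second_deriv_nonpos_of_isLocalMax hm hu hu2
  simp only [u', γ0, γ0'] at a1 a2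
  -- The first-order condition expresses `s' 0` through `p' 0`; the square of this is the source of
  -- the `P ^ 2` in the conclusion.
  have hs' : s' 0 = -(P * p' 0 * s 0 / p 0) := by
    field_simp at a1 ⊢
    linarith
  rw [hs'] at a2
  have e : p 0 ^ 2 * (s2 - s 0 * γ2) - s 0 * ((P + P ^ 2) * p' 0 ^ 2 - P * p 0 * p2) =
      (p 0 ^ 2 * s 0) * (P * ((p2 * p 0 - p' 0 * p' 0) / p 0 ^ 2)
      + (s2 * s 0 - -(P * p' 0 * s 0 / p 0) * -(P * p' 0 * s 0 / p 0)) / s 0 ^ 2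
        - (γ2 * 1 - 0 * 0) / 1 ^ 2) := by
    field_simp
    ring
  have : (p 0 ^ 2 * s 0) * (P * ((p2 * p 0 - p' 0 * p' 0) / p 0 ^ 2)
      + (s2 * s 0 - -(P * p' 0 * s 0 / p 0) * -(P * p' 0 * s 0 / p 0)) / s 0 ^ 2
        - (γ2 * 1 - 0 * 0) / 1 ^ 2) ≤ 0 := mul_nonpos_of_nonneg_of_nonpos (by positivity) a2
  linarith

variable {V W : Type*} [NormedAddCommGroup V] [NormedSpace ℝ V]
  [NormedAddCommGroup W] [NormedSpace ℝ W]

/-- First and second derivatives of `t ↦ B (c t) (u t) (u t)` along a curve. -/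
theorem hasDerivAt_bilin_curve {B : V → V →L[ℝ] V →L[ℝ] ℝ} {c c' u u' : ℝ → V} {c2 u2 : V}
    (hB : ContDiffAt ℝ 2 B (c 0))
    (hc : ∀ᶠ t in 𝓝 (0 : ℝ), HasDerivAt c (c' t) t) (hu : ∀ᶠ t in 𝓝 (0 : ℝ), HasDerivAt u (u' t) t)
    (hc2 : HasDerivAt c' c2 0) (hu2 : HasDerivAt u' u2 0) :
    (∀ᶠ t in 𝓝 (0 : ℝ), HasDerivAt (fun t => B (c t) (u t) (u t))
      (fderiv ℝ B (c t) (c' t) (u t) (u t) + B (c t) (u' t) (u t) + B (c t) (u t) (u' t)) t) ∧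
    HasDerivAt (fun t => fderiv ℝ B (c t) (c' t) (u t) (u t) + B (c t) (u' t) (u t)
        + B (c t) (u t) (u' t))
      (fderiv ℝ (fderiv ℝ B) (c 0) (c' 0) (c' 0) (u 0) (u 0) + fderiv ℝ B (c 0) c2 (u 0) (u 0)
        + 2 * (fderiv ℝ B (c 0) (c' 0) (u' 0) (u 0) + fderiv ℝ B (c 0) (c' 0) (u 0) (u' 0))
        + 2 * B (c 0) (u' 0) (u' 0) + B (c 0) u2 (u 0) + B (c 0) (u 0) u2) 0 := by
  have hcc := hc.self_of_nhds.continuousAt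
  have hB1 : ∀ᶠ t in 𝓝 (0 : ℝ), DifferentiableAt ℝ B (c t) :=
    hcc.eventually ((hB.eventually (by simp)).mono fun y hy => hy.differentiableAt (by simp))
  have hBd : ∀ᶠ t in 𝓝 (0 : ℝ), HasDerivAt (fun t => B (c t)) (fderiv ℝ B (c t) (c' t)) t := by
    filter_upwards [hc, hB1] with t h1 h2
    exact h2.hasFDerivAt.comp_hasDerivAt t h1
  have hfB : HasDerivAt (fun t => fderiv ℝ B (c t)) (fderiv ℝ (fderiv ℝ B) (c 0) (c' 0)) 0 := by
    have : ContDiffAt ℝ 1 (fderiv ℝ B) (c 0) := hB.fderiv_right (by norm_num)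
    exact (this.differentiableAt (by simp)).hasFDerivAt.comp_hasDerivAt 0 hc.self_of_nhds
  refine ⟨?_, ?_⟩
  · filter_upwards [hBd, hu] with t h1 h2
    refine ((h1.clm_apply h2).clm_apply h2).congr_deriv ?_
    simp
  · have hc0 := hc.self_of_nhds
    have hu0 := hu.self_of_nhds
    have hb0 := hBd.self_of_nhds
    refine ((((((hfB.clm_apply hc2).clm_apply hu0).clm_apply hu0)).add
      ((hb0.clm_apply hu2).clm_apply hu0)).add ((hb0.clm_apply hu0).clm_apply hu2)).congr_deriv ?_
    simp
    ring

end Calculus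

/-! ### The algebraic curvature estimate at a single point. -/

section Pointwise

variable {V : Type*} [NormedAddCommGroup V] [NormedSpace ℝ V]

/-- The seminorm of a positive semidefinite bilinear form. -/
def formNorm (A : V →L[ℝ] V →L[ℝ] ℝ) (v : V) : ℝ := Real.sqrt (A v v)

theorem formNorm_nonneg (A : V →L[ℝ] V →L[ℝ] ℝ) (v : V) : 0 ≤ formNorm A v := Real.sqrt_nonneg _

theorem formNorm_sq {A : V →L[ℝ] V →L[ℝ] ℝ} (hA : ∀ v, 0 ≤ A v v) (v : V) :
    formNorm A v ^ 2 = A v v := Real.sq_sqrt (hA v)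

/-- Take `w = v`. This converts bounds on pairings such as `A (Γ u v) w` into bounds on the length
of `Γ u v`. -/
theorem formNorm_le_of_forall_le {A : V →L[ℝ] V →L[ℝ] ℝ} (hA : ∀ v, 0 ≤ A v v) {v : V} {c : ℝ}
    (hc : 0 ≤ c) (h : ∀ w, |A v w| ≤ c * formNorm A w) : formNorm A v ≤ c := by
  have h1 := h v
  rw [abs_of_nonneg (hA v), ← formNorm_sq hA] at h1
  by_contra! hlt
  have : 0 < formNorm A v := hc.trans_lt hlt
  nlinarith

/-- The scalar curvature-type expression `-g(R(u, b) u, b)`, with `R` in terms of Christoffel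
symbols and their derivatives. -/
def curvTerm (G : V →L[ℝ] V →L[ℝ] ℝ) (Γ : V →L[ℝ] V →L[ℝ] V) (dΓ : V →L[ℝ] V →L[ℝ] V →L[ℝ] V)
    (u b : V) : ℝ :=
  -G (dΓ u b u - dΓ b u u + Γ u (Γ b u) - Γ b (Γ u u)) b

/-- The constant of the curvature estimate, in terms of bounds `K`, `c₁`, `c₂` for the data,
for the Christoffel symbols and for their derivatives. -/
def curvConst (n P : ℕ) (K c₁ c₂ : ℝ) : ℝ :=
  n * (K / 2 + c₂ + K * c₁ / 2 + (K + c₁) ^ 2) * K ^ 2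
    + n * ((P + P ^ 2) * K ^ 2 + P * K ^ 2 * (1 + c₁)) / 2

/-- Here `E`, `X`, `Z`, `W` stand for `∂ₖF`, `∂ₖ∂_top F`, `∂ₖ∂ₖF` and `∂ₖ∂ₖ∂_top F`, so the argument
of the last `G` in `hγ2` is `∇ₖ∇ₖ∂_top F`. Commuting derivatives and substituting the mean curvature
equation (`hZ`) and its derivative (`hW`) removes the third derivatives and leaves `curvTerm`. -/
theorem sum_second_deriv_eq {n : ℕ} {G : V →L[ℝ] V →L[ℝ] ℝ} {Γ : V →L[ℝ] V →L[ℝ] V}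
    {dΓ : V →L[ℝ] V →L[ℝ] V →L[ℝ] V} (hΓ : ∀ u v, Γ u v = Γ v u)
    (hdΓ : ∀ u v w, dΓ u v w = dΓ u w v) {E X Z W : Fin n → V} {top : Fin n} {θ γ2 : Fin n → ℝ}
    (hG : ∀ l, G (E l) (E top) = if l = top then 1 else 0)
    (hZ : ∑ k, Z k = -∑ k, Γ (E k) (E k))
    (hW : ∑ k, W k = ∑ l, θ l • E l - ∑ k, (dΓ (E top) (E k) (E k) + (2 : ℝ) • Γ (X k) (E k)))
    (hγ2 : ∀ k, γ2 k = 2 * (G (X k + Γ (E k) (E top)) (X k + Γ (E k) (E top))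
      + G (W k + (2 : ℝ) • Γ (E k) (X k) + Γ (Z k) (E top) + dΓ (E k) (E k) (E top)
        + Γ (E k) (Γ (E k) (E top))) (E top))) :
    ∑ k, γ2 k = 2 * (∑ k, G (X k + Γ (E k) (E top)) (X k + Γ (E k) (E top)) + θ top
      - ∑ k, curvTerm G Γ dΓ (E k) (E top)) := by
  -- By orthonormality only the coefficient `θ top` of the tangential part is seen.
  have h1 : ∑ k, G (W k) (E top) = θ top - ∑ k, (G (dΓ (E top) (E k) (E k)) (E top)
      + 2 * G (Γ (X k) (E k)) (E top)) := by
    have := congrArg (fun v => G v (E top)) hW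
    simpa [hG] using this
  have h2 : ∑ k, G (Γ (Z k) (E top)) (E top) = -∑ k, G (Γ (Γ (E k) (E k)) (E top)) (E top) := by
    have := congrArg (fun v => G (Γ v (E top)) (E top)) hZ
    simpa using this
  have h3 : ∑ k, γ2 k = 2 * (∑ k, G (X k + Γ (E k) (E top)) (X k + Γ (E k) (E top))
      + (∑ k, G (W k) (E top) + ∑ k, G (Γ (Z k) (E top)) (E top)
      + ∑ k, (2 * G (Γ (E k) (X k)) (E top) + G (dΓ (E k) (E k) (E top)) (E top)
        + G (Γ (E k) (Γ (E k) (E top))) (E top)))) := by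
    simp only [hγ2, ← Finset.mul_sum, ← Finset.sum_add_distrib]
    congr 1
    refine Finset.sum_congr rfl fun k _ => ?_
    simp only [map_add, add_apply, map_smul, smul_apply, smul_eq_mul]
    ring
  rw [h3, h1, h2]
  congr 1
  rw [add_sub_assoc]
  congr 1
  rw [sub_eq_add_neg, sub_eq_add_neg, ← Finset.sum_neg_distrib, ← Finset.sum_neg_distrib,
    ← Finset.sum_neg_distrib, add_assoc, add_assoc, ← Finset.sum_add_distrib,
    ← Finset.sum_add_distrib]
  congr 1
  refine Finset.sum_congr rfl fun k _ => ?_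
  simp only [curvTerm, map_add, map_sub, add_apply, sub_apply]
  rw [hΓ (X k) (E k), hΓ (Γ (E k) (E k)) (E top), hΓ (E top) (E k), hdΓ (E k) (E top) (E k)]
  ring

set_option maxHeartbeats 1000000 in
-- Summing `htest` over `k`, the unknown `θ top` occurs as `2 * θ top * A (E top) (E top)` in both
-- `∑ s2` and `A (E top) (E top) * ∑ γ2`, and drops out. The normal terms in `γ2` have a favourable
-- sign by `hI`, and the positive terms `2 * A (X k) (X k)` in `s2` dominate everything linear in
-- the unbounded vectors `X k`.
theorem sum_curvTerm_le {n : ℕ} (P : ℕ) {G A : V →L[ℝ] V →L[ℝ] ℝ} {Γ : V →L[ℝ] V →L[ℝ] V}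
    {dΓ : V →L[ℝ] V →L[ℝ] V →L[ℝ] V} {dA : V →L[ℝ] V →L[ℝ] V →L[ℝ] ℝ}
    {d2A : V →L[ℝ] V →L[ℝ] V →L[ℝ] V →L[ℝ] ℝ} {dφ : V →L[ℝ] ℝ} {d2φ : V →L[ℝ] V →L[ℝ] ℝ}
    {φ₀ K c₁ c₂ : ℝ} (hΓ : ∀ u v, Γ u v = Γ v u) (hdΓ : ∀ u v w, dΓ u v w = dΓ u w v)
    (hA : ∀ v, 0 ≤ A v v) {E X Z W : Fin n → V} {top : Fin n} {θ γ2 s2 : Fin n → ℝ}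
    (hG : ∀ l, G (E l) (E top) = if l = top then 1 else 0)
    (hAE : ∀ l, l ≠ top → A (E l) (E top) = 0)
    (hmax : ∀ l, A (E l) (E l) ≤ A (E top) (E top)) (hpos : 0 < A (E top) (E top))
    (hI : ∀ k, G (X k + Γ (E k) (E top)) (X k + Γ (E k) (E top)) ≤ 0)
    (hZ : ∑ k, Z k = -∑ k, Γ (E k) (E k))
    (hW : ∑ k, W k = ∑ l, θ l • E l - ∑ k, (dΓ (E top) (E k) (E k) + (2 : ℝ) • Γ (X k) (E k)))
    (hγ2 : ∀ k, γ2 k = 2 * (G (X k + Γ (E k) (E top)) (X k + Γ (E k) (E top))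
      + G (W k + (2 : ℝ) • Γ (E k) (X k) + Γ (Z k) (E top) + dΓ (E k) (E k) (E top)
        + Γ (E k) (Γ (E k) (E top))) (E top)))
    (hs2 : ∀ k, s2 k = d2A (E k) (E k) (E top) (E top) + dA (Z k) (E top) (E top)
      + 4 * dA (E k) (X k) (E top) + 2 * A (X k) (X k) + 2 * A (W k) (E top))
    (htest : ∀ k, φ₀ ^ 2 * (s2 k - A (E top) (E top) * γ2 k) ≤ A (E top) (E top) *
      ((P + P ^ 2) * dφ (E k) ^ 2 - P * φ₀ * (d2φ (E k) (E k) + dφ (Z k))))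
    (hφ₀ : 0 < φ₀) (hφK : φ₀ ≤ K) (hc₁ : 0 ≤ c₁) (hc₂ : 0 ≤ c₂)
    (bΓ : ∀ u v w, |A (Γ u v) w| ≤ c₁ * formNorm A u * formNorm A v * formNorm A w)
    (bdΓ : ∀ u v w z, |A (dΓ u v w) z| ≤
      c₂ * formNorm A u * formNorm A v * formNorm A w * formNorm A z)
    (bdA : ∀ u v w, |dA u v w| ≤ K * formNorm A u * formNorm A v * formNorm A w)
    (bd2A : ∀ u v w z, |d2A u v w z| ≤
      K * formNorm A u * formNorm A v * formNorm A w * formNorm A z)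
    (bdφ : ∀ u, |dφ u| ≤ K * formNorm A u)
    (bd2φ : ∀ u v, |d2φ u v| ≤ K * formNorm A u * formNorm A v) :
    ∑ k, curvTerm G Γ dΓ (E k) (E top) ≤
      curvConst n P K c₁ c₂ * (φ₀ ^ 2)⁻¹ * A (E top) (E top) := by
  set b := E top with hb
  set s₀ := A b b with hs₀
  set σ := formNorm A b with hσ
  have hσ2 : σ ^ 2 = s₀ := formNorm_sq hA b
  have hσ0 : 0 ≤ σ := formNorm_nonneg A b
  have hK : 0 ≤ K := hφ₀.le.trans hφK
  have hqΓ : ∀ u v, formNorm A (Γ u v) ≤ c₁ * formNorm A u * formNorm A v := fun u v =>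
    formNorm_le_of_forall_le hA (mul_nonneg (mul_nonneg hc₁ (formNorm_nonneg A u))
      (formNorm_nonneg A v)) (bΓ u v)
  -- Maximality of the top eigenvalue lets every frame vector be measured by `s₀`.
  have hr2 : ∀ k, formNorm A (E k) ^ 2 ≤ s₀ := fun k => by rw [formNorm_sq hA]; exact hmax k
  have hqΓE : ∀ k, formNorm A (Γ (E k) (E k)) ≤ c₁ * s₀ := fun k => by
    have h1 := hqΓ (E k) (E k)
    have h2 := mul_le_mul_of_nonneg_left (hr2 k) hc₁
    nlinarith
  have hγsum := sum_second_deriv_eq hΓ hdΓ hG hZ hW hγ2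
  have hIsum : ∑ k, G (X k + Γ (E k) b) (X k + Γ (E k) b) ≤ 0 := Finset.sum_nonpos fun k _ => hI k
  -- the sum of the second derivatives of `s`
  have hdAZ : ∑ k, dA (Z k) b b = -∑ k, dA (Γ (E k) (E k)) b b := by
    have := congrArg (fun v => dA v b b) hZ
    simpa using this
  have hdφZ : ∑ k, dφ (Z k) = -∑ k, dφ (Γ (E k) (E k)) := by
    have := congrArg (fun v => dφ v) hZ
    simpa using this
  have hAW : ∑ k, A (W k) b = θ top * s₀ - ∑ k, (A (dΓ b (E k) (E k)) b
      + 2 * A (Γ (X k) (E k)) b) := by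
    have := congrArg (fun v => A v b) hW
    -- Diagonality of `A` in the frame is what removes the other `θ l`, which are equally
    -- uncontrolled.
    have h2 : ∑ l, θ l * A (E l) b = θ top * s₀ := by
      rw [Finset.sum_eq_single top]
      · intro l _ hl; rw [hAE l hl, mul_zero]
      · simp
    simp only [map_sub, map_sum, map_add, map_smul, sub_apply, sum_apply,
      add_apply, smul_apply, smul_eq_mul, h2] at this
    exact this
  have hssum : ∑ k, s2 k = 2 * θ top * s₀ + ∑ k, (d2A (E k) (E k) b b - dA (Γ (E k) (E k)) b b
      + 4 * dA (E k) (X k) b + 2 * A (X k) (X k) - 2 * A (dΓ b (E k) (E k)) b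
      - 4 * A (Γ (X k) (E k)) b) := by
    simp only [hs2, Finset.sum_add_distrib, Finset.sum_sub_distrib, ← Finset.mul_sum, hdAZ, hAW]
    ring
  -- Half the sum of the error coefficients: `K` from `d2A`, `K * c₁` from `dA` on `Γ`, `2 * c₂`
  -- from `dΓ`, and `2 * (K + c₁) ^ 2` from completing the square in `X k`.
  set c₃ := K / 2 + c₂ + K * c₁ / 2 + (K + c₁) ^ 2 with hc₃
  have hterm : ∀ k, -(2 * c₃ * s₀ ^ 2) ≤ d2A (E k) (E k) b b - dA (Γ (E k) (E k)) b b
      + 4 * dA (E k) (X k) b + 2 * A (X k) (X k) - 2 * A (dΓ b (E k) (E k)) b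
      - 4 * A (Γ (X k) (E k)) b := fun k => by
    set r := formNorm A (E k)
    set x := formNorm A (X k)
    have hr0 : 0 ≤ r := formNorm_nonneg A _
    have hx0 : 0 ≤ x := formNorm_nonneg A _
    have hrk : r ^ 2 ≤ s₀ := hr2 k
    have hrs : r ^ 2 * s₀ ≤ s₀ ^ 2 := by rw [sq s₀]; exact mul_le_mul_of_nonneg_right hrk hpos.le
    have hx2 : x ^ 2 = A (X k) (X k) := formNorm_sq hA _
    have e1 : -(K * s₀ ^ 2) ≤ d2A (E k) (E k) b b := by
      have h := (abs_le.mp (bd2A (E k) (E k) b b)).1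
      have : K * r * r * σ * σ = K * (r ^ 2 * s₀) := by rw [← hσ2]; ring
      have h3 := mul_le_mul_of_nonneg_left hrs hK
      change -(K * r * r * σ * σ) ≤ _ at h
      linarith
    have e2 : dA (Γ (E k) (E k)) b b ≤ K * c₁ * s₀ ^ 2 := by
      have h := (abs_le.mp (bdA (Γ (E k) (E k)) b b)).2
      have h2 : K * formNorm A (Γ (E k) (E k)) * σ * σ = K * s₀ * formNorm A (Γ (E k) (E k)) := by
        rw [← hσ2]; ring
      have h3 := mul_le_mul_of_nonneg_left (hqΓE k) (mul_nonneg hK hpos.le)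
      change _ ≤ K * formNorm A (Γ (E k) (E k)) * σ * σ at h
      nlinarith
    have e3 : -(K * r * x * σ) ≤ dA (E k) (X k) b := (abs_le.mp (bdA (E k) (X k) b)).1
    have e4 : A (dΓ b (E k) (E k)) b ≤ c₂ * s₀ ^ 2 := by
      have h := (abs_le.mp (bdΓ b (E k) (E k) b)).2
      have : c₂ * σ * r * r * σ = c₂ * (r ^ 2 * s₀) := by rw [← hσ2]; ring
      have h3 := mul_le_mul_of_nonneg_left hrs hc₂
      change _ ≤ c₂ * σ * r * r * σ at h
      linarith
    have e5 : A (Γ (X k) (E k)) b ≤ c₁ * x * r * σ := (abs_le.mp (bΓ (X k) (E k) b)).2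
    -- The cross terms add up to at most `4 * (K + c₁) * r * x * σ` in absolute value; twice this
    -- square absorbs them into `2 * x ^ 2`.
    have e6 := sq_nonneg (x - (K + c₁) * r * σ)
    have e7 : (K + c₁) ^ 2 * (r ^ 2 * s₀) ≤ (K + c₁) ^ 2 * s₀ ^ 2 :=
      mul_le_mul_of_nonneg_left hrs (sq_nonneg _)
    have e8 : (x - (K + c₁) * r * σ) ^ 2 = x ^ 2 - 2 * (K + c₁) * x * r * σ
        + (K + c₁) ^ 2 * (r ^ 2 * s₀) := by rw [← hσ2]; ring
    rw [← hx2, hc₃]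
    nlinarith
  have hslow : 2 * θ top * s₀ - n * (2 * c₃ * s₀ ^ 2) ≤ ∑ k, s2 k := by
    rw [hssum]
    have := Finset.sum_le_sum fun k (_ : k ∈ Finset.univ) => hterm k
    simp only [Finset.sum_const, Finset.card_univ, Fintype.card_fin, nsmul_eq_mul] at this
    linarith
  have hp1 : ∀ k, dφ (E k) ^ 2 ≤ K ^ 2 * s₀ := fun k => by
    have h := bdφ (E k)
    have h2 : dφ (E k) ^ 2 ≤ (K * formNorm A (E k)) ^ 2 := by
      rw [← sq_abs (dφ (E k))]; exact pow_le_pow_left₀ (abs_nonneg _) h 2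
    have h3 := mul_le_mul_of_nonneg_left (hr2 k) (sq_nonneg K)
    rw [mul_pow] at h2
    linarith
  have hp1s : ∑ k, dφ (E k) ^ 2 ≤ n * (K ^ 2 * s₀) := by
    have := Finset.sum_le_sum fun k (_ : k ∈ Finset.univ) => hp1 k
    simpa using this
  have hp2 : ∀ k, -(K * (1 + c₁) * s₀) ≤ d2φ (E k) (E k) - dφ (Γ (E k) (E k)) := fun k => by
    have h := (abs_le.mp (bd2φ (E k) (E k))).1
    have h2 := (abs_le.mp (bdφ (Γ (E k) (E k)))).2
    have h3 := mul_le_mul_of_nonneg_left (hr2 k) hK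
    have h4 := mul_le_mul_of_nonneg_left (hqΓE k) hK
    nlinarith
  have hp2s : -(n * (K * (1 + c₁) * s₀)) ≤ ∑ k, (d2φ (E k) (E k) + dφ (Z k)) := by
    have := Finset.sum_le_sum fun k (_ : k ∈ Finset.univ) => hp2 k
    rw [Finset.sum_add_distrib, hdφZ, ← sub_eq_add_neg, ← Finset.sum_sub_distrib]
    simp only [Finset.sum_const, Finset.card_univ, Fintype.card_fin, nsmul_eq_mul] at this
    linarith
  have htests : φ₀ ^ 2 * (∑ k, s2 k - s₀ * ∑ k, γ2 k) ≤ s₀ * ((P + P ^ 2) * ∑ k, dφ (E k) ^ 2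
      - P * φ₀ * ∑ k, (d2φ (E k) (E k) + dφ (Z k))) := by
    have := Finset.sum_le_sum fun k (_ : k ∈ Finset.univ) => htest k
    rw [← Finset.mul_sum, ← Finset.mul_sum] at this
    simpa only [Finset.sum_sub_distrib, ← Finset.mul_sum] using this
  set R := ∑ k, curvTerm G Γ dΓ (E k) b with hR
  have hP : (0 : ℝ) ≤ P := P.cast_nonneg
  have hn : (0 : ℝ) ≤ n := n.cast_nonneg
  -- The `θ top` terms cancel here, and the nonpositive sum `hIsum` is discarded.
  have f1 : 2 * s₀ * R - n * (2 * c₃ * s₀ ^ 2) ≤ ∑ k, s2 k - s₀ * ∑ k, γ2 k := by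
    rw [hγsum]
    have := mul_nonneg hpos.le (neg_nonneg.mpr hIsum)
    nlinarith
  have f2 : φ₀ ^ 2 * (2 * s₀ * R - n * (2 * c₃ * s₀ ^ 2)) ≤
      s₀ * ((P + P ^ 2) * (n * (K ^ 2 * s₀)) + P * φ₀ * (n * (K * (1 + c₁) * s₀))) := by
    refine (mul_le_mul_of_nonneg_left f1 (sq_nonneg φ₀)).trans (htests.trans ?_)
    refine mul_le_mul_of_nonneg_left ?_ hpos.le
    have g1 := mul_le_mul_of_nonneg_left hp1s (by positivity : (0 : ℝ) ≤ P + P ^ 2)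
    have g2 := mul_le_mul_of_nonneg_left hp2s (by positivity : (0 : ℝ) ≤ P * φ₀)
    linarith
  have hφ2 : φ₀ ^ 2 ≤ K ^ 2 := pow_le_pow_left₀ hφ₀.le hφK 2
  have hc₃0 : 0 ≤ c₃ := by positivity
  have f3 : φ₀ ^ 2 * R ≤ curvConst n P K c₁ c₂ * s₀ := by
    have h4 : φ₀ ^ 2 * (n * c₃ * s₀) ≤ K ^ 2 * (n * c₃ * s₀) :=
      mul_le_mul_of_nonneg_right hφ2 (by positivity)
    have h5 : P * φ₀ * (n * (K * (1 + c₁) * s₀)) ≤ P * K * (n * (K * (1 + c₁) * s₀)) := by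
      gcongr
    have h6 : φ₀ ^ 2 * (2 * R - n * (2 * c₃ * s₀)) ≤
        (P + P ^ 2) * (n * (K ^ 2 * s₀)) + P * φ₀ * (n * (K * (1 + c₁) * s₀)) := by
      -- Every term of `f2` carries a factor `s₀`, which is divided out.
      refine le_of_mul_le_mul_left ?_ hpos
      linarith
    have : curvConst n P K c₁ c₂ = n * c₃ * K ^ 2
        + n * ((P + P ^ 2) * K ^ 2 + P * K ^ 2 * (1 + c₁)) / 2 := rfl
    rw [this]
    linarith
  have hφ2p : 0 < φ₀ ^ 2 := by positivity
  calc R = (φ₀ ^ 2)⁻¹ * (φ₀ ^ 2 * R) := by field_simp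
    _ ≤ (φ₀ ^ 2)⁻¹ * (curvConst n P K c₁ c₂ * s₀) :=
        mul_le_mul_of_nonneg_left f3 (inv_nonneg.mpr hφ2p.le)
    _ = _ := by ring

end Pointwise

/-! ### Higher derivatives along lines, metric compatibility, and the differentiated mean curvature
equation. -/

section Jets

variable {V W : Type*} [NormedAddCommGroup V] [NormedSpace ℝ V]
  [NormedAddCommGroup W] [NormedSpace ℝ W]

theorem hasDerivAt_smul_const_right (a : W) (t : ℝ) : HasDerivAt (fun t : ℝ => t • a) a t := by
  simpa using (hasDerivAt_id t).smul_const a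

theorem tendsto_smul_nhds_zero (a : W) : Tendsto (fun t : ℝ => t • a) (𝓝 0) (𝓝 0) := by
  have := (hasDerivAt_smul_const_right a 0).continuousAt.tendsto
  simpa using this

theorem hasDerivAt_comp_line {L : W → V} {a : W} {t : ℝ} (h : DifferentiableAt ℝ L (t • a)) :
    HasDerivAt (fun t : ℝ => L (t • a)) (fderiv ℝ L (t • a) a) t :=
  h.hasFDerivAt.comp_hasDerivAt t (hasDerivAt_smul_const_right a t)

/-- Derivatives of a map and of its differential along a line through `0`. -/
theorem hasDerivAt_line_jets {F : W → V} (hF : ContDiffAt ℝ 3 F 0) (a b : W) :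
    (∀ᶠ t in 𝓝 (0 : ℝ), HasDerivAt (fun t : ℝ => F (t • a)) (fderiv ℝ F (t • a) a) t) ∧
    (∀ᶠ t in 𝓝 (0 : ℝ), HasDerivAt (fun t : ℝ => fderiv ℝ F (t • a) b)
      (fderiv ℝ (fderiv ℝ F) (t • a) a b) t) ∧
    HasDerivAt (fun t : ℝ => fderiv ℝ (fderiv ℝ F) (t • a) a b)
      (fderiv ℝ (fderiv ℝ (fderiv ℝ F)) 0 a a b) 0 := by
  have h1 : ContDiffAt ℝ 2 (fderiv ℝ F) 0 := hF.fderiv_right (by norm_num)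
  have h2 : ContDiffAt ℝ 1 (fderiv ℝ (fderiv ℝ F)) 0 := h1.fderiv_right (by norm_num)
  refine ⟨?_, ?_, ?_⟩
  · filter_upwards [(tendsto_smul_nhds_zero a).eventually (hF.eventually (by simp))] with t ht
    exact hasDerivAt_comp_line (ht.differentiableAt (by simp))
  · filter_upwards [(tendsto_smul_nhds_zero a).eventually (h1.eventually (by simp))] with t ht
    have h3 := hasDerivAt_comp_line (ht.differentiableAt (by simp))
    refine (h3.clm_apply (hasDerivAt_const t b)).congr_deriv ?_
    rw [map_zero, add_zero]
  · have h3 : DifferentiableAt ℝ (fderiv ℝ (fderiv ℝ F)) ((0 : ℝ) • a) := by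
      rw [zero_smul]; exact h2.differentiableAt (by simp)
    have h4 := hasDerivAt_comp_line h3
    refine ((h4.clm_apply (hasDerivAt_const 0 a)).clm_apply (hasDerivAt_const 0 b)).congr_deriv ?_
    simp only [map_zero, add_zero, zero_smul]

theorem fderiv_fderiv_symm {F : W → V} {x : W} (hF : ContDiffAt ℝ 2 F x) (a b : W) :
    fderiv ℝ (fderiv ℝ F) x a b = fderiv ℝ (fderiv ℝ F) x b a :=
  (hF.isSymmSndFDerivAt (by simp)) a b

/-- The first two slots are exchanged by the symmetry theorem applied to `fderiv ℝ F`; the last two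
by differentiating the symmetry of the second derivative, valid near `0`. -/
theorem fderiv_fderiv_fderiv_symm {F : W → V} (hF : ContDiffAt ℝ 3 F 0) (a b : W) :
    fderiv ℝ (fderiv ℝ (fderiv ℝ F)) 0 b a a = fderiv ℝ (fderiv ℝ (fderiv ℝ F)) 0 a a b := by
  have h1 : ContDiffAt ℝ 2 (fderiv ℝ F) 0 := hF.fderiv_right (by norm_num)
  have h2 : ContDiffAt ℝ 1 (fderiv ℝ (fderiv ℝ F)) 0 := h1.fderiv_right (by norm_num)
  rw [fderiv_fderiv_symm h1 b a]
  have hd : HasFDerivAt (fderiv ℝ (fderiv ℝ F)) (fderiv ℝ (fderiv ℝ (fderiv ℝ F)) 0) 0 :=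
    (h2.differentiableAt (by simp)).hasFDerivAt
  have e1 := (hd.clm_apply (hasFDerivAt_const b 0)).clm_apply (hasFDerivAt_const a 0)
  have e2 := (hd.clm_apply (hasFDerivAt_const a 0)).clm_apply (hasFDerivAt_const b 0)
  have heq : (fun x => fderiv ℝ (fderiv ℝ F) x b a) =ᶠ[𝓝 0]
      fun x => fderiv ℝ (fderiv ℝ F) x a b := by
    filter_upwards [hF.eventually (by simp)] with x hx
    exact fderiv_fderiv_symm (hx.of_le (by norm_num)) b a
  have := congrArg (fun L => L a) (e1.unique (e2.congr_of_eventuallyEq heq))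
  simpa using this

/-- The second derivative of a metric in terms of the Christoffel symbols. -/
theorem fderiv_fderiv_eq_of_compat {G : V → V →L[ℝ] V →L[ℝ] ℝ} {Γ : V → V →L[ℝ] V →L[ℝ] V} {y : V}
    (hG : ContDiffAt ℝ 2 G y) (hΓ : DifferentiableAt ℝ Γ y)
    (hcompat : ∀ᶠ z in 𝓝 y, ∀ u v w, fderiv ℝ G z u v w = G z (Γ z u v) w + G z v (Γ z u w))
    (u' u v w : V) :
    fderiv ℝ (fderiv ℝ G) y u' u v w = fderiv ℝ G y u' (Γ y u v) w + G y (fderiv ℝ Γ y u' u v) w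
      + (fderiv ℝ G y u' v (Γ y u w) + G y v (fderiv ℝ Γ y u' u w)) := by
  have hd : HasFDerivAt (fderiv ℝ G) (fderiv ℝ (fderiv ℝ G) y) y :=
    ((hG.fderiv_right (m := 1) (by norm_num)).differentiableAt (by simp)).hasFDerivAt
  have hGd : HasFDerivAt G (fderiv ℝ G y) y := (hG.differentiableAt (by simp)).hasFDerivAt
  have c : ∀ v : V, HasFDerivAt (fun _ : V => v) (0 : V →L[ℝ] V) y := fun v => hasFDerivAt_const v y
  have e1 := ((hd.clm_apply (c u)).clm_apply (c v)).clm_apply (c w)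
  have e2 := (hGd.clm_apply ((hΓ.hasFDerivAt.clm_apply (c u)).clm_apply (c v))).clm_apply (c w)
  have e3 := (hGd.clm_apply (c v)).clm_apply ((hΓ.hasFDerivAt.clm_apply (c u)).clm_apply (c w))
  have heq : (fun z => fderiv ℝ G z u v w) =ᶠ[𝓝 y]
      fun z => G z (Γ z u v) w + G z v (Γ z u w) := hcompat.mono fun z hz => hz u v w
  have := congrArg (fun L => L u') (e1.unique ((e2.add e3).congr_of_eventuallyEq heq))
  simp only [add_apply, ContinuousLinearMap.comp_zero, zero_add, ContinuousLinearMap.flip_apply,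
    ContinuousLinearMap.comp_apply] at this
  rw [this]
  ring

/-- The second derivative of the induced metric in terms of covariant derivatives. -/
theorem second_deriv_metric_eq {G : V → V →L[ℝ] V →L[ℝ] ℝ} {Γ : V → V →L[ℝ] V →L[ℝ] V} {y : V}
    (hG : ContDiffAt ℝ 2 G y) (hΓ : DifferentiableAt ℝ Γ y)
    (hcompat : ∀ᶠ z in 𝓝 y, ∀ u v w, fderiv ℝ G z u v w = G z (Γ z u v) w + G z v (Γ z u w))
    (hsymm : ∀ u v, G y u v = G y v u) (a b X Z W : V) :
    fderiv ℝ (fderiv ℝ G) y a a b b + fderiv ℝ G y Z b b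
        + 2 * (fderiv ℝ G y a X b + fderiv ℝ G y a b X)
        + 2 * G y X X + G y W b + G y b W =
      2 * (G y (X + Γ y a b) (X + Γ y a b) + G y (W + (2 : ℝ) • Γ y a X + Γ y Z b
        + fderiv ℝ Γ y a a b + Γ y a (Γ y a b)) b) := by
  rw [fderiv_fderiv_eq_of_compat hG hΓ hcompat]
  simp only [hcompat.self_of_nhds, map_add, add_apply, map_smul, smul_apply, smul_eq_mul]
  rw [hsymm b W, hsymm b (Γ y Z b), hsymm b (Γ y a X), hsymm (Γ y a b) X,
    hsymm b (Γ y a (Γ y a b)), hsymm b (fderiv ℝ Γ y a a b)]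
  ring

/-- First-order information at `0` from the equation of vanishing mean curvature near `0`. -/
theorem mean_curvature_jets {n : ℕ} {F : W → V} {Γ : V → V →L[ℝ] V →L[ℝ] V}
    (hF : ContDiffAt ℝ 3 F 0) (hΓ : DifferentiableAt ℝ Γ (F 0))
    (hΓs : ∀ u v, Γ (F 0) u v = Γ (F 0) v u) {e : Fin n → W}
    {a : Fin n → Fin n → W → ℝ} {τ : Fin n → W → ℝ}
    (ha : ∀ i j, HasFDerivAt (a i j) (0 : W →L[ℝ] ℝ) 0) (ha0 : ∀ i j, a i j 0 = if i = j then 1 else 0)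
    (hτ : ∀ l, DifferentiableAt ℝ (τ l) 0) (hτ0 : ∀ l, τ l 0 = 0)
    (hmean : ∀ᶠ x in 𝓝 (0 : W), ∑ i, ∑ j, a i j x • (fderiv ℝ (fderiv ℝ F) x (e i) (e j)
      + Γ (F x) (fderiv ℝ F x (e i)) (fderiv ℝ F x (e j))) = ∑ l, τ l x • fderiv ℝ F x (e l))
    (b : W) :
    ∑ k, fderiv ℝ (fderiv ℝ F) 0 (e k) (e k) =
      -∑ k, Γ (F 0) (fderiv ℝ F 0 (e k)) (fderiv ℝ F 0 (e k)) ∧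
    ∑ k, fderiv ℝ (fderiv ℝ (fderiv ℝ F)) 0 (e k) (e k) b =
      ∑ l, fderiv ℝ (τ l) 0 b • fderiv ℝ F 0 (e l)
      - ∑ k, (fderiv ℝ Γ (F 0) (fderiv ℝ F 0 b) (fderiv ℝ F 0 (e k)) (fderiv ℝ F 0 (e k))
        + (2 : ℝ) • Γ (F 0) (fderiv ℝ (fderiv ℝ F) 0 (e k) b) (fderiv ℝ F 0 (e k))) := by
  have h1 : ContDiffAt ℝ 2 (fderiv ℝ F) 0 := hF.fderiv_right (by norm_num)
  have h2 : ContDiffAt ℝ 1 (fderiv ℝ (fderiv ℝ F)) 0 := h1.fderiv_right (by norm_num)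
  have d0 : HasFDerivAt F (fderiv ℝ F 0) 0 := (hF.differentiableAt (by simp)).hasFDerivAt
  have d1 : HasFDerivAt (fderiv ℝ F) (fderiv ℝ (fderiv ℝ F) 0) 0 :=
    (h1.differentiableAt (by simp)).hasFDerivAt
  have d2 : HasFDerivAt (fderiv ℝ (fderiv ℝ F)) (fderiv ℝ (fderiv ℝ (fderiv ℝ F)) 0) 0 :=
    (h2.differentiableAt (by simp)).hasFDerivAt
  have dΓ : HasFDerivAt (fun x => Γ (F x)) ((fderiv ℝ Γ (F 0)).comp (fderiv ℝ F 0)) 0 :=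
    HasFDerivAt.comp 0 hΓ.hasFDerivAt d0
  have c : ∀ w : W, HasFDerivAt (fun _ : W => w) (0 : W →L[ℝ] W) 0 := fun w => hasFDerivAt_const w 0
  constructor
  -- At `0` the coefficients are `δᵢⱼ` and the right-hand side vanishes.
  · have := hmean.self_of_nhds
    simp only [ha0, hτ0, ite_smul, one_smul, zero_smul, Finset.sum_ite_eq, Finset.mem_univ,
      if_true, Finset.sum_const_zero, Finset.sum_add_distrib] at this
    exact eq_neg_of_add_eq_zero_left this
  -- Differentiating the equation itself: `da = 0` at `0` kills the terms with derivatives of the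
  -- coefficients, and `τ = 0` at `0` kills second derivatives of `F` on the right. Only a
  -- tangential vector with coefficients `dτ` survives there.
  · have l1 : HasFDerivAt (fun x => ∑ i, ∑ j, a i j x • (fderiv ℝ (fderiv ℝ F) x (e i) (e j)
      + Γ (F x) (fderiv ℝ F x (e i)) (fderiv ℝ F x (e j)))) _ 0 :=
      HasFDerivAt.fun_sum fun i _ => HasFDerivAt.fun_sum fun j _ =>
        (ha i j).fun_smul (((d2.clm_apply (c (e i))).clm_apply (c (e j))).fun_add
          ((dΓ.clm_apply (d1.clm_apply (c (e i)))).clm_apply (d1.clm_apply (c (e j)))))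
    have l2 : HasFDerivAt (fun x => ∑ l, τ l x • fderiv ℝ F x (e l)) _ 0 :=
      HasFDerivAt.fun_sum fun l _ => (hτ l).hasFDerivAt.fun_smul (d1.clm_apply (c (e l)))
    have := congrArg (fun L => L b) (l1.unique (l2.congr_of_eventuallyEq hmean))
    simp only [sum_apply, add_apply, smul_apply, ContinuousLinearMap.comp_zero, zero_add,
      ContinuousLinearMap.flip_apply, ContinuousLinearMap.comp_apply, zero_apply,
      ContinuousLinearMap.smulRight_apply, zero_smul, add_zero] at this
    simp only [ha0, hτ0, zero_smul, zero_add, ite_smul, one_smul, Finset.sum_ite_eq,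
     Finset.mem_univ, if_true] at this
    rw [← this, eq_sub_iff_add_eq, ← Finset.sum_add_distrib]
    refine Finset.sum_congr rfl fun k _ => ?_
    rw [fderiv_fderiv_fderiv_symm hF (e k) b, fderiv_fderiv_symm (hF.of_le (by norm_num)) b (e k),
      hΓs (fderiv ℝ F 0 (e k)) (fderiv ℝ (fderiv ℝ F) 0 (e k) b), two_smul]
    abel

end Jets

/-! ### The curvature estimate for a coordinate representation of the immersion. -/

section LocalEstimate

variable {V W : Type*} [NormedAddCommGroup V] [NormedSpace ℝ V]
  [NormedAddCommGroup W] [NormedSpace ℝ W]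

/-- The curvature estimate for a map `F` with vanishing mean curvature, in coordinates. -/
theorem sum_curvTerm_le_of_isLocalMax {n : ℕ} (P : ℕ) {F : W → V}
    {G A : V → V →L[ℝ] V →L[ℝ] ℝ} {Γ : V → V →L[ℝ] V →L[ℝ] V} {φ : V → ℝ} {K c₁ c₂ : ℝ}
    (hF : ContDiffAt ℝ 3 F 0) (hG : ContDiffAt ℝ 2 G (F 0)) (hA : ContDiffAt ℝ 2 A (F 0))
    (hφ : ContDiffAt ℝ 2 φ (F 0)) (hΓ : DifferentiableAt ℝ Γ (F 0))
    (hcompat : ∀ᶠ z in 𝓝 (F 0), ∀ u v w,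
      fderiv ℝ G z u v w = G z (Γ z u v) w + G z v (Γ z u w))
    (hGs : ∀ u v, G (F 0) u v = G (F 0) v u)
    (hAs : ∀ᶠ z in 𝓝 (F 0), ∀ u v, A z u v = A z v u)
    (hΓs : ∀ᶠ z in 𝓝 (F 0), ∀ u v, Γ z u v = Γ z v u)
    (hA0 : ∀ v, 0 ≤ A (F 0) v v)
    {e : Fin n → W} {top : Fin n} {E : Fin n → V} (hE : ∀ k, fderiv ℝ F 0 (e k) = E k)
    (hGE : ∀ k l, G (F 0) (E k) (E l) = if k = l then 1 else 0)
    (hAE : ∀ l, l ≠ top → A (F 0) (E l) (E top) = 0)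
    (hAmax : ∀ l, A (F 0) (E l) (E l) ≤ A (F 0) (E top) (E top))
    (hApos : 0 < A (F 0) (E top) (E top))
    (hnormal : ∀ k l, G (F 0) (fderiv ℝ (fderiv ℝ F) 0 (e k) (e top)
      + Γ (F 0) (E k) (E top)) (E l) = 0)
    (hneg : ∀ v, (∀ l, G (F 0) v (E l) = 0) → G (F 0) v v ≤ 0)
    {a : Fin n → Fin n → W → ℝ} {τ : Fin n → W → ℝ}
    (ha : ∀ i j, HasFDerivAt (a i j) (0 : W →L[ℝ] ℝ) 0) (ha0 : ∀ i j, a i j 0 = if i = j then 1 else 0)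
    (hτ : ∀ l, DifferentiableAt ℝ (τ l) 0) (hτ0 : ∀ l, τ l 0 = 0)
    (hmean : ∀ᶠ x in 𝓝 (0 : W), ∑ i, ∑ j, a i j x • (fderiv ℝ (fderiv ℝ F) x (e i) (e j)
      + Γ (F x) (fderiv ℝ F x (e i)) (fderiv ℝ F x (e j))) = ∑ l, τ l x • fderiv ℝ F x (e l))
    (hmax : ∀ᶠ x in 𝓝 (0 : W),
      φ (F x) ^ P * A (F x) (fderiv ℝ F x (e top)) (fderiv ℝ F x (e top)) ≤
        φ (F 0) ^ P * A (F 0) (E top) (E top)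
          * G (F x) (fderiv ℝ F x (e top)) (fderiv ℝ F x (e top)))
    (hφ0 : 0 < φ (F 0)) (hφK : φ (F 0) ≤ K) (hc₁ : 0 ≤ c₁) (hc₂ : 0 ≤ c₂)
    (bΓ : ∀ u v w, |A (F 0) (Γ (F 0) u v) w| ≤
      c₁ * formNorm (A (F 0)) u * formNorm (A (F 0)) v * formNorm (A (F 0)) w)
    (bdΓ : ∀ u v w z, |A (F 0) (fderiv ℝ Γ (F 0) u v w) z| ≤ c₂ * formNorm (A (F 0)) u
      * formNorm (A (F 0)) v * formNorm (A (F 0)) w * formNorm (A (F 0)) z)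
    (bdA : ∀ u v w, |fderiv ℝ A (F 0) u v w| ≤
      K * formNorm (A (F 0)) u * formNorm (A (F 0)) v * formNorm (A (F 0)) w)
    (bd2A : ∀ u v w z, |fderiv ℝ (fderiv ℝ A) (F 0) u v w z| ≤ K * formNorm (A (F 0)) u
      * formNorm (A (F 0)) v * formNorm (A (F 0)) w * formNorm (A (F 0)) z)
    (bdφ : ∀ u, |fderiv ℝ φ (F 0) u| ≤ K * formNorm (A (F 0)) u)
    (bd2φ : ∀ u v, |fderiv ℝ (fderiv ℝ φ) (F 0) u v| ≤
      K * formNorm (A (F 0)) u * formNorm (A (F 0)) v) :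
    ∑ k, curvTerm (G (F 0)) (Γ (F 0)) (fderiv ℝ Γ (F 0)) (E k) (E top) ≤
      curvConst n P K c₁ c₂ * (φ (F 0) ^ 2)⁻¹ * A (F 0) (E top) (E top) := by
  have hΓs0 := hΓs.self_of_nhds
  have hAs0 := hAs.self_of_nhds
  have c : ∀ v : V, HasFDerivAt (fun _ : V => v) (0 : V →L[ℝ] V) (F 0) :=
    fun v => hasFDerivAt_const v _
  -- Symmetry of `Γ` on a neighbourhood passes to its derivative.
  have hdΓs : ∀ u v w, fderiv ℝ Γ (F 0) u v w = fderiv ℝ Γ (F 0) u w v := fun u v w => by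
    have e1 := (hΓ.hasFDerivAt.clm_apply (c v)).clm_apply (c w)
    have e2 := (hΓ.hasFDerivAt.clm_apply (c w)).clm_apply (c v)
    have heq : (fun z => Γ z v w) =ᶠ[𝓝 (F 0)] fun z => Γ z w v := hΓs.mono fun z hz => hz v w
    simpa using congrArg (fun L => L u) (e1.unique (e2.congr_of_eventuallyEq heq))
  have hdAs : ∀ u v w, fderiv ℝ A (F 0) u v w = fderiv ℝ A (F 0) u w v := fun u v w => by
    have hd := (hA.differentiableAt (by simp)).hasFDerivAt
    have e1 := (hd.clm_apply (c v)).clm_apply (c w)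
    have e2 := (hd.clm_apply (c w)).clm_apply (c v)
    have heq : (fun z => A z v w) =ᶠ[𝓝 (F 0)] fun z => A z w v := hAs.mono fun z hz => hz v w
    simpa using congrArg (fun L => L u) (e1.unique (e2.congr_of_eventuallyEq heq))
  obtain ⟨hZ, hW⟩ := mean_curvature_jets hF hΓ hΓs0 ha ha0 hτ hτ0 hmean (e top)
  simp only [hE] at hZ hW
  have hI : ∀ k, G (F 0) (fderiv ℝ (fderiv ℝ F) 0 (e k) (e top) + Γ (F 0) (E k) (E top))
      (fderiv ℝ (fderiv ℝ F) 0 (e k) (e top) + Γ (F 0) (E k) (E top)) ≤ 0 :=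
    fun k => hneg _ (hnormal k)
  -- The remaining hypothesis is the second derivative test along the line `t • e k`.
  refine sum_curvTerm_le P (X := fun k => fderiv ℝ (fderiv ℝ F) 0 (e k) (e top))
    (Z := fun k => fderiv ℝ (fderiv ℝ F) 0 (e k) (e k))
    (W := fun k => fderiv ℝ (fderiv ℝ (fderiv ℝ F)) 0 (e k) (e k) (e top))
    hΓs0 hdΓs hA0 (fun l => hGE l top) hAE hAmax hApos hI hZ hW (fun k => rfl) (fun k => rfl)
    (fun k => ?_) hφ0 hφK hc₁ hc₂ bΓ bdΓ bdA bd2A bdφ bd2φ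
  obtain ⟨j1, -, j2⟩ := hasDerivAt_line_jets hF (e k) (e k)
  obtain ⟨-, j3, j4⟩ := hasDerivAt_line_jets hF (e k) (e top)
  have j2' := (hasDerivAt_line_jets hF (e k) (e k)).2.1.self_of_nhds
  have s0 : F ((0 : ℝ) • e k) = F 0 := by rw [zero_smul]
  have hc2 : HasDerivAt (fun t : ℝ => fderiv ℝ F (t • e k) (e k))
      (fderiv ℝ (fderiv ℝ F) 0 (e k) (e k)) 0 := by simpa only [zero_smul] using j2'
  obtain ⟨sd, sd2⟩ := hasDerivAt_bilin_curve (B := A) (c := fun t : ℝ => F (t • e k))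
    (by simpa only [zero_smul] using hA) j1 j3 hc2 j4
  obtain ⟨gd, gd2⟩ := hasDerivAt_bilin_curve (B := G) (c := fun t : ℝ => F (t • e k))
    (by simpa only [zero_smul] using hG) j1 j3 hc2 j4
  have pd : ∀ᶠ t in 𝓝 (0 : ℝ), HasDerivAt (fun t : ℝ => φ (F (t • e k)))
      (fderiv ℝ φ (F (t • e k)) (fderiv ℝ F (t • e k) (e k))) t := by
    have hFc : Tendsto (fun t : ℝ => F (t • e k)) (𝓝 0) (𝓝 (F 0)) :=
      hF.continuousAt.tendsto.comp (tendsto_smul_nhds_zero (e k))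
    filter_upwards [j1, hFc.eventually (hφ.eventually (by simp))] with t h1 h2
    exact (h2.differentiableAt (by simp)).hasFDerivAt.comp_hasDerivAt t h1
  have pd2 : HasDerivAt (fun t : ℝ => fderiv ℝ φ (F (t • e k)) (fderiv ℝ F (t • e k) (e k)))
      (fderiv ℝ (fderiv ℝ φ) (F 0) (E k) (E k)
        + fderiv ℝ φ (F 0) (fderiv ℝ (fderiv ℝ F) 0 (e k) (e k))) 0 := by
    have hd : HasFDerivAt (fderiv ℝ φ) (fderiv ℝ (fderiv ℝ φ) (F 0)) (F ((0 : ℝ) • e k)) := by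
      rw [s0]
      exact ((hφ.fderiv_right (m := 1) (by norm_num)).differentiableAt (by simp)).hasFDerivAt
    have h1 : HasDerivAt (fun t : ℝ => fderiv ℝ φ (F (t • e k)))
        (fderiv ℝ (fderiv ℝ φ) (F 0) (fderiv ℝ F ((0 : ℝ) • e k) (e k))) 0 :=
      hd.comp_hasDerivAt (0 : ℝ) j1.self_of_nhds
    refine (h1.clm_apply hc2).congr_deriv ?_
    simp only [zero_smul, hE]
  have key := second_deriv_test_quotient P pd sd gd pd2 sd2 gd2
    (by simpa only [zero_smul] using hφ0) (by simpa only [zero_smul, hE] using hApos)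
    (by simp only [zero_smul, hE, hGE, if_true])
    (by
      simp only [zero_smul, hE]
      rw [hcompat.self_of_nhds, hGs (E top) (fderiv ℝ (fderiv ℝ F) 0 (e k) (e top)),
        hGs (E top) (Γ (F 0) (E k) (E top))]
      -- Tangential components of the second covariant derivative vanish, so `γ' 0 = 0`.
      have := hnormal k top
      simp only [map_add, add_apply] at this
      linarith)
    (by
      filter_upwards [(tendsto_smul_nhds_zero (e k)).eventually hmax] with t ht
      simpa only [zero_smul, hE] using ht)
  simp only [zero_smul, hE] at key
  rw [second_deriv_metric_eq hG hΓ hcompat hGs] at key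
  rw [hdAs (E k) (E top), hAs0 (E top) (fderiv ℝ (fderiv ℝ (fderiv ℝ F)) 0 (e k) (e k) (e top))] at key
  convert key using 3
  ring

end LocalEstimate

/-! ### Bilinear maps built from component arrays, and smoothness of the inverse matrix. -/

section MatrixForms

variable {N : ℕ}

/-- The bilinear form of a matrix. -/
def matForm (M : Matrix (Fin N) (Fin N) ℝ) : Eu N →L[ℝ] Eu N →L[ℝ] ℝ :=
  ∑ i, ∑ j, M i j • (EuclideanSpace.proj i : Eu N →L[ℝ] ℝ).smulRight
    (EuclideanSpace.proj j : Eu N →L[ℝ] ℝ)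

theorem matForm_apply (M : Matrix (Fin N) (Fin N) ℝ) (u v : Eu N) :
    matForm M u v = ∑ i, ∑ j, M i j * u i * v j := by
  simp only [matForm, sum_apply, smul_apply, ContinuousLinearMap.smulRight_apply, smul_eq_mul,
    PiLp.proj_apply, mul_assoc]

/-- The bilinear map with components `T a b c`. -/
def symbolMap (T : Fin N → Fin N → Fin N → ℝ) : Eu N →L[ℝ] Eu N →L[ℝ] Eu N :=
  ∑ a, ∑ b, ∑ c, T a b c • (EuclideanSpace.proj b : Eu N →L[ℝ] ℝ).smulRight
    ((EuclideanSpace.proj c : Eu N →L[ℝ] ℝ).smulRight (basisVec a))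

theorem basisVec_apply (a b : Fin N) : (basisVec a : Eu N) b = if b = a then 1 else 0 := by
  simp [basisVec]

theorem symbolMap_apply (T : Fin N → Fin N → Fin N → ℝ) (u v : Eu N) (a : Fin N) :
    symbolMap T u v a = ∑ b, ∑ c, T a b c * u b * v c := by
  simp only [symbolMap, sum_apply, smul_apply, ContinuousLinearMap.smulRight_apply, smul_eq_mul,
    PiLp.proj_apply, mul_assoc, WithLp.ofLp_sum, Finset.sum_apply, PiLp.smul_apply,
    basisVec_apply, mul_ite, mul_one, mul_zero]
  rw [Finset.sum_comm]
  refine Finset.sum_congr rfl fun b _ => ?_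
  rw [Finset.sum_comm]
  simp

theorem sum_smul_basisVec (v : Eu N) : ∑ i, v i • (basisVec i : Eu N) = v := by
  ext a
  simp [basisVec_apply]

theorem map_eq_sum_basisVec {X : Type*} [AddCommGroup X] [Module ℝ X] [TopologicalSpace X]
    (f : Eu N →L[ℝ] X) (v : Eu N) : f v = ∑ i, v i • f (basisVec i) := by
  conv_lhs => rw [← sum_smul_basisVec v]
  simp

theorem matForm_basisVec (M : Matrix (Fin N) (Fin N) ℝ) (i j : Fin N) :
    matForm M (basisVec i) (basisVec j) = M i j := by
  simp [matForm_apply, basisVec_apply]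

theorem matForm_symm {M : Matrix (Fin N) (Fin N) ℝ} (h : ∀ i j, M i j = M j i) (u v : Eu N) :
    matForm M u v = matForm M v u := by
  rw [matForm_apply, matForm_apply, Finset.sum_comm]
  refine Finset.sum_congr rfl fun i _ => Finset.sum_congr rfl fun j _ => ?_
  rw [h j i]; ring

variable {X : Type*} [NormedAddCommGroup X] [NormedSpace ℝ X]

theorem contDiffAt_matForm {k : WithTop ℕ∞} {G : X → Matrix (Fin N) (Fin N) ℝ} {y : X}
    (h : ∀ i j, ContDiffAt ℝ k (fun z => G z i j) y) : ContDiffAt ℝ k (fun z => matForm (G z)) y :=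
  ContDiffAt.sum fun i _ => ContDiffAt.sum fun j _ => (h i j).smul contDiffAt_const

theorem contDiffAt_symbolMap {k : WithTop ℕ∞} {T : X → Fin N → Fin N → Fin N → ℝ} {y : X}
    (h : ∀ a b c, ContDiffAt ℝ k (fun z => T z a b c) y) :
    ContDiffAt ℝ k (fun z => symbolMap (T z)) y :=
  ContDiffAt.sum fun a _ => ContDiffAt.sum fun b _ => ContDiffAt.sum fun c _ =>
    (h a b c).smul contDiffAt_const

theorem contDiffAt_matrix_det {k : WithTop ℕ∞} {G : X → Matrix (Fin N) (Fin N) ℝ} {y : X}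
    (h : ∀ i j, ContDiffAt ℝ k (fun z => G z i j) y) : ContDiffAt ℝ k (fun z => (G z).det) y := by
  simp only [Matrix.det_apply]
  exact ContDiffAt.sum fun σ _ => (contDiffAt_prod fun i _ => h _ _).const_smul _

/-- Cramer's rule: the entries are cofactors divided by the determinant. -/
theorem contDiffAt_matrix_inv {k : WithTop ℕ∞} {G : X → Matrix (Fin N) (Fin N) ℝ} {y : X}
    (h : ∀ i j, ContDiffAt ℝ k (fun z => G z i j) y) (hdet : (G y).det ≠ 0) (i j : Fin N) :
    ContDiffAt ℝ k (fun z => (G z)⁻¹ i j) y := by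
  simp only [Matrix.inv_def, Ring.inverse_eq_inv', Matrix.smul_apply, smul_eq_mul,
    Matrix.adjugate_apply]
  refine ((contDiffAt_matrix_det h).inv hdet).mul (contDiffAt_matrix_det fun a b => ?_)
  by_cases ha : a = j
  · subst ha; simpa using contDiffAt_const
  · simpa [Matrix.updateRow_ne ha] using h a b

theorem fderiv_bilin_apply {V : Type*} [NormedAddCommGroup V] [NormedSpace ℝ V]
    {B : X → V →L[ℝ] V →L[ℝ] ℝ} {y : X} (hB : DifferentiableAt ℝ B y) (u : X) (v w : V) :
    fderiv ℝ (fun z => B z v w) y u = fderiv ℝ B y u v w := by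
  have := (hB.hasFDerivAt.clm_apply (hasFDerivAt_const v y)).clm_apply (hasFDerivAt_const w y)
  rw [this.fderiv]
  simp

end MatrixForms

/-! ### Christoffel symbols as a bilinear map and the Koszul formula. -/

section Christoffel

variable {N : ℕ}

/-- The covector `w ↦ dG(u)(w, v) + dG(v)(w, u) - dG(w)(u, v)`, as a function of `w`. -/
def koszul (D : Eu N →L[ℝ] Eu N →L[ℝ] Eu N →L[ℝ] ℝ) (u v w : Eu N) : ℝ :=
  D u w v + D v w u - D w u v

theorem koszul_eq_sum (D : Eu N →L[ℝ] Eu N →L[ℝ] Eu N →L[ℝ] ℝ) (u v w : Eu N) :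
    koszul D u v w = ∑ d, koszul D u v (basisVec d) * w d := by
  simp only [koszul, sub_mul, add_mul, Finset.sum_sub_distrib, Finset.sum_add_distrib]
  rw [map_eq_sum_basisVec (D u) w, map_eq_sum_basisVec (D v) w, map_eq_sum_basisVec D w]
  simp [mul_comm]

theorem koszul_eq_sum_sum (D : Eu N →L[ℝ] Eu N →L[ℝ] Eu N →L[ℝ] ℝ) (u v w : Eu N) :
    koszul D u v w = ∑ b, ∑ c, koszul D (basisVec b) (basisVec c) w * u b * v c := by
  have h1 : D u w v = ∑ b, ∑ c, D (basisVec b) w (basisVec c) * u b * v c := by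
    rw [map_eq_sum_basisVec D u]
    simp only [sum_apply, smul_apply, smul_eq_mul]
    refine Finset.sum_congr rfl fun b _ => ?_
    rw [map_eq_sum_basisVec (D (basisVec b) w) v, Finset.mul_sum]
    exact Finset.sum_congr rfl fun c _ => by rw [smul_eq_mul]; ring
  have h2 : D v w u = ∑ b, ∑ c, D (basisVec c) w (basisVec b) * u b * v c := by
    rw [map_eq_sum_basisVec (D v w) u]
    refine Finset.sum_congr rfl fun b _ => ?_
    rw [map_eq_sum_basisVec D v]
    simp only [sum_apply, smul_apply, smul_eq_mul, Finset.mul_sum]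
    exact Finset.sum_congr rfl fun c _ => by ring
  have h3 : D w u v = ∑ b, ∑ c, D w (basisVec b) (basisVec c) * u b * v c := by
    rw [map_eq_sum_basisVec (D w) u]
    simp only [sum_apply, smul_apply, smul_eq_mul]
    refine Finset.sum_congr rfl fun b _ => ?_
    rw [map_eq_sum_basisVec (D w (basisVec b)) v, Finset.mul_sum]
    exact Finset.sum_congr rfl fun c _ => by rw [smul_eq_mul]; ring
  simp only [koszul, sub_mul, add_mul, Finset.sum_sub_distrib, Finset.sum_add_distrib, h1, h2, h3]

/-- The Christoffel symbols of `G` as a bilinear map. -/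
def chrMap (G : Eu N → Matrix (Fin N) (Fin N) ℝ) (y : Eu N) : Eu N →L[ℝ] Eu N →L[ℝ] Eu N :=
  symbolMap (christoffel G y)

theorem chrMap_apply (G : Eu N → Matrix (Fin N) (Fin N) ℝ) (y u v : Eu N) (a : Fin N) :
    chrMap G y u v a = ∑ b, ∑ c, christoffel G y a b c * u b * v c := symbolMap_apply _ _ _ _

variable {G : Eu N → Matrix (Fin N) (Fin N) ℝ} {y : Eu N}

theorem fderiv_matForm_basisVec (h : ∀ i j, ContDiffAt ℝ 1 (fun z => G z i j) y) (i j k : Fin N) :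
    fderiv ℝ (fun z => matForm (G z)) y (basisVec k) (basisVec i) (basisVec j) =
      pd k (fun z => G z i j) y := by
  rw [← fderiv_bilin_apply ((contDiffAt_matForm h).differentiableAt (by simp)), pd]
  simp only [matForm_basisVec]

theorem christoffel_eq_koszul (h : ∀ i j, ContDiffAt ℝ 1 (fun z => G z i j) y) (a b c : Fin N) :
    christoffel G y a b c = (1 / 2) * ∑ d, (G y)⁻¹ a d *
      koszul (fderiv ℝ (fun z => matForm (G z)) y) (basisVec b) (basisVec c) (basisVec d) := by
  simp only [christoffel, koszul, fderiv_matForm_basisVec h]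

theorem chrMap_apply_eq_koszul (h : ∀ i j, ContDiffAt ℝ 1 (fun z => G z i j) y) (u v : Eu N)
    (a : Fin N) : chrMap G y u v a = (1 / 2) * ∑ d, (G y)⁻¹ a d *
      koszul (fderiv ℝ (fun z => matForm (G z)) y) u v (basisVec d) := by
  simp only [chrMap_apply, christoffel_eq_koszul h, Finset.mul_sum, Finset.sum_mul]
  simp_rw [koszul_eq_sum_sum _ u v, Finset.mul_sum]
  conv_rhs => rw [Finset.sum_comm]
  refine Finset.sum_congr rfl fun b _ => ?_
  rw [Finset.sum_comm]
  refine Finset.sum_congr rfl fun d _ => Finset.sum_congr rfl fun c _ => ?_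
  ring

/-- Lowering the index with `G` cancels the inverse matrix in the definition of the Christoffel
symbols. -/
theorem matForm_chrMap (h : ∀ i j, ContDiffAt ℝ 1 (fun z => G z i j) y)
    (hs : ∀ i j, G y i j = G y j i) (hdet : (G y).det ≠ 0) (u v w : Eu N) :
    matForm (G y) (chrMap G y u v) w =
      (1 / 2) * koszul (fderiv ℝ (fun z => matForm (G z)) y) u v w := by
  set D := fderiv ℝ (fun z => matForm (G z)) y
  have hinv : ∀ j d, ∑ i, G y i j * (G y)⁻¹ i d = if j = d then 1 else 0 := fun j d => by
    have := congrFun (congrFun (Matrix.mul_nonsing_inv (G y) (Ne.isUnit hdet)) j) d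
    rw [Matrix.mul_apply, Matrix.one_apply] at this
    rw [← this]
    exact Finset.sum_congr rfl fun i _ => by rw [hs i j]
  rw [koszul_eq_sum, matForm_apply, Finset.sum_comm, Finset.mul_sum]
  refine Finset.sum_congr rfl fun j _ => ?_
  calc ∑ i, G y i j * chrMap G y u v i * w j
      = ∑ i, ∑ d, (G y i j * (G y)⁻¹ i d) * ((1 / 2) * koszul D u v (basisVec d) * w j) := by
        refine Finset.sum_congr rfl fun i _ => ?_
        rw [chrMap_apply_eq_koszul h, Finset.mul_sum, Finset.mul_sum, Finset.sum_mul]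
        exact Finset.sum_congr rfl fun d _ => by ring
    _ = ∑ d, (∑ i, G y i j * (G y)⁻¹ i d) * ((1 / 2) * koszul D u v (basisVec d) * w j) := by
        rw [Finset.sum_comm]; simp only [Finset.sum_mul]
    _ = _ := by simp [hinv]; ring

theorem fderiv_matForm_symm (h : ∀ i j, ContDiffAt ℝ 1 (fun z => G z i j) y)
    (hs : ∀ᶠ z in 𝓝 y, ∀ i j, G z i j = G z j i) (u v w : Eu N) :
    fderiv ℝ (fun z => matForm (G z)) y u v w = fderiv ℝ (fun z => matForm (G z)) y u w v := by
  have hd := (contDiffAt_matForm h).differentiableAt (by simp)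
  rw [← fderiv_bilin_apply hd, ← fderiv_bilin_apply hd]
  have : (fun z => matForm (G z) v w) =ᶠ[𝓝 y] fun z => matForm (G z) w v :=
    hs.mono fun z hz => matForm_symm hz v w
  rw [this.fderiv_eq]

/-- Metric compatibility: in the sum of the two Koszul expressions all terms but two equal ones
cancel by symmetry of the metric. -/
theorem fderiv_matForm_eq (h : ∀ i j, ContDiffAt ℝ 1 (fun z => G z i j) y)
    (hs : ∀ᶠ z in 𝓝 y, ∀ i j, G z i j = G z j i) (hdet : (G y).det ≠ 0) (u v w : Eu N) :
    fderiv ℝ (fun z => matForm (G z)) y u v w =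
      matForm (G y) (chrMap G y u v) w + matForm (G y) v (chrMap G y u w) := by
  rw [matForm_symm hs.self_of_nhds v, matForm_chrMap h hs.self_of_nhds hdet,
    matForm_chrMap h hs.self_of_nhds hdet, koszul, koszul, fderiv_matForm_symm h hs v,
    fderiv_matForm_symm h hs u w, fderiv_matForm_symm h hs w u]
  ring

theorem chrMap_symm (h : ∀ i j, ContDiffAt ℝ 1 (fun z => G z i j) y)
    (hs : ∀ᶠ z in 𝓝 y, ∀ i j, G z i j = G z j i) (u v : Eu N) :
    chrMap G y u v = chrMap G y v u := by
  ext a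
  rw [chrMap_apply_eq_koszul h, chrMap_apply_eq_koszul h]
  simp only [koszul, fderiv_matForm_symm h hs _ u v]
  simp only [add_comm]

theorem contDiffAt_pd {k : WithTop ℕ∞} {h : Eu N → ℝ} (hh : ContDiffAt ℝ (k + 1) h y) (i : Fin N) :
    ContDiffAt ℝ k (pd i h) y :=
  (hh.fderiv_right (m := k) le_rfl).clm_apply contDiffAt_const

theorem contDiffAt_christoffel {k : WithTop ℕ∞}
    (h : ∀ i j, ContDiffAt ℝ (k + 1) (fun z => G z i j) y) (hdet : (G y).det ≠ 0) (a b c : Fin N) :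
    ContDiffAt ℝ k (fun z => christoffel G z a b c) y := by
  refine contDiffAt_const.mul (ContDiffAt.sum fun d _ => ?_)
  exact (contDiffAt_matrix_inv (fun i j => (h i j).of_le le_self_add) hdet a d).mul
    (((contDiffAt_pd (h _ _) _).add (contDiffAt_pd (h _ _) _)).sub (contDiffAt_pd (h _ _) _))

theorem contDiffAt_chrMap {k : WithTop ℕ∞}
    (h : ∀ i j, ContDiffAt ℝ (k + 1) (fun z => G z i j) y) (hdet : (G y).det ≠ 0) :
    ContDiffAt ℝ k (chrMap G) y :=
  contDiffAt_symbolMap fun a b c => contDiffAt_christoffel h hdet a b c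

end Christoffel

/-! ### From bounds on unit balls to homogeneous bounds, and estimates for Christoffel symbols. -/

section Bounds

variable {N : ℕ}

/-- `ξ` lies in `c • B`, as far as bounds for linear functionals are concerned. -/
def ScaleBound (B : Set (Eu N)) (ξ : Eu N) (c : ℝ) : Prop :=
  0 ≤ c ∧ ∀ (f : Eu N →L[ℝ] ℝ) (K : ℝ), 0 ≤ K → (∀ u ∈ B, |f u| ≤ K) → |f ξ| ≤ K * c

theorem scaleBound_of_smul_mem {B : Set (Eu N)} {ξ : Eu N} {c : ℝ} (hc : 0 < c)
    (h : c⁻¹ • ξ ∈ B) : ScaleBound B ξ c := by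
  refine ⟨hc.le, fun f K _ hf => ?_⟩
  have h1 := hf _ h
  rw [map_smul, smul_eq_mul, abs_mul, abs_of_pos (inv_pos.mpr hc)] at h1
  calc |f ξ| = (c⁻¹ * |f ξ|) * c := by field_simp
    _ ≤ K * c := mul_le_mul_of_nonneg_right h1 hc.le

theorem scaleBound_zero {B : Set (Eu N)} {c : ℝ} (hc : 0 ≤ c) : ScaleBound B 0 c :=
  ⟨hc, fun f K hK _ => by rw [map_zero, abs_zero]; positivity⟩

theorem mem_unitBall_iff (A : Matrix (Fin N) (Fin N) ℝ) (v : Eu N) :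
    v ∈ unitBall A ↔ matForm A v v ≤ 1 := by
  rw [unitBall, Set.mem_ofPred_eq, matForm_apply]

theorem scaleBound_unitBall {A : Matrix (Fin N) (Fin N) ℝ} (hA : ∀ v, v ≠ 0 → 0 < matForm A v v)
    (u : Eu N) : ScaleBound (unitBall A) u (formNorm (matForm A) u) := by
  by_cases hu : u = 0
  · subst hu; exact scaleBound_zero (formNorm_nonneg _ _)
  have h0 := hA u hu
  have hpos : 0 < formNorm (matForm A) u := Real.sqrt_pos.mpr h0
  refine scaleBound_of_smul_mem hpos ?_
  have h2 : formNorm (matForm A) u ^ 2 = matForm A u u := Real.sq_sqrt h0.le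
  rw [mem_unitBall_iff]
  simp only [map_smul, smul_apply, smul_eq_mul]
  rw [← h2]
  apply le_of_eq
  field_simp

theorem scaleBound_dualBall {A : Matrix (Fin N) (Fin N) ℝ}
    {ξ : Eu N} {c : ℝ} (hc : 0 ≤ c) (h : ∀ v, |∑ i, ξ i * v i| ≤ c * formNorm (matForm A) v) :
    ScaleBound (dualBall A) ξ c := by
  -- Rescaling by `c⁻¹` needs `c ≠ 0`; for `c = 0` the hypothesis forces `ξ = 0`.
  rcases hc.eq_or_lt with rfl | hpos
  · have : ξ = 0 := by
      ext a
      have := h (basisVec a)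
      rw [zero_mul, abs_nonpos_iff] at this
      simpa [basisVec_apply] using this
    subst this; exact scaleBound_zero le_rfl
  · refine scaleBound_of_smul_mem hpos fun v hv => ?_
    rw [mem_unitBall_iff] at hv
    have h1 : formNorm (matForm A) v ≤ 1 := Real.sqrt_le_one.mpr hv
    have h2 := h v
    have h3 : ∑ i, (c⁻¹ • ξ) i * v i = c⁻¹ * ∑ i, ξ i * v i := by
      rw [Finset.mul_sum]
      exact Finset.sum_congr rfl fun i _ => by simp [mul_assoc]
    rw [h3, abs_mul, abs_of_pos (inv_pos.mpr hpos), inv_mul_le_iff₀ hpos]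
    nlinarith

/-! ### Multilinear estimates from jet bounds. -/

section Jets

variable {B B' : Set (Eu N)} {y : Eu N} {K : ℝ}

theorem fderiv_bilin_eventuallyEq {H : Eu N → Eu N →L[ℝ] Eu N →L[ℝ] ℝ} (hH : ContDiffAt ℝ 2 H y)
    (u v w : Eu N) :
    (fun z => fderiv ℝ (fun z => H z v w) z u) =ᶠ[𝓝 y] fun z => fderiv ℝ H z u v w := by
  filter_upwards [hH.eventually (by simp)] with z hz
  exact fderiv_bilin_apply (hz.differentiableAt (by simp)) u v w

theorem fderiv_fderiv_bilin {H : Eu N → Eu N →L[ℝ] Eu N →L[ℝ] ℝ} (hH : ContDiffAt ℝ 2 H y)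
    (u₁ u₂ v w : Eu N) :
    fderiv ℝ (fun z => fderiv ℝ (fun z => H z v w) z u₂) y u₁ =
      fderiv ℝ (fderiv ℝ H) y u₁ u₂ v w := by
  rw [(fderiv_bilin_eventuallyEq hH u₂ v w).fderiv_eq]
  have hd : HasFDerivAt (fderiv ℝ H) (fderiv ℝ (fderiv ℝ H) y) y :=
    ((hH.fderiv_right (m := 1) (by norm_num)).differentiableAt (by simp)).hasFDerivAt
  have := ((hd.clm_apply (hasFDerivAt_const u₂ y)).clm_apply (hasFDerivAt_const v y)).clm_apply
    (hasFDerivAt_const w y)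
  rw [this.fderiv]
  simp

variable {H : Eu N → Eu N →L[ℝ] Eu N →L[ℝ] ℝ}

/-- `ScaleBound` concerns one linear functional, so the slots are rescaled one at a time with the
others fixed in the unit ball or already treated. The two lemmas on derivatives follow the same
pattern. -/
theorem abs_bilin_le (hK : 0 ≤ K) (h : ∀ v ∈ B', ∀ w ∈ B', JetBound B (fun z => H z v w) y K)
    {v w : Eu N} {c d : ℝ} (hv : ScaleBound B' v c) (hw : ScaleBound B' w d) :
    |H y v w| ≤ K * c * d := by
  refine hw.2 (H y v) _ (mul_nonneg hK hv.1) fun w' hw' => ?_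
  exact hv.2 ((H y).flip w') K hK fun v' hv' => (h v' hv' w' hw').1

theorem abs_fderiv_bilin_le (hK : 0 ≤ K) (hH : ContDiffAt ℝ 2 H y)
    (h : ∀ v ∈ B', ∀ w ∈ B', JetBound B (fun z => H z v w) y K)
    {u v w : Eu N} {a c d : ℝ} (hu : ScaleBound B u a) (hv : ScaleBound B' v c)
    (hw : ScaleBound B' w d) : |fderiv ℝ H y u v w| ≤ K * a * c * d := by
  refine hw.2 (fderiv ℝ H y u v) _ (mul_nonneg (mul_nonneg hK hu.1) hv.1) fun w' hw' => ?_
  refine hv.2 ((fderiv ℝ H y u).flip w') _ (mul_nonneg hK hu.1) fun v' hv' => ?_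
  refine hu.2 (((fderiv ℝ H y).flip v').flip w') K hK fun u' hu' => ?_
  have := (h v' hv' w' hw').2.1 u' hu'
  rwa [fderiv_bilin_apply (hH.differentiableAt (by simp))] at this

theorem abs_fderiv_fderiv_bilin_le (hK : 0 ≤ K) (hH : ContDiffAt ℝ 2 H y)
    (h : ∀ v ∈ B', ∀ w ∈ B', JetBound B (fun z => H z v w) y K)
    {u₁ u₂ v w : Eu N} {a b c d : ℝ} (hu₁ : ScaleBound B u₁ a) (hu₂ : ScaleBound B u₂ b)
    (hv : ScaleBound B' v c) (hw : ScaleBound B' w d) :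
    |fderiv ℝ (fderiv ℝ H) y u₁ u₂ v w| ≤ K * a * b * c * d := by
  have k1 := mul_nonneg hK hu₁.1
  have k2 := mul_nonneg k1 hu₂.1
  refine hw.2 (fderiv ℝ (fderiv ℝ H) y u₁ u₂ v) _ (mul_nonneg k2 hv.1) fun w' hw' => ?_
  refine hv.2 ((fderiv ℝ (fderiv ℝ H) y u₁ u₂).flip w') _ k2 fun v' hv' => ?_
  refine hu₂.2 (((fderiv ℝ (fderiv ℝ H) y u₁).flip v').flip w') _ k1 fun u₂' hu₂' => ?_
  refine hu₁.2 ((((fderiv ℝ (fderiv ℝ H) y).flip u₂').flip v').flip w') K hK fun u₁' hu₁' => ?_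
  have := (h v' hv' w' hw').2.2 u₁' hu₁' u₂' hu₂'
  rwa [fderiv_fderiv_bilin hH] at this

theorem abs_fderiv_le {φ : Eu N → ℝ} (hK : 0 ≤ K) (h : JetBound B φ y K) {u : Eu N} {a : ℝ}
    (hu : ScaleBound B u a) : |fderiv ℝ φ y u| ≤ K * a :=
  hu.2 (fderiv ℝ φ y) K hK h.2.1

theorem abs_fderiv_fderiv_le {φ : Eu N → ℝ} (hK : 0 ≤ K) (hφ : ContDiffAt ℝ 2 φ y)
    (h : JetBound B φ y K) {u v : Eu N} {a b : ℝ} (hu : ScaleBound B u a) (hv : ScaleBound B v b) :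
    |fderiv ℝ (fderiv ℝ φ) y u v| ≤ K * a * b := by
  have hd : HasFDerivAt (fderiv ℝ φ) (fderiv ℝ (fderiv ℝ φ) y) y :=
    ((hφ.fderiv_right (m := 1) (by norm_num)).differentiableAt (by simp)).hasFDerivAt
  refine hv.2 (fderiv ℝ (fderiv ℝ φ) y u) _ (mul_nonneg hK hu.1) fun v' hv' => ?_
  refine hu.2 ((fderiv ℝ (fderiv ℝ φ) y).flip v') K hK fun u' hu' => ?_
  have h1 := h.2.2 u' hu' v' hv'
  rw [(hd.clm_apply (hasFDerivAt_const v' y)).fderiv] at h1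
  simpa using h1

end Jets

/-- Cauchy–Schwarz for a semidefinite form, from the discriminant of `t ↦ A (v + t • w) (v + t •
w)`. -/
theorem abs_bilin_le_formNorm {V : Type*} [NormedAddCommGroup V] [NormedSpace ℝ V]
    {A : V →L[ℝ] V →L[ℝ] ℝ} (hs : ∀ v w, A v w = A w v) (hA : ∀ v, 0 ≤ A v v) (v w : V) :
    |A v w| ≤ formNorm A v * formNorm A w := by
  have h : ∀ t : ℝ, 0 ≤ A w w * (t * t) + 2 * A v w * t + A v v := fun t => by
    have := hA (v + t • w)
    simp only [map_add, map_smul, add_apply, smul_apply, smul_eq_mul, hs w v] at this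
    linarith
  have h2 := discrim_le_zero h
  rw [discrim, ← formNorm_sq hA v, ← formNorm_sq hA w] at h2
  refine abs_le_of_sq_le_sq ?_ (mul_nonneg (formNorm_nonneg A v) (formNorm_nonneg A w))
  nlinarith

/-! ### Bounds for the Christoffel symbols and their first derivatives. -/

section ChristoffelBounds

variable {G A : Eu N → Matrix (Fin N) (Fin N) ℝ} {y : Eu N} {K : ℝ}

/-- The covector `koszul D u v`, as a vector of components. -/
def koszulVec (D : Eu N →L[ℝ] Eu N →L[ℝ] Eu N →L[ℝ] ℝ) (u v : Eu N) : Eu N :=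
  ∑ d, koszul D u v (basisVec d) • basisVec d

theorem koszulVec_apply (D : Eu N →L[ℝ] Eu N →L[ℝ] Eu N →L[ℝ] ℝ) (u v : Eu N) (d : Fin N) :
    koszulVec D u v d = koszul D u v (basisVec d) := by
  simp [koszulVec, basisVec_apply]

/-- The covector `A(·, w)`, as a vector of components. -/
def lowerVec (A : Eu N →L[ℝ] Eu N →L[ℝ] ℝ) (w : Eu N) : Eu N := ∑ a, A (basisVec a) w • basisVec a

theorem lowerVec_apply (A : Eu N →L[ℝ] Eu N →L[ℝ] ℝ) (w : Eu N) (a : Fin N) :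
    lowerVec A w a = A (basisVec a) w := by
  simp [lowerVec, basisVec_apply]

theorem sum_lowerVec_mul (A : Eu N →L[ℝ] Eu N →L[ℝ] ℝ) (w v : Eu N) :
    ∑ a, lowerVec A w a * v a = A v w := by
  rw [map_eq_sum_basisVec A v]
  simp [lowerVec_apply, mul_comm]

/-- Pairing with `w` exhibits the Christoffel symbols as the inverse metric evaluated on two
covectors, the form in which the bound for `g⁻¹` on dual balls applies. -/
theorem bilin_chrMap_eq (h : ∀ i j, ContDiffAt ℝ 1 (fun z => G z i j) y)
    (A : Eu N →L[ℝ] Eu N →L[ℝ] ℝ) (u v w : Eu N) :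
    A (chrMap G y u v) w = (1 / 2) * matForm (G y)⁻¹ (lowerVec A w)
      (koszulVec (fderiv ℝ (fun z => matForm (G z)) y) u v) := by
  rw [← sum_lowerVec_mul, matForm_apply, Finset.mul_sum]
  refine Finset.sum_congr rfl fun a _ => ?_
  rw [chrMap_apply_eq_koszul h, Finset.mul_sum, Finset.mul_sum, Finset.mul_sum]
  refine Finset.sum_congr rfl fun d _ => ?_
  rw [koszulVec_apply]
  ring

theorem hasFDerivAt_koszulVec {D : Eu N → Eu N →L[ℝ] Eu N →L[ℝ] Eu N →L[ℝ] ℝ}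
    (hD : DifferentiableAt ℝ D y) (v w : Eu N) :
    ∃ L : Eu N →L[ℝ] Eu N, HasFDerivAt (fun z => koszulVec (D z) v w) L y ∧
      ∀ u, L u = koszulVec (fderiv ℝ D y u) v w := by
  have c : ∀ v : Eu N, HasFDerivAt (fun _ : Eu N => v) (0 : Eu N →L[ℝ] Eu N) y :=
    fun v => hasFDerivAt_const v y
  have t : ∀ a b d : Eu N, HasFDerivAt (fun z => D z a b d) _ y := fun a b d =>
    ((hD.hasFDerivAt.clm_apply (c a)).clm_apply (c b)).clm_apply (c d)
  refine ⟨_, HasFDerivAt.fun_sum fun d _ =>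
    (((t v (basisVec d) w).fun_add (t w (basisVec d) v)).fun_sub (t (basisVec d) v w)).smul_const
      (basisVec d), fun u => ?_⟩
  simp [koszulVec, koszul]

theorem abs_koszul_le {D : Eu N →L[ℝ] Eu N →L[ℝ] Eu N →L[ℝ] ℝ} {q : Eu N → ℝ} {c : ℝ}
    (hD : ∀ u v w, |D u v w| ≤ c * q u * q v * q w) (u v w : Eu N) :
    |koszul D u v w| ≤ 3 * c * q u * q v * q w := by
  have h1 := abs_le.mp (hD u w v)
  have h2 := abs_le.mp (hD v w u)
  have h3 := abs_le.mp (hD w u v)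
  rw [koszul, abs_le]
  constructor <;> linarith [h1.1, h1.2, h2.1, h2.2, h3.1, h3.2]

theorem scaleBound_koszulVec {A : Matrix (Fin N) (Fin N) ℝ}
    {D : Eu N →L[ℝ] Eu N →L[ℝ] Eu N →L[ℝ] ℝ} {c : ℝ}
    (hc : 0 ≤ c) (hD : ∀ u v w, |D u v w| ≤
      c * formNorm (matForm A) u * formNorm (matForm A) v * formNorm (matForm A) w) (u v : Eu N) :
    ScaleBound (dualBall A) (koszulVec D u v)
      (3 * c * formNorm (matForm A) u * formNorm (matForm A) v) := by
  refine scaleBound_dualBall (mul_nonneg (mul_nonneg (mul_nonneg (by norm_num) hc)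
    (formNorm_nonneg _ u)) (formNorm_nonneg _ v)) fun w => ?_
  have := abs_koszul_le hD u v w
  rw [koszul_eq_sum] at this
  simpa only [koszulVec_apply] using this

theorem scaleBound_lowerVec {A : Matrix (Fin N) (Fin N) ℝ}
    (hA : ∀ v, v ≠ 0 → 0 < matForm A v v) (hs : ∀ i j, A i j = A j i) (w : Eu N) :
    ScaleBound (dualBall A) (lowerVec (matForm A) w) (formNorm (matForm A) w) := by
  refine scaleBound_dualBall (formNorm_nonneg _ w) fun v => ?_
  rw [sum_lowerVec_mul, mul_comm]
  refine abs_bilin_le_formNorm (matForm_symm hs) (fun v => ?_) v w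
  by_cases hv : v = 0
  · simp [hv]
  · exact (hA v hv).le

/-- In `3 / 2 * K ^ 2` one `K` comes from `g⁻¹`, the other from `dg`, the `3` from the three Koszul
terms and the `1 / 2` from the Christoffel formula. -/
theorem abs_chrMap_le
    (hK : 0 ≤ K) (hG : ∀ i j, ContDiffAt ℝ 2 (fun z => G z i j) y)
    (hA : ∀ v, v ≠ 0 → 0 < matForm (A y) v v) (hs : ∀ i j, A y i j = A y j i)
    (bG : ∀ v ∈ unitBall (A y), ∀ w ∈ unitBall (A y),
      JetBound (unitBall (A y)) (fun z => matForm (G z) v w) y K)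
    (bGi : ∀ v ∈ dualBall (A y), ∀ w ∈ dualBall (A y),
      JetBound (unitBall (A y)) (fun z => matForm (G z)⁻¹ v w) y K)
    (u v w : Eu N) :
    |matForm (A y) (chrMap G y u v) w| ≤ 3 / 2 * K ^ 2 * formNorm (matForm (A y)) u
      * formNorm (matForm (A y)) v * formNorm (matForm (A y)) w := by
  have s := scaleBound_unitBall hA
  have hH := contDiffAt_matForm hG
  rw [bilin_chrMap_eq (fun i j => (hG i j).of_le (by norm_num)), abs_mul]
  have h1 := scaleBound_koszulVec hK
    (fun u v w => abs_fderiv_bilin_le hK hH bG (s u) (s v) (s w)) u v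
  have h2 := abs_bilin_le hK bGi (scaleBound_lowerVec hA hs w) h1
  rw [abs_of_pos (by norm_num : (0 : ℝ) < 1 / 2)]
  linarith

/-- The product rule gives two terms, one with `dg⁻¹` and `dg`, one with `g⁻¹` and `d²g`, each at
most `3 / 2 * K ^ 2` times the lengths of the arguments. -/
theorem abs_fderiv_chrMap_le
    (hK : 0 ≤ K) (hG : ∀ i j, ContDiffAt ℝ 2 (fun z => G z i j) y) (hdet : (G y).det ≠ 0)
    (hA : ∀ v, v ≠ 0 → 0 < matForm (A y) v v) (hs : ∀ i j, A y i j = A y j i)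
    (bG : ∀ v ∈ unitBall (A y), ∀ w ∈ unitBall (A y),
      JetBound (unitBall (A y)) (fun z => matForm (G z) v w) y K)
    (bGi : ∀ v ∈ dualBall (A y), ∀ w ∈ dualBall (A y),
      JetBound (unitBall (A y)) (fun z => matForm (G z)⁻¹ v w) y K)
    (u v w z : Eu N) :
    |matForm (A y) (fderiv ℝ (chrMap G) y u v w) z| ≤ 3 * K ^ 2 * formNorm (matForm (A y)) u
      * formNorm (matForm (A y)) v * formNorm (matForm (A y)) w * formNorm (matForm (A y)) z := by
  have s := scaleBound_unitBall hA
  have hH := contDiffAt_matForm hG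
  have hGi : ContDiffAt ℝ 2 (fun z => matForm (G z)⁻¹) y :=
    contDiffAt_matForm (contDiffAt_matrix_inv hG hdet)
  have hD : DifferentiableAt ℝ (fderiv ℝ (fun z => matForm (G z))) y :=
    (hH.fderiv_right (m := 1) (by norm_num)).differentiableAt (by simp)
  have hΓ : DifferentiableAt ℝ (chrMap G) y :=
    (contDiffAt_chrMap (k := 1) (by simpa [one_add_one_eq_two] using hG) hdet).differentiableAt
      (by simp)
  obtain ⟨L, hL, hLu⟩ := hasFDerivAt_koszulVec hD v w
  have c : ∀ v : Eu N, HasFDerivAt (fun _ : Eu N => v) (0 : Eu N →L[ℝ] Eu N) y :=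
    fun v => hasFDerivAt_const v y
  have e1 : HasFDerivAt (fun x => matForm (A y) (chrMap G x v w) z) _ y :=
    ((hasFDerivAt_const (matForm (A y)) y).clm_apply
      ((hΓ.hasFDerivAt.clm_apply (c v)).clm_apply (c w))).clm_apply (c z)
  have e2 : HasFDerivAt (fun x => (1 / 2 : ℝ) * matForm (G x)⁻¹ (lowerVec (matForm (A y)) z)
      (koszulVec (fderiv ℝ (fun z => matForm (G z)) x) v w)) _ y :=
    ((((hGi.differentiableAt (by simp)).hasFDerivAt).clm_apply
      (c (lowerVec (matForm (A y)) z))).clm_apply hL).const_mul (1 / 2)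
  have heq : (fun x => matForm (A y) (chrMap G x v w) z) =ᶠ[𝓝 y]
      fun x => (1 / 2 : ℝ) * matForm (G x)⁻¹ (lowerVec (matForm (A y)) z)
      (koszulVec (fderiv ℝ (fun z => matForm (G z)) x) v w) := by
    have : ∀ᶠ x in 𝓝 y, ∀ i j, ContDiffAt ℝ 1 (fun z => G z i j) x := by
      simp only [eventually_all]
      exact fun i j => ((hG i j).eventually (by simp)).mono fun x hx => hx.of_le (by norm_num)
    exact this.mono fun x hx => bilin_chrMap_eq hx _ v w z
  have h3 := congrArg (fun L => L u) (e1.unique (e2.congr_of_eventuallyEq heq))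
  simp only [add_apply, smul_apply, ContinuousLinearMap.comp_zero, zero_add, add_zero,
    ContinuousLinearMap.flip_apply, ContinuousLinearMap.comp_apply, zero_apply, smul_eq_mul, hLu,
    ContinuousLinearMap.flip_zero] at h3
  rw [h3]
  have bl := scaleBound_lowerVec hA hs z
  have h1 := scaleBound_koszulVec hK
    (fun u v w => abs_fderiv_bilin_le hK hH bG (s u) (s v) (s w)) v w
  -- The differentiated Koszul covector is the Koszul covector of `d²g(u, ·)`, so the earlier bound
  -- applies with `K` times the length of `u` in place of `K`.
  have h1' := scaleBound_koszulVec (mul_nonneg hK (s u).1)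
    (fun u' v w => abs_fderiv_fderiv_bilin_le hK hH bG (s u) (s u') (s v) (s w)) v w
  have h4 := abs_fderiv_bilin_le hK hGi bGi (s u) bl h1
  have h5 := abs_bilin_le hK bGi bl h1'
  rw [abs_mul, abs_of_pos (by norm_num : (0 : ℝ) < 1 / 2)]
  have h6 := (abs_add_le _ _).trans (add_le_add h5 h4)
  linarith

end ChristoffelBounds
end Bounds

/-! ### Tensor fields in a chart of the maximal atlas. -/

section Charts

variable {N : ℕ} {X : Type*} [TopologicalSpace X] [ChartedSpace (Eu N) X]
  {ψ : OpenPartialHomeomorph X (Eu N)}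

theorem mdifferentiable_of_mem_maximalAtlas (hψ : ψ ∈ IsManifold.maximalAtlas (𝓡 N) ∞ X) :
    ψ.MDifferentiable (𝓡 N) (𝓡 N) :=
  ⟨(contMDiffOn_of_mem_maximalAtlas hψ).mdifferentiableOn (by simp),
    (contMDiffOn_symm_of_mem_maximalAtlas hψ).mdifferentiableOn (by simp)⟩

/-- A tensor field of bilinear forms as a `TwoForm`. -/
def toTwoForm (b : ∀ p : X, TangentSpace (𝓡 N) p →L[ℝ] TangentSpace (𝓡 N) p →L[ℝ] ℝ) :
    TwoForm N X := fun p v w => b p v w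

theorem matForm_coordMatrix (b : ∀ p : X, TangentSpace (𝓡 N) p →L[ℝ] TangentSpace (𝓡 N) p →L[ℝ] ℝ)
    (y u v : Eu N) :
    matForm (coordMatrix ψ (toTwoForm b) y) u v =
      b (ψ.symm y) (mfderiv (𝓡 N) (𝓡 N) ψ.symm y u) (mfderiv (𝓡 N) (𝓡 N) ψ.symm y v) := by
  let L : Eu N →L[ℝ] TangentSpace (𝓡 N) (ψ.symm y) := mfderiv (𝓡 N) (𝓡 N) ψ.symm y
  change _ = b (ψ.symm y) (L u) (L v)
  have h1 : L u = ∑ i, u i • L (basisVec i) := map_eq_sum_basisVec L u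
  have h2 : L v = ∑ i, v i • L (basisVec i) := map_eq_sum_basisVec L v
  rw [h1, h2, matForm_apply]
  simp only [map_sum, map_smul, sum_apply, smul_apply, smul_eq_mul, Finset.mul_sum]
  rw [Finset.sum_comm]
  refine Finset.sum_congr rfl fun i _ => Finset.sum_congr rfl fun j _ => ?_
  change b (ψ.symm y) (L _) (L _) * _ * _ = _
  ring

theorem mfderiv_symm_injective (hψ : ψ ∈ IsManifold.maximalAtlas (𝓡 N) ∞ X) {y : Eu N}
    (hy : y ∈ ψ.target) {v : Eu N}
    (h : (mfderiv (𝓡 N) (𝓡 N) ψ.symm y v : TangentSpace (𝓡 N) (ψ.symm y)) = 0) : v = 0 := by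
  have := (mdifferentiable_of_mem_maximalAtlas hψ).comp_symm_deriv hy
  have h2 : mfderiv (𝓡 N) (𝓡 N) ψ (ψ.symm y) (mfderiv (𝓡 N) (𝓡 N) ψ.symm y v) = v :=
    congrArg (fun L => L v) this
  rw [h, map_zero] at h2
  exact h2.symm

theorem mfderiv_symm_surjective (hψ : ψ ∈ IsManifold.maximalAtlas (𝓡 N) ∞ X) {y : Eu N}
    (hy : y ∈ ψ.target) (a : TangentSpace (𝓡 N) (ψ.symm y)) :
    ∃ v : Eu N, mfderiv (𝓡 N) (𝓡 N) ψ.symm y v = a := by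
  have h0 := (mdifferentiable_of_mem_maximalAtlas hψ).symm_comp_deriv (ψ.map_target hy)
  rw [ψ.right_inv hy] at h0
  exact ⟨mfderiv (𝓡 N) (𝓡 N) ψ (ψ.symm y) a, congrArg (fun L => L a) h0⟩

variable [IsManifold (𝓡 N) ∞ X]

/-- Smoothness of coordinate vector fields along the inverse chart: a smooth bundle map applied to a
constant section. -/
theorem contMDiffAt_mfderiv_symm_apply (hψ : ψ ∈ IsManifold.maximalAtlas (𝓡 N) ∞ X) {y : Eu N}
    (hy : y ∈ ψ.target) (v : Eu N) :
    ContMDiffAt (𝓡 N) ((𝓡 N).prod 𝓘(ℝ, Eu N)) ∞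
      (fun z => Bundle.TotalSpace.mk' (Eu N) (E := fun p : X => TangentSpace (𝓡 N) p) (ψ.symm z)
        (mfderiv (𝓡 N) (𝓡 N) ψ.symm z v)) y := by
  have hs : ContMDiffAt (𝓡 N) (𝓡 N) ∞ ψ.symm y := contMDiffAt_symm_of_mem_maximalAtlas hψ hy
  have hv : ContMDiffAt (𝓡 N) ((𝓡 N).prod 𝓘(ℝ, Eu N)) ∞
      (fun z => Bundle.TotalSpace.mk' (Eu N) (E := fun p : Eu N => TangentSpace (𝓡 N) p) z v) y := by
    rw [Bundle.contMDiffAt_totalSpace]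
    refine ⟨contMDiffAt_id, ?_⟩
    simpa using contMDiffAt_const
  exact ContMDiffAt.clm_apply_of_inCoordinates (b₁ := fun z : Eu N => z)
    (hs.mfderiv_const (m := ∞) (by simp)) hv hs

theorem contDiffAt_bilin_mfderiv_symm
    {b : ∀ p : X, TangentSpace (𝓡 N) p →L[ℝ] TangentSpace (𝓡 N) p →L[ℝ] ℝ}
    (hb : ContMDiff (𝓡 N) ((𝓡 N).prod 𝓘(ℝ, Eu N →L[ℝ] Eu N →L[ℝ] ℝ)) ∞
      (fun p => Bundle.TotalSpace.mk' (Eu N →L[ℝ] Eu N →L[ℝ] ℝ)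
        (E := fun p : X => (TangentSpace (𝓡 N) p →L[ℝ] TangentSpace (𝓡 N) p →L[ℝ] ℝ)) p (b p)))
    (hψ : ψ ∈ IsManifold.maximalAtlas (𝓡 N) ∞ X) {y : Eu N} (hy : y ∈ ψ.target) (v w : Eu N) :
    ContDiffAt ℝ ∞ (fun z => b (ψ.symm z) (mfderiv (𝓡 N) (𝓡 N) ψ.symm z v)
      (mfderiv (𝓡 N) (𝓡 N) ψ.symm z w)) y := by
  have hs : ContMDiffAt (𝓡 N) (𝓡 N) ∞ ψ.symm y := contMDiffAt_symm_of_mem_maximalAtlas hψ hy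
  have : ContMDiffAt (𝓡 N) ((𝓡 N).prod 𝓘(ℝ)) ∞
      (fun z => Bundle.TotalSpace.mk' ℝ (E := Bundle.Trivial X ℝ) (ψ.symm z)
        (b (ψ.symm z) (mfderiv (𝓡 N) (𝓡 N) ψ.symm z v) (mfderiv (𝓡 N) (𝓡 N) ψ.symm z w))) y := by
    apply ContMDiffAt.clm_bundle_apply₂ (F₁ := Eu N) (F₂ := Eu N)
    · exact ContMDiffAt.comp y hb.contMDiffAt hs
    · exact contMDiffAt_mfderiv_symm_apply hψ hy v
    · exact contMDiffAt_mfderiv_symm_apply hψ hy w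
  rw [Bundle.contMDiffAt_totalSpace] at this
  exact contMDiffAt_iff_contDiffAt.mp this.2

theorem contDiffAt_coordMatrix
    {b : ∀ p : X, TangentSpace (𝓡 N) p →L[ℝ] TangentSpace (𝓡 N) p →L[ℝ] ℝ}
    (hb : ContMDiff (𝓡 N) ((𝓡 N).prod 𝓘(ℝ, Eu N →L[ℝ] Eu N →L[ℝ] ℝ)) ∞
      (fun p => Bundle.TotalSpace.mk' (Eu N →L[ℝ] Eu N →L[ℝ] ℝ)
        (E := fun p : X => (TangentSpace (𝓡 N) p →L[ℝ] TangentSpace (𝓡 N) p →L[ℝ] ℝ)) p (b p)))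
    (hψ : ψ ∈ IsManifold.maximalAtlas (𝓡 N) ∞ X) {y : Eu N} (hy : y ∈ ψ.target) (i j : Fin N) :
    ContDiffAt ℝ ∞ (fun z => coordMatrix ψ (toTwoForm b) z i j) y :=
  contDiffAt_bilin_mfderiv_symm hb hψ hy (basisVec i) (basisVec j)

end Charts

/-! ### The immersion and restricted tensors in charts. -/

section Pullback

variable {n N : ℕ} {X Y : Type*} [TopologicalSpace X] [ChartedSpace (Eu n) X]
  [TopologicalSpace Y] [ChartedSpace (Eu N) Y]
  {χ : OpenPartialHomeomorph X (Eu n)} {ψ : OpenPartialHomeomorph Y (Eu N)} {f : X → Y}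

/-- The map `f` in the charts `χ` and `ψ`. -/
def localRep (f : X → Y) (χ : OpenPartialHomeomorph X (Eu n)) (ψ : OpenPartialHomeomorph Y (Eu N)) :
    Eu n → Eu N := fun x => ψ (f (χ.symm x))

theorem contDiffAt_localRep [IsManifold (𝓡 n) ∞ X] [IsManifold (𝓡 N) ∞ Y]
    (hf : ContMDiff (𝓡 n) (𝓡 N) ∞ f) (hχ : χ ∈ IsManifold.maximalAtlas (𝓡 n) ∞ X)
    (hψ : ψ ∈ IsManifold.maximalAtlas (𝓡 N) ∞ Y) {x : Eu n} (hx : x ∈ χ.target)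
    (hfx : f (χ.symm x) ∈ ψ.source) : ContDiffAt ℝ ∞ (localRep f χ ψ) x := by
  rw [← contMDiffAt_iff_contDiffAt]
  exact (contMDiffAt_of_mem_maximalAtlas hψ hfx).comp x
    (hf.contMDiffAt.comp x (contMDiffAt_symm_of_mem_maximalAtlas hχ hx))

theorem fderiv_localRep (hf : MDifferentiable (𝓡 n) (𝓡 N) f)
    (hχ : χ ∈ IsManifold.maximalAtlas (𝓡 n) ∞ X) (hψ : ψ ∈ IsManifold.maximalAtlas (𝓡 N) ∞ Y)
    {x : Eu n} (hx : x ∈ χ.target) (hfx : f (χ.symm x) ∈ ψ.source) (v : Eu n) :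
    fderiv ℝ (localRep f χ ψ) x v = mfderiv (𝓡 N) (𝓡 N) ψ (f (χ.symm x))
      (mfderiv (𝓡 n) (𝓡 N) f (χ.symm x) (mfderiv (𝓡 n) (𝓡 n) χ.symm x v)) := by
  have h1 := (mdifferentiable_of_mem_maximalAtlas hχ).mdifferentiableAt_symm hx
  have h2 := (mdifferentiable_of_mem_maximalAtlas hψ).mdifferentiableAt hfx
  have h3 := h2.hasMFDerivAt.comp x ((hf (χ.symm x)).hasMFDerivAt.comp x h1.hasMFDerivAt)
  rw [← mfderiv_eq_fderiv]
  exact DFunLike.congr_fun h3.mfderiv v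

theorem mfderiv_symm_fderiv_localRep (hf : MDifferentiable (𝓡 n) (𝓡 N) f)
    (hχ : χ ∈ IsManifold.maximalAtlas (𝓡 n) ∞ X) (hψ : ψ ∈ IsManifold.maximalAtlas (𝓡 N) ∞ Y)
    {x : Eu n} (hx : x ∈ χ.target) (hfx : f (χ.symm x) ∈ ψ.source) (v : Eu n) :
    mfderiv (𝓡 N) (𝓡 N) ψ.symm (localRep f χ ψ x) (fderiv ℝ (localRep f χ ψ) x v) =
      mfderiv (𝓡 n) (𝓡 N) f (χ.symm x) (mfderiv (𝓡 n) (𝓡 n) χ.symm x v) := by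
  rw [fderiv_localRep hf hχ hψ hx hfx]
  exact congrArg (fun L => L (mfderiv (𝓡 n) (𝓡 N) f (χ.symm x) (mfderiv (𝓡 n) (𝓡 n) χ.symm x v)))
    ((mdifferentiable_of_mem_maximalAtlas hψ).symm_comp_deriv hfx)

theorem pullback_eq_matForm (hf : MDifferentiable (𝓡 n) (𝓡 N) f)
    (hχ : χ ∈ IsManifold.maximalAtlas (𝓡 n) ∞ X) (hψ : ψ ∈ IsManifold.maximalAtlas (𝓡 N) ∞ Y)
    (b : ∀ p : Y, TangentSpace (𝓡 N) p →L[ℝ] TangentSpace (𝓡 N) p →L[ℝ] ℝ)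
    {x : Eu n} (hx : x ∈ χ.target) (hfx : f (χ.symm x) ∈ ψ.source) (u v : Eu n) :
    pullback f (toTwoForm b) (χ.symm x) (mfderiv (𝓡 n) (𝓡 n) χ.symm x u)
        (mfderiv (𝓡 n) (𝓡 n) χ.symm x v) =
      matForm (coordMatrix ψ (toTwoForm b) (localRep f χ ψ x))
        (fderiv ℝ (localRep f χ ψ) x u) (fderiv ℝ (localRep f χ ψ) x v) := by
  rw [matForm_coordMatrix]
  -- All tangent spaces unfold to `Eu N`, so the base point can be changed along the equality
  -- `ψ.symm (ψ q) = q` while the vectors stay fixed.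
  have key : ∀ (p p' : Y) (h : p = p') (a c : Eu N),
      b p (show TangentSpace (𝓡 N) p from a) (show TangentSpace (𝓡 N) p from c) =
      b p' (show TangentSpace (𝓡 N) p' from a) (show TangentSpace (𝓡 N) p' from c) := by
    rintro p _ rfl a c; rfl
  have h1 := mfderiv_symm_fderiv_localRep hf hχ hψ hx hfx u
  have h2 := mfderiv_symm_fderiv_localRep hf hχ hψ hx hfx v
  have e : ψ.symm (localRep f χ ψ x) = f (χ.symm x) := ψ.left_inv hfx
  refine (key _ _ e.symm _ _).trans ?_
  exact congrArg₂ (fun a c => b (ψ.symm (localRep f χ ψ x)) a c) h1.symm h2.symm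

theorem coordMatrix_pullback (hf : MDifferentiable (𝓡 n) (𝓡 N) f)
    (hχ : χ ∈ IsManifold.maximalAtlas (𝓡 n) ∞ X) (hψ : ψ ∈ IsManifold.maximalAtlas (𝓡 N) ∞ Y)
    (b : ∀ p : Y, TangentSpace (𝓡 N) p →L[ℝ] TangentSpace (𝓡 N) p →L[ℝ] ℝ)
    {x : Eu n} (hx : x ∈ χ.target) (hfx : f (χ.symm x) ∈ ψ.source) (i j : Fin n) :
    coordMatrix χ (pullback f (toTwoForm b)) x i j =
      matForm (coordMatrix ψ (toTwoForm b) (localRep f χ ψ x))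
        (fderiv ℝ (localRep f χ ψ) x (basisVec i)) (fderiv ℝ (localRep f χ ψ) x (basisVec j)) :=
  pullback_eq_matForm hf hχ hψ b hx hfx _ _

end Pullback

/-! ### Curvature components in terms of the Christoffel map. -/

section Curvature

variable {N : ℕ} {G : Eu N → Matrix (Fin N) (Fin N) ℝ} {y : Eu N}

theorem fderiv_chrMap_apply (hΓ : ∀ a b c, ContDiffAt ℝ 1 (fun z => christoffel G z a b c) y)
    (u v w : Eu N) (a : Fin N) :
    fderiv ℝ (chrMap G) y u v w a =
      ∑ b, ∑ c, ∑ d, pd d (fun z => christoffel G z a b c) y * u d * v b * w c := by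
  have h1 : DifferentiableAt ℝ (chrMap G) y :=
    (contDiffAt_symbolMap hΓ).differentiableAt (by simp)
  have e1 : HasFDerivAt (fun z => (EuclideanSpace.proj a : Eu N →L[ℝ] ℝ) (chrMap G z v w)) _ y :=
    (EuclideanSpace.proj a : Eu N →L[ℝ] ℝ).hasFDerivAt.comp y
      ((h1.hasFDerivAt.clm_apply (hasFDerivAt_const v y)).clm_apply (hasFDerivAt_const w y))
  have e2 : HasFDerivAt (fun z => ∑ b, ∑ c, christoffel G z a b c * v b * w c) _ y :=
    HasFDerivAt.fun_sum fun b _ => HasFDerivAt.fun_sum fun c _ =>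
      ((((hΓ a b c).differentiableAt (by simp)).hasFDerivAt.mul_const (v b)).mul_const (w c))
  have heq : (fun z => (EuclideanSpace.proj a : Eu N →L[ℝ] ℝ) (chrMap G z v w)) =
      fun z => ∑ b, ∑ c, christoffel G z a b c * v b * w c := by
    ext z; exact chrMap_apply G z v w a
  rw [heq] at e1
  have h3 := congrArg (fun L => L u) (e1.unique e2)
  simp only [ContinuousLinearMap.comp_apply, add_apply, ContinuousLinearMap.flip_apply, zero_apply,
    map_zero, zero_add, sum_apply, smul_apply, smul_eq_mul, PiLp.proj_apply] at h3
  rw [h3]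
  refine Finset.sum_congr rfl fun b _ => Finset.sum_congr rfl fun c _ => ?_
  rw [map_eq_sum_basisVec (fderiv ℝ (fun z => christoffel G z a b c) y) u, Finset.mul_sum,
    Finset.mul_sum]
  refine Finset.sum_congr rfl fun d _ => ?_
  simp only [pd, smul_eq_mul]
  ring

theorem chrMap_chrMap_apply (u v w : Eu N) (a : Fin N) :
    chrMap G y u (chrMap G y v w) a = ∑ c, ∑ d, ∑ b, (∑ e, christoffel G y a c e *
      christoffel G y e d b) * u c * v d * w b := by
  simp only [chrMap_apply, Finset.mul_sum, Finset.sum_mul]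
  refine Finset.sum_congr rfl fun c _ => ?_
  rw [Finset.sum_comm]
  refine Finset.sum_congr rfl fun d _ => ?_
  rw [Finset.sum_comm]
  refine Finset.sum_congr rfl fun b _ => Finset.sum_congr rfl fun e _ => ?_
  ring

/-- Contracting with vectors only permutes summation indices; the identities `t1` to `t4` bring the
four terms to a common order. -/
theorem sum_curvCoord (hΓ : ∀ a b c, ContDiffAt ℝ 1 (fun z => christoffel G z a b c) y)
    (u v w : Eu N) (a : Fin N) :
    ∑ b, ∑ c, ∑ d, curvCoord G y a b c d * u c * v d * w b =
      (fderiv ℝ (chrMap G) y u v w - fderiv ℝ (chrMap G) y v u w + chrMap G y u (chrMap G y v w)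
        - chrMap G y v (chrMap G y u w)) a := by
  simp only [PiLp.sub_apply, PiLp.add_apply, fderiv_chrMap_apply hΓ, chrMap_chrMap_apply]
  have t1 : ∑ b, ∑ c, ∑ d, pd d (fun z => christoffel G z a b c) y * u d * v b * w c =
      ∑ b, ∑ c, ∑ d, pd c (fun z => christoffel G z a d b) y * u c * v d * w b := by
    rw [Finset.sum_comm]
    exact Finset.sum_congr rfl fun c _ => Finset.sum_comm
  have t2 : ∑ b, ∑ c, ∑ d, pd d (fun z => christoffel G z a b c) y * v d * u b * w c =
      ∑ b, ∑ c, ∑ d, pd d (fun z => christoffel G z a c b) y * u c * v d * w b := by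
    rw [Finset.sum_comm]
    refine Finset.sum_congr rfl fun c _ => Finset.sum_congr rfl fun b _ =>
      Finset.sum_congr rfl fun d _ => ?_
    ring
  have t3 : ∑ c, ∑ d, ∑ b, (∑ e, christoffel G y a c e * christoffel G y e d b) * u c * v d * w b =
      ∑ b, ∑ c, ∑ d, (∑ e, christoffel G y a c e * christoffel G y e d b) * u c * v d * w b := by
    rw [Finset.sum_comm]
    exact (Finset.sum_congr rfl fun d _ => Finset.sum_comm).trans
      (Finset.sum_comm.trans (Finset.sum_congr rfl fun b _ => Finset.sum_comm))
  have t4 : ∑ c, ∑ d, ∑ b, (∑ e, christoffel G y a c e * christoffel G y e d b) * v c * u d * w b =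
      ∑ b, ∑ c, ∑ d, (∑ e, christoffel G y a d e * christoffel G y e c b) * u c * v d * w b := by
    refine (Finset.sum_congr rfl fun c _ => Finset.sum_comm).trans
      (Finset.sum_comm.trans (Finset.sum_congr rfl fun b _ => ?_))
    rw [Finset.sum_comm]
    refine Finset.sum_congr rfl fun c _ => Finset.sum_congr rfl fun d _ => ?_
    ring
  rw [t1, t2, t3, t4]
  simp only [← Finset.sum_add_distrib, ← Finset.sum_sub_distrib]
  refine Finset.sum_congr rfl fun b _ => Finset.sum_congr rfl fun c _ =>
    Finset.sum_congr rfl fun d _ => ?_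
  rw [curvCoord, Finset.sum_sub_distrib]
  ring

theorem riemann_eq_curvTerm {X : Type*} [TopologicalSpace X] [ChartedSpace (Eu N) X]
    {g : TwoForm N X} {ψ : OpenPartialHomeomorph X (Eu N)} {p : X}
    (hΓ : ∀ a b c, ContDiffAt ℝ 1 (fun z => christoffel (coordMatrix ψ g) z a b c) (ψ p))
    {x y : TangentSpace (𝓡 N) p} {u v : Eu N} (hx : coordVec ψ p x = u) (hy : coordVec ψ p y = v) :
    riemann g ψ p x y x y = curvTerm (matForm (coordMatrix ψ g (ψ p)))
      (chrMap (coordMatrix ψ g) (ψ p)) (fderiv ℝ (chrMap (coordMatrix ψ g)) (ψ p)) u v := by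
  rw [curvTerm, riemann, matForm_apply, hx, hy, neg_inj]
  refine Finset.sum_congr rfl fun a _ => ?_
  simp only [← sum_curvCoord hΓ u v u a, Finset.mul_sum, Finset.sum_mul]
  symm
  rw [Finset.sum_comm]
  refine Finset.sum_congr rfl fun b _ => ?_
  rw [Finset.sum_comm]
  refine Finset.sum_congr rfl fun c _ => ?_
  rw [Finset.sum_comm]
  refine Finset.sum_congr rfl fun d _ => Finset.sum_congr rfl fun e _ => ?_
  ring

end Curvature

/-! ### Nondegeneracy and the sign of the metric on normal vectors. -/

section Signature

variable {n m : ℕ} {X : Type*} [TopologicalSpace X] [ChartedSpace (Eu (n + m)) X]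
  [IsManifold (𝓡 (n + m)) ∞ X]

theorem PseudoMetric.eq_zero_of_forall (g : PseudoMetric n m X) {p : X}
    {a : TangentSpace (𝓡 (n + m)) p} (h : ∀ c, g.val p a c = 0) : a = 0 := by
  obtain ⟨b, h0, h1, h2⟩ := g.signature p
  have key : ∀ j, b.repr a j * g.val p (b j) (b j) = 0 := fun j => by
    have h3 := h (b j)
    rw [← b.sum_repr a] at h3
    simp only [map_sum, map_smul, sum_apply, smul_apply, smul_eq_mul] at h3
    rwa [Finset.sum_eq_single j (fun i _ hi => by rw [h0 i j hi, mul_zero])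
      (fun hj => absurd (Finset.mem_univ j) hj)] at h3
  refine b.ext_elem fun j => ?_
  have h4 := key j
  rcases j with j | j
  · rw [h1] at h4; simpa using h4
  · rw [h2] at h4; simpa using h4

/-- If `v` were positive, it would span together with `E` a positive definite space of dimension `n
+ 1`. Such a space meets the `m`-dimensional negative definite span of the last basis vectors, a
contradiction. -/
theorem PseudoMetric.nonpos_of_orthogonal (g : PseudoMetric n m X) {p : X}
    {E : Fin n → TangentSpace (𝓡 (n + m)) p}
    (hE : ∀ k l, g.val p (E k) (E l) = if k = l then 1 else 0)
    {v : TangentSpace (𝓡 (n + m)) p} (hv : ∀ l, g.val p v (E l) = 0) : g.val p v v ≤ 0 := by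
  obtain ⟨b, h0, h1, h2⟩ := g.signature p
  by_contra! hpos
  let T : ((Fin n → ℝ) × ℝ) →ₗ[ℝ] TangentSpace (𝓡 (n + m)) p :=
    LinearMap.coprod (Fintype.linearCombination ℝ E) (LinearMap.toSpanSingleton ℝ _ v)
  let pr : TangentSpace (𝓡 (n + m)) p →ₗ[ℝ] (Fin n → ℝ) :=
    LinearMap.pi fun i => b.coord (Sum.inl i)
  -- A linear map from dimension `n + 1` to dimension `n` has a kernel. Working with coefficients
  -- avoids proving that `E` and `v` are independent.
  obtain ⟨⟨a, t⟩, hne, hker⟩ : ∃ x : (Fin n → ℝ) × ℝ, x ≠ 0 ∧ (pr ∘ₗ T) x = 0 := by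
    have : ¬ Function.Injective (pr ∘ₗ T) := fun hinj => by
      have := LinearMap.finrank_le_finrank_of_injective hinj
      simp at this
    rw [injective_iff_map_eq_zero] at this
    push Not at this
    obtain ⟨x, hx, hx0⟩ := this
    exact ⟨x, hx0, hx⟩
  set u := ∑ k, a k • E k + t • v with hu
  have hTu : T (a, t) = u := by
    simp [T, hu, Fintype.linearCombination_apply]
  have hcoord : ∀ i, b.repr u (Sum.inl i) = 0 := fun i => by
    have := congrFun hker i
    rw [LinearMap.comp_apply, hTu] at this
    simpa [pr] using this
  have hle : g.val p u u ≤ 0 := by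
    have h3 : g.val p u u = ∑ j, b.repr u j * (b.repr u j * g.val p (b j) (b j)) := by
      conv_lhs => rw [← b.sum_repr u]
      simp only [map_sum, map_smul, sum_apply, smul_apply, smul_eq_mul]
      refine Finset.sum_congr rfl fun j _ => ?_
      congr 1
      rw [Finset.sum_eq_single j (fun i _ hi => by rw [h0 i j hi, mul_zero])
        (fun hj => absurd (Finset.mem_univ j) hj)]
    rw [h3, Fintype.sum_sum_type]
    simp only [hcoord, zero_mul, Finset.sum_const_zero, zero_add, h2]
    refine Finset.sum_nonpos fun j _ => ?_
    nlinarith [sq_nonneg (b.repr u (Sum.inr j))]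
  have hEv : ∀ k, g.val p (E k) v = 0 := fun k => by rw [g.symm, hv]
  have heq : g.val p u u = ∑ k, a k ^ 2 + t ^ 2 * g.val p v v := by
    simp only [hu, map_add, add_apply, map_sum, map_smul, sum_apply, smul_apply, smul_eq_mul, hE,
      hv, hEv, mul_ite, mul_one, mul_zero,
      Finset.sum_const_zero, zero_add, add_zero]
    simp [sq]
    ring
  have ha : 0 ≤ ∑ k, a k ^ 2 := Finset.sum_nonneg fun k _ => sq_nonneg _
  have ht2 : 0 ≤ t ^ 2 * g.val p v v := mul_nonneg (sq_nonneg t) hpos.le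
  have ht : t = 0 := by
    have : t ^ 2 * g.val p v v = 0 := by linarith
    rcases mul_eq_zero.mp this with h | h
    · exact pow_eq_zero_iff (two_ne_zero) |>.mp h
    · exact absurd h hpos.ne'
  have ha0 : ∑ k, a k ^ 2 = 0 := by linarith
  have ha' : a = 0 := by
    ext k
    have := (Finset.sum_eq_zero_iff_of_nonneg fun k _ => sq_nonneg (a k)).mp ha0 k
      (Finset.mem_univ k)
    exact pow_eq_zero_iff (two_ne_zero) |>.mp this
  exact hne (by rw [ha', ht]; rfl)

variable {ψ : OpenPartialHomeomorph X (Eu (n + m))}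

theorem PseudoMetric.det_coordMatrix_ne_zero (g : PseudoMetric n m X)
    (hψ : ψ ∈ IsManifold.maximalAtlas (𝓡 (n + m)) ∞ X) {y : Eu (n + m)} (hy : y ∈ ψ.target) :
    (coordMatrix ψ g.form y).det ≠ 0 := by
  intro hdet
  obtain ⟨v, hv, hv0⟩ := Matrix.exists_mulVec_eq_zero_iff.mpr hdet
  let v' : Eu (n + m) := WithLp.toLp 2 v
  have h1 : ∀ w : Eu (n + m), matForm (coordMatrix ψ g.form y) w v' = 0 := fun w => by
    rw [matForm_apply]
    refine Finset.sum_eq_zero fun i _ => ?_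
    have := congrFun hv0 i
    simp only [Matrix.mulVec, dotProduct, Pi.zero_apply] at this
    calc ∑ j, coordMatrix ψ g.form y i j * w i * v' j
        = w i * ∑ j, coordMatrix ψ g.form y i j * v j := by
          rw [Finset.mul_sum]; exact Finset.sum_congr rfl fun j _ => by ring
      _ = 0 := by rw [this, mul_zero]
  have h2 : (mfderiv (𝓡 (n + m)) (𝓡 (n + m)) ψ.symm y v' :
      TangentSpace (𝓡 (n + m)) (ψ.symm y)) = 0 := by
    refine g.eq_zero_of_forall fun c => ?_
    obtain ⟨w, rfl⟩ := mfderiv_symm_surjective hψ hy c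
    rw [g.symm, ← h1 w]
    exact (matForm_coordMatrix g.val y w v').symm
  have h3 := mfderiv_symm_injective hψ hy h2
  apply hv
  ext i
  exact congrArg (fun x : Eu (n + m) => x i) h3

theorem PseudoMetric.matForm_nonpos_of_orthogonal (g : PseudoMetric n m X) {y : Eu (n + m)}
    {E : Fin n → Eu (n + m)}
    (hE : ∀ k l, matForm (coordMatrix ψ g.form y) (E k) (E l) = if k = l then 1 else 0)
    {v : Eu (n + m)} (hv : ∀ l, matForm (coordMatrix ψ g.form y) v (E l) = 0) :
    matForm (coordMatrix ψ g.form y) v v ≤ 0 := by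
  have key := fun u w => matForm_coordMatrix (ψ := ψ) g.val y u w
  refine (key v v).trans_le (g.nonpos_of_orthogonal
    (E := fun k => mfderiv (𝓡 (n + m)) (𝓡 (n + m)) ψ.symm y (E k)) (fun k l => ?_) fun l => ?_)
  · exact (key (E k) (E l)).symm.trans (hE k l)
  · exact (key v (E l)).symm.trans (hv l)

end Signature

/-! ### Rayleigh quotients. -/

section Eigenvalue

theorem eq_zero_of_forall_mul_add_le {α β : ℝ} (h : ∀ t : ℝ, t * α + t ^ 2 * β ≤ 0) : α = 0 := by
  have hl : IsLocalMax (fun t : ℝ => t * α + t ^ 2 * β) 0 :=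
    Filter.Eventually.of_forall fun t => by simpa using h t
  have hd : HasDerivAt (fun t : ℝ => t * α + t ^ 2 * β) α 0 := by
    refine (((hasDerivAt_id (0 : ℝ)).mul_const α).fun_add
      (((hasDerivAt_id (0 : ℝ)).fun_pow 2).mul_const β)).congr_deriv ?_
    simp
  exact hl.hasDerivAt_eq_zero hd

/-- The largest eigenvalue is attained, and it is the maximum of the Rayleigh quotient. -/
theorem largestEigenvalue_spec {V : Type*} [NormedAddCommGroup V] [NormedSpace ℝ V]
    [FiniteDimensional ℝ V] [Nontrivial V] {g B : V →L[ℝ] V →L[ℝ] ℝ}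
    (hgs : ∀ v w, g v w = g w v) (hBs : ∀ v w, B v w = B w v) (hg : ∀ v, v ≠ 0 → 0 < g v v) :
    (∀ w, B w w ≤ largestEigenvalue (fun v w => g v w) (fun v w => B v w) * g w w) ∧
    ∃ v, v ≠ 0 ∧ ∀ w, B v w = largestEigenvalue (fun v w => g v w) (fun v w => B v w) * g v w := by
  have hcomp : IsCompact (Metric.sphere (0 : V) 1) := by
    have : ProperSpace V := FiniteDimensional.proper_real V
    exact isCompact_sphere 0 1
  have hne : (Metric.sphere (0 : V) 1).Nonempty := NormedSpace.sphere_nonempty.mpr zero_le_one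
  have hsph : ∀ v ∈ Metric.sphere (0 : V) 1, v ≠ 0 := fun v hv => ne_zero_of_mem_unit_sphere ⟨v, hv⟩
  have hcont : ContinuousOn (fun v => B v v / g v v) (Metric.sphere (0 : V) 1) :=
    ContinuousOn.div (by fun_prop) (by fun_prop) fun v hv => (hg v (hsph v hv)).ne'
  -- The quotient is homogeneous of degree zero, so a maximizer on the compact unit sphere is a
  -- global one.
  obtain ⟨v₀, hv₀, hmax⟩ := hcomp.exists_isMaxOn hne hcont
  set μ := B v₀ v₀ / g v₀ v₀ with hμ
  have h0 := hsph v₀ hv₀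
  have hle : ∀ w, B w w ≤ μ * g w w := fun w => by
    by_cases hw : w = 0
    · simp [hw]
    have hw' : 0 < ‖w‖ := norm_pos_iff.mpr hw
    have h1 := hmax (show ‖w‖⁻¹ • w ∈ Metric.sphere (0 : V) 1 by
      simp [norm_smul, hw'.ne'])
    simp only [Set.mem_ofPred_eq, map_smul, smul_apply, smul_eq_mul] at h1
    rw [mul_div_mul_left _ _ (inv_ne_zero hw'.ne'), mul_div_mul_left _ _ (inv_ne_zero hw'.ne'),
      div_le_iff₀ (hg w hw)] at h1
    exact h1
  have heq : B v₀ v₀ = μ * g v₀ v₀ := by rw [hμ, div_mul_cancel₀ _ (hg v₀ h0).ne']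
  -- The quadratic polynomial in `t` coming from `v₀ + t • w` is nonpositive and vanishes at `0`, so
  -- its linear coefficient is zero: `v₀` is an eigenvector.
  have hcrit : ∀ w, B v₀ w = μ * g v₀ w := fun w => by
    have := eq_zero_of_forall_mul_add_le (α := 2 * (B v₀ w - μ * g v₀ w))
      (β := B w w - μ * g w w) fun t => by
        have h2 := hle (v₀ + t • w)
        simp only [map_add, map_smul, add_apply, smul_apply, smul_eq_mul, hBs w v₀, hgs w v₀] at h2
        nlinarith
    linarith
  have hgreat : IsGreatest (eigenvalues (fun v w => g v w) (fun v w => B v w)) μ := by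
    refine ⟨⟨v₀, h0, hcrit⟩, ?_⟩
    rintro c ⟨v, hv, hc⟩
    have h3 := hle v
    rw [show B v v = c * g v v from hc v] at h3
    exact le_of_mul_le_mul_right h3 (hg v hv)
  have hsup : largestEigenvalue (fun v w => g v w) (fun v w => B v w) = μ := hgreat.csSup_eq
  rw [hsup]
  exact ⟨hle, v₀, h0, hcrit⟩

end Eigenvalue

/-! ### Quadratic changes of coordinates. -/

section QuadraticMap

variable {V W : Type*} [NormedAddCommGroup V] [NormedSpace ℝ V]
  [NormedAddCommGroup W] [NormedSpace ℝ W]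

/-- A quadratic polynomial map with prescribed 2-jet at `0`. -/
def quadMap (x : V) (L : W →L[ℝ] V) (Q : W →L[ℝ] W →L[ℝ] V) (w : W) : V :=
  x + L w + (1 / 2 : ℝ) • Q w w

variable {x : V} {L : W →L[ℝ] V} {Q : W →L[ℝ] W →L[ℝ] V}

theorem hasFDerivAt_quadMap (hQ : ∀ u v, Q u v = Q v u) (w : W) :
    HasFDerivAt (quadMap x L Q) (L + Q w) w := by
  have h1 : HasFDerivAt (fun w => Q w w) _ w := Q.hasFDerivAt.clm_apply (hasFDerivAt_id w)
  refine (((hasFDerivAt_const x w).fun_add L.hasFDerivAt).fun_add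
    (h1.const_smul (1 / 2 : ℝ))).congr_fderiv ?_
  ext u
  simp only [zero_add, add_apply, smul_apply, ContinuousLinearMap.comp_apply,
    ContinuousLinearMap.flip_apply, ContinuousLinearMap.id_apply]
  rw [hQ u w, ← two_smul ℝ (Q w u), smul_smul]
  norm_num

theorem fderiv_quadMap (hQ : ∀ u v, Q u v = Q v u) :
    fderiv ℝ (quadMap x L Q) = fun w => L + Q w :=
  funext fun w => (hasFDerivAt_quadMap hQ w).fderiv

theorem fderiv_fderiv_quadMap (hQ : ∀ u v, Q u v = Q v u) (w : W) :
    fderiv ℝ (fderiv ℝ (quadMap x L Q)) w = Q := by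
  rw [fderiv_quadMap hQ]
  exact (Q.hasFDerivAt.const_add L).fderiv

theorem contDiff_quadMap {k : WithTop ℕ∞} : ContDiff ℝ k (quadMap x L Q) :=
  (contDiff_const.add L.contDiff).add ((Q.contDiff.clm_apply contDiff_id).const_smul _)

/-- The second derivative of a composition. -/
theorem fderiv_fderiv_comp {U : Type*} [NormedAddCommGroup U] [NormedSpace ℝ U] {F : V → U}
    {P : W → V} {w : W} (hF : ContDiffAt ℝ 2 F (P w)) (hP : ContDiffAt ℝ 2 P w) (a b : W) :
    fderiv ℝ (fderiv ℝ (fun z => F (P z))) w a b =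
      fderiv ℝ (fderiv ℝ F) (P w) (fderiv ℝ P w a) (fderiv ℝ P w b)
        + fderiv ℝ F (P w) (fderiv ℝ (fderiv ℝ P) w a b) := by
  have h1 : fderiv ℝ (fun z => F (P z)) =ᶠ[𝓝 w]
      fun z => (fderiv ℝ F (P z)).comp (fderiv ℝ P z) := by
    filter_upwards [hP.eventually (by simp),
      hP.continuousAt.eventually (hF.eventually (by simp))] with z h2 h3
    exact fderiv_comp z (h3.differentiableAt (by simp)) (h2.differentiableAt (by simp))
  rw [h1.fderiv_eq]
  have d1 : HasFDerivAt (fun z => fderiv ℝ F (P z)) _ w :=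
    HasFDerivAt.comp w ((hF.fderiv_right (m := 1) (by norm_num)).differentiableAt
      (by simp)).hasFDerivAt (hP.differentiableAt (by simp)).hasFDerivAt
  have d2 : HasFDerivAt (fderiv ℝ P) (fderiv ℝ (fderiv ℝ P) w) w :=
    ((hP.fderiv_right (m := 1) (by norm_num)).differentiableAt (by simp)).hasFDerivAt
  rw [(d1.clm_comp d2).fderiv]
  simp
  abel

end QuadraticMap

/-! ### Construction of the adapted chart on the submanifold. -/

section NormalChart

variable {n : ℕ} {X : Type*} [TopologicalSpace X] [ChartedSpace (Eu n) X]
  [IsManifold (𝓡 n) ∞ X]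

/-- Reparametrizing a chart by a quadratic polynomial map with invertible linear part. -/
theorem exists_chart_comp_quadMap {χ : OpenPartialHomeomorph X (Eu n)}
    (hχ : χ ∈ IsManifold.maximalAtlas (𝓡 n) ∞ X) {p : X} (hp : p ∈ χ.source)
    (L : Eu n ≃L[ℝ] Eu n) {Q : Eu n →L[ℝ] Eu n →L[ℝ] Eu n} (hQ : ∀ u v, Q u v = Q v u) :
    ∃ χ' ∈ IsManifold.maximalAtlas (𝓡 n) ∞ X, p ∈ χ'.source ∧ χ' p = 0 ∧
      (∀ x, χ'.symm x = χ.symm (quadMap (χ p) (L : Eu n →L[ℝ] Eu n) Q x)) ∧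
      ∀ v, (show Eu n from mfderiv (𝓡 n) (𝓡 n) χ'.symm 0 v) =
        (show Eu n from mfderiv (𝓡 n) (𝓡 n) χ.symm (χ p) (L v)) := by
  set P := quadMap (χ p) (L : Eu n →L[ℝ] Eu n) Q with hP
  have hPs : ContDiff ℝ ∞ P := contDiff_quadMap
  have hP0 : P 0 = χ p := by simp [hP, quadMap]
  have hL0 : HasFDerivAt P (L : Eu n →L[ℝ] Eu n) 0 := by
    simpa using hasFDerivAt_quadMap (x := χ p) (L := (L : Eu n →L[ℝ] Eu n)) hQ 0
  let e₀ := hPs.contDiffAt.toOpenPartialHomeomorph P hL0 (by simp)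
  have he₀ : (0 : Eu n) ∈ e₀.source :=
    hPs.contDiffAt.mem_toOpenPartialHomeomorph_source hL0 (by simp)
  -- Restricting to points where the derivative is invertible makes the local inverse smooth on its
  -- whole domain, as membership in the maximal atlas requires.
  let U : Set (Eu n) := {x | (L : Eu n →L[ℝ] Eu n) + Q x ∈
    Set.range fun E : Eu n ≃L[ℝ] Eu n => (E : Eu n →L[ℝ] Eu n)}
  have hU : IsOpen U := ContinuousLinearEquiv.isOpen.preimage (by fun_prop)
  have h0U : (0 : Eu n) ∈ U := ⟨L, by simp⟩
  let e := e₀.restrOpen U hU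
  have he0 : (0 : Eu n) ∈ e.source := ⟨he₀, h0U⟩
  have hecoe : ∀ x, e x = P x := fun x => rfl
  have hes : ContDiffOn ℝ ∞ e.symm e.target := fun y hy => by
    obtain ⟨E, hE⟩ : e.symm y ∈ U := (e.map_target hy).2
    refine (e.contDiffAt_symm hy (f₀' := E) ?_ hPs.contDiffAt).contDiffWithinAt
    change (E : Eu n →L[ℝ] Eu n) = (L : Eu n →L[ℝ] Eu n) + Q (e.symm y) at hE
    rw [hE]
    exact hasFDerivAt_quadMap hQ _
  let χ' := χ.trans e.symm
  refine ⟨χ', ?_, ?_, ?_, fun x => rfl, ?_⟩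
  · apply OpenPartialHomeomorph.mem_maximalAtlas_of_contMDiffOn
    · have h1 : ContMDiffOn (𝓡 n) (𝓡 n) ∞ e.symm e.target := contMDiffOn_iff_contDiffOn.mpr hes
      refine h1.comp ((contMDiffOn_of_mem_maximalAtlas hχ).mono ?_) ?_
      · intro x hx; exact hx.1
      · intro x hx; exact hx.2
    · have h1 : ContMDiffOn (𝓡 n) (𝓡 n) ∞ P Set.univ :=
        contMDiffOn_iff_contDiffOn.mpr hPs.contDiffOn
      refine (contMDiffOn_symm_of_mem_maximalAtlas hχ).comp (h1.mono (Set.subset_univ _)) ?_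
      intro x hx
      exact hx.2
  · refine ⟨hp, ?_⟩
    have := e.map_source he0
    rw [hecoe, hP0] at this
    exact this
  · change e.symm (χ p) = 0
    rw [← hP0, ← hecoe]
    exact e.left_inv he0
  · intro v
    have h1 : HasMFDerivAt (𝓡 n) (𝓡 n) χ.symm (P 0) (mfderiv (𝓡 n) (𝓡 n) χ.symm (P 0)) := by
      refine ((mdifferentiable_of_mem_maximalAtlas hχ).mdifferentiableAt_symm ?_).hasMFDerivAt
      rw [hP0]; exact χ.map_source hp
    have h2 : HasMFDerivAt (𝓡 n) (𝓡 n) P 0 (L : Eu n →L[ℝ] Eu n) :=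
      hasMFDerivAt_iff_hasFDerivAt.mpr hL0
    have h3 : HasMFDerivAt (𝓡 n) (𝓡 n) χ'.symm 0 _ := h1.comp 0 h2
    refine (DFunLike.congr_fun h3.mfderiv v).trans ?_
    change (show Eu n from mfderiv (𝓡 n) (𝓡 n) χ.symm (P 0) (L v)) = _
    rw [hP0]

/-- Existence of a chart with prescribed coordinate vectors, in which the tangential part of the
second covariant derivative of `f` vanishes at the point. -/
theorem exists_normal_chart {N : ℕ} {Y : Type*} [TopologicalSpace Y] [ChartedSpace (Eu N) Y]
    [IsManifold (𝓡 N) ∞ Y] {f : X → Y} (hf : ContMDiff (𝓡 n) (𝓡 N) ∞ f) {p : X}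
    {ψ : OpenPartialHomeomorph Y (Eu N)} (hψ : ψ ∈ IsManifold.maximalAtlas (𝓡 N) ∞ Y)
    (hfp : f p ∈ ψ.source) (e : Module.Basis (Fin n) ℝ (TangentSpace (𝓡 n) p))
    {G : Eu N →L[ℝ] Eu N →L[ℝ] ℝ} {Γ : Eu N →L[ℝ] Eu N →L[ℝ] Eu N}
    (hΓ : ∀ u v, Γ u v = Γ v u) {E : Fin n → Eu N}
    (hE : ∀ k, E k = mfderiv (𝓡 N) (𝓡 N) ψ (f p) (mfderiv (𝓡 n) (𝓡 N) f p (e k)))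
    (hG : ∀ k l, G (E k) (E l) = if k = l then 1 else 0) :
    ∃ χ ∈ IsManifold.maximalAtlas (𝓡 n) ∞ X, p ∈ χ.source ∧ χ p = 0 ∧
      (∀ k, (show Eu n from mfderiv (𝓡 n) (𝓡 n) χ.symm 0 (basisVec k)) = (show Eu n from e k)) ∧
      (∀ k, fderiv ℝ (localRep f χ ψ) 0 (basisVec k) = E k) ∧
      ∀ i j l, G (fderiv ℝ (fderiv ℝ (localRep f χ ψ)) 0 (basisVec i) (basisVec j)
        + Γ (E i) (E j)) (E l) = 0 := by
  let χ₀ := chartAt (Eu n) p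
  have hχ₀ : χ₀ ∈ IsManifold.maximalAtlas (𝓡 n) ∞ X := IsManifold.chart_mem_maximalAtlas p
  have hp : p ∈ χ₀.source := mem_chart_source _ p
  have hd := mdifferentiable_of_mem_maximalAtlas hχ₀
  let e' : Module.Basis (Fin n) ℝ (Eu n) := e.map (hd.mfderiv hp).toLinearEquiv
  -- The linear part sends the standard basis to the components of the prescribed frame.
  let L₀ : Eu n ≃ₗ[ℝ] Eu n :=
    (EuclideanSpace.basisFun (Fin n) ℝ).toBasis.equiv e' (Equiv.refl _)
  let L : Eu n ≃L[ℝ] Eu n := L₀.toContinuousLinearEquiv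
  have hL : ∀ k, L (basisVec k) = mfderiv (𝓡 n) (𝓡 n) χ₀ p (e k) := fun k => by
    have h1 : L₀ ((EuclideanSpace.basisFun (Fin n) ℝ).toBasis k) = e' k :=
      (EuclideanSpace.basisFun (Fin n) ℝ).toBasis.equiv_apply k e' (Equiv.refl _)
    rw [OrthonormalBasis.coe_toBasis, EuclideanSpace.basisFun_apply] at h1
    exact h1
  have hdL : ∀ k, (show Eu n from mfderiv (𝓡 n) (𝓡 n) χ₀.symm (χ₀ p) (L (basisVec k))) =
      (show Eu n from e k) := fun k => by
    rw [hL]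
    exact DFunLike.congr_fun (hd.symm_comp_deriv hp) (e k)
  let F₀ := localRep f χ₀ ψ
  have hx : χ₀ p ∈ χ₀.target := χ₀.map_source hp
  have hfx : f (χ₀.symm (χ₀ p)) ∈ ψ.source := by rw [χ₀.left_inv hp]; exact hfp
  have hF₀ : ContDiffAt ℝ 2 F₀ (χ₀ p) :=
    (contDiffAt_localRep hf hχ₀ hψ hx hfx).of_le ENat.LEInfty.out
  have hfd : MDifferentiable (𝓡 n) (𝓡 N) f := hf.mdifferentiable (by simp)
  have hF₀E : ∀ k, fderiv ℝ F₀ (χ₀ p) (L (basisVec k)) = E k := fun k => by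
    rw [fderiv_localRep hfd hχ₀ hψ hx hfx, hE]
    have key : ∀ (q : X) (h : q = p) (a : Eu n), a = (show Eu n from e k) →
        (show Eu N from mfderiv (𝓡 N) (𝓡 N) ψ (f q) (mfderiv (𝓡 n) (𝓡 N) f q a)) =
        (show Eu N from mfderiv (𝓡 N) (𝓡 N) ψ (f p) (mfderiv (𝓡 n) (𝓡 N) f p (e k))) := by
      rintro q rfl a rfl; rfl
    exact key _ (χ₀.left_inv hp) _ (hdL k)
  let A : Fin n → Fin n → Eu N := fun i j =>
    fderiv ℝ (fderiv ℝ F₀) (χ₀ p) (L (basisVec i)) (L (basisVec j)) + Γ (E i) (E j)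
  have hA : ∀ i j, A i j = A j i := fun i j => by
    simp only [A]
    rw [fderiv_fderiv_symm hF₀, hΓ]
  -- Composing with the quadratic map adds `dF₀ (Q u v)` to the second derivative; this choice
  -- subtracts exactly the `G`-orthogonal projection of `A i j` onto the span of `E`.
  let c : Fin n → Fin n → Eu n := fun i j => -∑ l, G (A i j) (E l) • L (basisVec l)
  let Q : Eu n →L[ℝ] Eu n →L[ℝ] Eu n := symbolMap fun a i j => c i j a
  have hQ : ∀ u v, Q u v = Q v u := fun u v => by
    ext a
    rw [symbolMap_apply, symbolMap_apply, Finset.sum_comm]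
    refine Finset.sum_congr rfl fun i _ => Finset.sum_congr rfl fun j _ => ?_
    simp only [c, hA j i]
    ring
  have hQb : ∀ i j, Q (basisVec i) (basisVec j) = c i j := fun i j => by
    ext a
    rw [symbolMap_apply]
    simp [basisVec_apply]
  obtain ⟨χ, hχ, hpχ, hχp, hχs, hχd⟩ := exists_chart_comp_quadMap hχ₀ hp L hQ
  set P := quadMap (χ₀ p) (L : Eu n →L[ℝ] Eu n) Q with hP
  have hP0 : P 0 = χ₀ p := by simp [hP, quadMap]
  have hF : localRep f χ ψ = fun x => F₀ (P x) := by
    ext1 x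
    simp only [localRep, F₀, hχs]
  have hPd : ContDiffAt ℝ 2 P 0 := contDiff_quadMap.contDiffAt
  have hP1 : ∀ v, fderiv ℝ P 0 v = L v := fun v => by
    rw [hP, fderiv_quadMap hQ]; simp
  refine ⟨χ, hχ, hpχ, hχp, fun k => (hχd _).trans (hdL k), fun k => ?_, fun i j l => ?_⟩
  · rw [hF]
    have h1 := fderiv_comp (𝕜 := ℝ) (0 : Eu n) (g := F₀) (f := P)
      (by rw [hP0]; exact hF₀.differentiableAt (by simp)) (hPd.differentiableAt (by simp))
    have h2 := DFunLike.congr_fun h1 (basisVec k)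
    rw [ContinuousLinearMap.comp_apply, hP1, hP0, hF₀E] at h2
    exact h2
  · rw [hF, fderiv_fderiv_comp (by rw [hP0]; exact hF₀) hPd, hP1, hP1, hP0, hP,
      fderiv_fderiv_quadMap hQ, hQb]
    have h1 : fderiv ℝ F₀ (χ₀ p) (c i j) = -∑ l, G (A i j) (E l) • E l := by
      simp only [c, map_neg, map_sum, map_smul, hF₀E]
    rw [h1, add_right_comm]
    change G (A i j + _) (E l) = 0
    simp [hG]

end NormalChart

/-! ### Partial derivatives of components and derivatives of an inverse matrix. -/

section Coordinates

theorem pd_coord {n N : ℕ} {F : Eu n → Eu N} {x : Eu n} (hF : DifferentiableAt ℝ F x) (i : Fin n)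
    (α : Fin N) : pd i (fun z => F z α) x = fderiv ℝ F x (basisVec i) α := by
  have h : HasFDerivAt (fun z => (EuclideanSpace.proj α : Eu N →L[ℝ] ℝ) (F z)) _ x :=
    (EuclideanSpace.proj α : Eu N →L[ℝ] ℝ).hasFDerivAt.comp x hF.hasFDerivAt
  rw [pd]
  exact DFunLike.congr_fun h.fderiv (basisVec i)

theorem pd_pd_coord {n N : ℕ} {F : Eu n → Eu N} {x : Eu n} (hF : ContDiffAt ℝ 2 F x) (i j : Fin n)
    (α : Fin N) : pd i (pd j (fun z => F z α)) x =
      fderiv ℝ (fderiv ℝ F) x (basisVec i) (basisVec j) α := by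
  have h1 : pd j (fun z => F z α) =ᶠ[𝓝 x] fun z => fderiv ℝ F z (basisVec j) α := by
    filter_upwards [hF.eventually (by simp)] with z hz
    exact pd_coord (hz.differentiableAt (by simp)) j α
  have h2 : HasFDerivAt (fderiv ℝ F) (fderiv ℝ (fderiv ℝ F) x) x :=
    ((hF.fderiv_right (m := 1) (by norm_num)).differentiableAt (by simp)).hasFDerivAt
  have h3 : HasFDerivAt (fun z => fderiv ℝ F z (basisVec j)) _ x :=
    h2.clm_apply (hasFDerivAt_const (basisVec j) x)
  rw [pd, h1.fderiv_eq]
  change pd i (fun z => (fun z => fderiv ℝ F z (basisVec j)) z α) x = _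
  rw [pd_coord h3.differentiableAt, h3.fderiv]
  simp

/-- Differentiate `M * M⁻¹ = 1` at a point where `M = 1` and `dM = 0`. -/
theorem hasFDerivAt_inv_of_eq_one {W : Type*} [NormedAddCommGroup W] [NormedSpace ℝ W] {n : ℕ}
    {M : W → Matrix (Fin n) (Fin n) ℝ} {x : W} (hM : ∀ i j, ContDiffAt ℝ 1 (fun z => M z i j) x)
    (h1 : M x = 1) (hd : ∀ i j, fderiv ℝ (fun z => M z i j) x = 0) (i j : Fin n) :
    HasFDerivAt (fun z => (M z)⁻¹ i j) (0 : W →L[ℝ] ℝ) x := by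
  have hdet : (M x).det ≠ 0 := by rw [h1]; simp
  have hinv : ∀ k, DifferentiableAt ℝ (fun z => (M z)⁻¹ k j) x := fun k =>
    (contDiffAt_matrix_inv hM hdet k j).differentiableAt (by simp)
  have hdM : ∀ k, HasFDerivAt (fun z => M z i k) (0 : W →L[ℝ] ℝ) x := fun k => by
    rw [← hd i k]; exact ((hM i k).differentiableAt (by simp)).hasFDerivAt
  have e1 : HasFDerivAt (fun z => ∑ k, M z i k * (M z)⁻¹ k j) _ x :=
    HasFDerivAt.fun_sum fun k _ => (hdM k).mul (hinv k).hasFDerivAt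
  have heq : (fun z => ∑ k, M z i k * (M z)⁻¹ k j) =ᶠ[𝓝 x]
      fun _ => (1 : Matrix (Fin n) (Fin n) ℝ) i j := by
    filter_upwards [(contDiffAt_matrix_det hM).continuousAt.eventually_ne hdet] with z hz
    rw [← Matrix.mul_apply, Matrix.mul_nonsing_inv _ (Ne.isUnit hz)]
  have e2 := e1.unique ((hasFDerivAt_const _ x).congr_of_eventuallyEq heq)
  simp only [h1, Matrix.one_apply, ite_smul, one_smul, zero_smul, smul_zero, add_zero,
    Finset.sum_ite_eq, Finset.mem_univ, if_true] at e2
  rw [← e2]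
  exact (hinv i).hasFDerivAt

theorem matForm_coordMatrix_mfderiv {N : ℕ} {X : Type*} [TopologicalSpace X]
    [ChartedSpace (Eu N) X] {ψ : OpenPartialHomeomorph X (Eu N)}
    (hψ : ψ ∈ IsManifold.maximalAtlas (𝓡 N) ∞ X)
    (b : ∀ p : X, TangentSpace (𝓡 N) p →L[ℝ] TangentSpace (𝓡 N) p →L[ℝ] ℝ) {p : X}
    (hp : p ∈ ψ.source) (u v : TangentSpace (𝓡 N) p) :
    matForm (coordMatrix ψ (toTwoForm b) (ψ p)) (mfderiv (𝓡 N) (𝓡 N) ψ p u)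
      (mfderiv (𝓡 N) (𝓡 N) ψ p v) = b p u v := by
  refine (matForm_coordMatrix b (ψ p) _ _).trans ?_
  have h := (mdifferentiable_of_mem_maximalAtlas hψ).symm_comp_deriv hp
  have key : ∀ (q : X) (h : p = q) (a c : Eu N), a = (show Eu N from u) → c = (show Eu N from v) →
      b q (show TangentSpace (𝓡 N) q from a) (show TangentSpace (𝓡 N) q from c) = b p u v := by
    rintro q rfl a c rfl rfl; rfl
  exact key _ (ψ.left_inv hp).symm _ _ (DFunLike.congr_fun h u) (DFunLike.congr_fun h v)

end Coordinates

/-! ### Vanishing mean curvature as a vector equation. -/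

section MeanCurvature

variable {n N : ℕ} {X Y : Type*} [TopologicalSpace X] [ChartedSpace (Eu n) X]
  [TopologicalSpace Y] [ChartedSpace (Eu N) Y] {f : X → Y} {g : TwoForm N Y}
  {χ : OpenPartialHomeomorph X (Eu n)} {ψ : OpenPartialHomeomorph Y (Eu N)}

theorem secondFundamentalForm_eq {x : Eu n} (hF : ContDiffAt ℝ 2 (localRep f χ ψ) x) (i j : Fin n)
    (α : Fin N) : secondFundamentalForm f g χ ψ x i j α =
      (fderiv ℝ (fderiv ℝ (localRep f χ ψ)) x (basisVec i) (basisVec j)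
        + chrMap (coordMatrix ψ g) (localRep f χ ψ x) (fderiv ℝ (localRep f χ ψ) x (basisVec i))
          (fderiv ℝ (localRep f χ ψ) x (basisVec j))
        - ∑ k, christoffel (coordMatrix χ (pullback f g)) x k i j •
          fderiv ℝ (localRep f χ ψ) x (basisVec k)) α := by
  have hd := hF.differentiableAt (by simp)
  simp only [PiLp.sub_apply, PiLp.add_apply, WithLp.ofLp_sum, Finset.sum_apply, PiLp.smul_apply,
    smul_eq_mul, ← pd_pd_coord hF, chrMap_apply, ← pd_coord hd]
  rfl

/-- Separating off the tangential terms gives the shape required by `mean_curvature_jets`; their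
coefficients are traces of the induced Christoffel symbols. -/
theorem sum_eq_of_meanCurvature_eq_zero {x : Eu n} (hF : ContDiffAt ℝ 2 (localRep f χ ψ) x)
    (h : ∀ α, meanCurvature f g χ ψ x α = 0) :
    ∑ i, ∑ j, (coordMatrix χ (pullback f g) x)⁻¹ i j •
      (fderiv ℝ (fderiv ℝ (localRep f χ ψ)) x (basisVec i) (basisVec j)
        + chrMap (coordMatrix ψ g) (localRep f χ ψ x) (fderiv ℝ (localRep f χ ψ) x (basisVec i))
          (fderiv ℝ (localRep f χ ψ) x (basisVec j))) =
    ∑ k, (∑ i, ∑ j, (coordMatrix χ (pullback f g) x)⁻¹ i j *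
      christoffel (coordMatrix χ (pullback f g)) x k i j) •
        fderiv ℝ (localRep f χ ψ) x (basisVec k) := by
  have h1 : ∑ i, ∑ j, (coordMatrix χ (pullback f g) x)⁻¹ i j •
      (fderiv ℝ (fderiv ℝ (localRep f χ ψ)) x (basisVec i) (basisVec j)
        + chrMap (coordMatrix ψ g) (localRep f χ ψ x) (fderiv ℝ (localRep f χ ψ) x (basisVec i))
          (fderiv ℝ (localRep f χ ψ) x (basisVec j))
        - ∑ k, christoffel (coordMatrix χ (pullback f g)) x k i j •
          fderiv ℝ (localRep f χ ψ) x (basisVec k)) = 0 := by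
    ext α
    have := h α
    simp only [meanCurvature, secondFundamentalForm_eq hF] at this
    simpa only [WithLp.ofLp_sum, Finset.sum_apply, PiLp.smul_apply, smul_eq_mul, PiLp.zero_apply]
      using this
  simp only [smul_sub (M := ℝ), Finset.sum_sub_distrib] at h1
  rw [sub_eq_zero.mp h1]
  simp only [Finset.smul_sum, Finset.sum_smul, smul_smul]
  refine (Finset.sum_congr rfl fun i _ => Finset.sum_comm).trans Finset.sum_comm

end MeanCurvature

/-! ### Rayleigh quotients on the submanifold. -/

section MainEstimate

variable {n : ℕ} {X : Type*} [TopologicalSpace X] [ChartedSpace (Eu n) X]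

/-- The Rayleigh characterization of the largest eigenvalue for restrictions to a submanifold. -/
theorem largestEigenvalue_pullback_spec {N : ℕ} {Y : Type*} [TopologicalSpace Y]
    [ChartedSpace (Eu N) Y] {f : X → Y}
    {b s : ∀ p : Y, TangentSpace (𝓡 N) p →L[ℝ] TangentSpace (𝓡 N) p →L[ℝ] ℝ}
    (hb : ∀ p v w, b p v w = b p w v) (hs : ∀ p v w, s p v w = s p w v)
    (hsp : Spacelike (n := n) f (toTwoForm b)) (q : X) (hn : 0 < n) (r : ℝ) :
    (∀ w : TangentSpace (𝓡 n) q, r * pullback (n := n) f (toTwoForm s) q w w ≤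
      largestEigenvalue (pullback (n := n) f (toTwoForm b) q) (fun v w => r * pullback (n := n) f (toTwoForm s) q v w)
        * pullback (n := n) f (toTwoForm b) q w w) ∧
    ∃ v : TangentSpace (𝓡 n) q, v ≠ 0 ∧ ∀ w, r * pullback (n := n) f (toTwoForm s) q v w =
      largestEigenvalue (pullback (n := n) f (toTwoForm b) q) (fun v w => r * pullback (n := n) f (toTwoForm s) q v w)
        * pullback (n := n) f (toTwoForm b) q v w := by
  let D : Eu n →L[ℝ] Eu N := mfderiv (𝓡 n) (𝓡 N) f q
  let b' : Eu N →L[ℝ] Eu N →L[ℝ] ℝ := b (f q)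
  let s' : Eu N →L[ℝ] Eu N →L[ℝ] ℝ := s (f q)
  have : Nontrivial (Eu n) := by
    have : Nonempty (Fin n) := ⟨⟨0, hn⟩⟩
    infer_instance
  exact largestEigenvalue_spec (V := Eu n) (g := b'.bilinearComp D D)
    (B := r • s'.bilinearComp D D) (fun v w => hb (f q) _ _)
    (fun v w => congrArg (fun x => r * x) (hs (f q) _ _)) (fun v hv => hsp q v hv)

end MainEstimate

/-! ### First derivatives of the induced metric in the adapted chart. -/

section NormalCoordinates

variable {n N : ℕ} {F : Eu n → Eu N} {G : Eu N → Matrix (Fin N) (Fin N) ℝ}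

/-- The induced metric has vanishing derivative where the second covariant derivative of `F` is
normal. -/
theorem fderiv_induced_metric_eq_zero {M : Eu n → Matrix (Fin n) (Fin n) ℝ}
    (hF : ContDiffAt ℝ 2 F 0) (hG : ∀ i j, ContDiffAt ℝ 1 (fun z => G z i j) (F 0))
    (hs : ∀ᶠ z in 𝓝 (F 0), ∀ i j, G z i j = G z j i) (hdet : (G (F 0)).det ≠ 0)
    (hM : ∀ᶠ x in 𝓝 0, ∀ i j, M x i j =
      matForm (G (F x)) (fderiv ℝ F x (basisVec i)) (fderiv ℝ F x (basisVec j)))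
    (hn : ∀ i j l, matForm (G (F 0)) (fderiv ℝ (fderiv ℝ F) 0 (basisVec i) (basisVec j)
      + chrMap G (F 0) (fderiv ℝ F 0 (basisVec i)) (fderiv ℝ F 0 (basisVec j)))
        (fderiv ℝ F 0 (basisVec l)) = 0) (i j : Fin n) :
    fderiv ℝ (fun x => M x i j) 0 = 0 := by
  have d0 : HasFDerivAt F (fderiv ℝ F 0) 0 := (hF.differentiableAt (by simp)).hasFDerivAt
  have d1 : HasFDerivAt (fderiv ℝ F) (fderiv ℝ (fderiv ℝ F) 0) 0 :=
    ((hF.fderiv_right (m := 1) (by norm_num)).differentiableAt (by simp)).hasFDerivAt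
  have dGy : HasFDerivAt (fun z => matForm (G z)) (fderiv ℝ (fun z => matForm (G z)) (F 0)) (F 0) :=
    ((contDiffAt_matForm hG).differentiableAt (by simp)).hasFDerivAt
  have dG : HasFDerivAt (fun x => matForm (G (F x)))
      ((fderiv ℝ (fun z => matForm (G z)) (F 0)).comp (fderiv ℝ F 0)) 0 :=
    HasFDerivAt.comp (g := fun z => matForm (G z)) 0 dGy d0
  have c : ∀ v : Eu n, HasFDerivAt (fun _ : Eu n => v) (0 : Eu n →L[ℝ] Eu n) 0 :=
    fun v => hasFDerivAt_const v 0
  have h1 : (fun x => M x i j) =ᶠ[𝓝 0] fun x =>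
      matForm (G (F x)) (fderiv ℝ F x (basisVec i)) (fderiv ℝ F x (basisVec j)) :=
    hM.mono fun x hx => hx i j
  rw [h1.fderiv_eq, ((dG.clm_apply (d1.clm_apply (c (basisVec i)))).clm_apply
    (d1.clm_apply (c (basisVec j)))).fderiv]
  ext u
  rw [map_eq_sum_basisVec _ u]
  refine Finset.sum_eq_zero fun k _ => ?_
  simp only [add_apply, ContinuousLinearMap.comp_zero, zero_add, ContinuousLinearMap.flip_apply,
    ContinuousLinearMap.comp_apply]
  rw [fderiv_matForm_eq hG hs hdet]
  -- By metric compatibility the derivative splits into two tangential components of second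
  -- covariant derivatives, and both vanish.
  have e1 := hn k i j
  have e2 := hn k j i
  have hsy := matForm_symm hs.self_of_nhds
  rw [map_add, add_apply] at e1
  rw [hsy, map_add] at e2
  rw [hsy (fderiv ℝ F 0 (basisVec i)) (fderiv ℝ (fderiv ℝ F) 0 (basisVec k) (basisVec j))]
  rw [hsy (fderiv ℝ F 0 (basisVec i)) (fderiv ℝ (fderiv ℝ F) 0 (basisVec k) (basisVec j))] at e2
  rw [smul_eq_mul, mul_eq_zero]
  right
  linarith

end NormalCoordinates

/-! ### Assembly of the global estimate. -/

section MainEstimate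

variable {n m : ℕ} {X Y : Type*} [TopologicalSpace X] [ChartedSpace (Eu n) X]
  [IsManifold (𝓡 n) ∞ X] [TopologicalSpace Y] [ChartedSpace (Eu (n + m)) Y]
  [IsManifold (𝓡 (n + m)) ∞ Y]

theorem sum_riemann_le {K : ℝ} (P : ℕ) (ghat : PseudoMetric n m Y) (Shat : RiemMetric (n + m) Y)
    {φhat : Y → ℝ} (hφ : ContMDiff (𝓡 (n + m)) 𝓘(ℝ, ℝ) ∞ φhat) {f : X → Y}
    (hf : ContMDiff (𝓡 n) (𝓡 (n + m)) ∞ f)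
    (hsp : Spacelike (n := n) f ghat.form) (hH : ZeroMeanCurvature (n := n) f ghat.form)
    {p₀ : X} (hφp : 0 < φhat (f p₀))
    (hmax : ∀ q : X, largestEigenvalue (pullback (n := n) f ghat.form q)
        (fun v w => φhat (f q) ^ P * pullback (n := n) f (riemForm Shat) q v w) ≤
      largestEigenvalue (pullback (n := n) f ghat.form p₀)
        (fun v w => φhat (f p₀) ^ P * pullback (n := n) f (riemForm Shat) p₀ v w))
    (e : Module.Basis (Fin n) ℝ (TangentSpace (𝓡 n) p₀))
    (he : ∀ k l, pullback f ghat.form p₀ (e k) (e l) = if k = l then 1 else 0)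
    (hS : ∀ k l, k ≠ l → pullback f (riemForm Shat) p₀ (e k) (e l) = 0) (top : Fin n)
    (htop : pullback f (riemForm Shat) p₀ (e top) (e top) =
      largestEigenvalue (pullback (n := n) f ghat.form p₀) (pullback (n := n) f (riemForm Shat) p₀))
    {ψ : OpenPartialHomeomorph Y (Eu (n + m))}
    (hψ : ψ ∈ IsManifold.maximalAtlas (𝓡 (n + m)) ∞ Y) (hfψ : f p₀ ∈ ψ.source)
    (hC2 : C2Bound ghat.form (riemForm Shat) φhat ψ (f p₀) K) :
    ∑ l, riemann ghat.form ψ (f p₀) (mfderiv (𝓡 n) (𝓡 (n + m)) f p₀ (e l))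
        (mfderiv (𝓡 n) (𝓡 (n + m)) f p₀ (e top)) (mfderiv (𝓡 n) (𝓡 (n + m)) f p₀ (e l))
        (mfderiv (𝓡 n) (𝓡 (n + m)) f p₀ (e top)) ≤
      curvConst n P K (3 / 2 * K ^ 2) (3 * K ^ 2) * (φhat (f p₀) ^ 2)⁻¹
        * pullback f (riemForm Shat) p₀ (e top) (e top) := by
  have hn : 0 < n := top.pos
  have hgf : ghat.form = toTwoForm ghat.val := rfl
  have hSf : riemForm Shat = toTwoForm Shat.inner := rfl
  set G := coordMatrix ψ ghat.form with hG
  set A := coordMatrix ψ (riemForm Shat) with hA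
  have hfd : MDifferentiable (𝓡 n) (𝓡 (n + m)) f := hf.mdifferentiable (by simp)
  have hy₀ : ψ (f p₀) ∈ ψ.target := ψ.map_source hfψ
  -- smoothness and algebraic properties of the components
  have hGs : ∀ y ∈ ψ.target, ∀ i j, ContDiffAt ℝ ∞ (fun z => G z i j) y := fun y hy i j =>
    contDiffAt_coordMatrix ghat.contMDiff hψ hy i j
  have hAs : ∀ y ∈ ψ.target, ∀ i j, ContDiffAt ℝ ∞ (fun z => A z i j) y := fun y hy i j =>
    contDiffAt_coordMatrix Shat.contMDiff hψ hy i j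
  have hGsy : ∀ y i j, G y i j = G y j i := fun y i j => ghat.symm _ _ _
  have hAsy : ∀ y i j, A y i j = A y j i := fun y i j => Shat.symm _ _ _
  have hApos : ∀ v, v ≠ 0 → 0 < matForm (A (ψ (f p₀))) v v := fun v hv => by
    rw [hA, hSf, matForm_coordMatrix]
    exact Shat.pos _ _ fun h => hv (mfderiv_symm_injective hψ hy₀ h)
  have hdet : ∀ y ∈ ψ.target, (G y).det ≠ 0 := fun y hy => ghat.det_coordMatrix_ne_zero hψ hy
  have hG2 : ∀ y ∈ ψ.target, ∀ i j, ContDiffAt ℝ 2 (fun z => G z i j) y := fun y hy i j =>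
    (hGs y hy i j).of_le ENat.LEInfty.out
  have hG1 : ∀ y ∈ ψ.target, ∀ i j, ContDiffAt ℝ 1 (fun z => G z i j) y := fun y hy i j =>
    (hGs y hy i j).of_le ENat.LEInfty.out
  -- the frame
  let E : Fin n → Eu (n + m) := fun k =>
    mfderiv (𝓡 (n + m)) (𝓡 (n + m)) ψ (f p₀) (mfderiv (𝓡 n) (𝓡 (n + m)) f p₀ (e k))
  have hGE : ∀ k l, matForm (G (ψ (f p₀))) (E k) (E l) = if k = l then 1 else 0 := fun k l =>
    (matForm_coordMatrix_mfderiv hψ ghat.val hfψ _ _).trans (he k l)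
  have hAE : ∀ k l, matForm (A (ψ (f p₀))) (E k) (E l) =
      pullback f (riemForm Shat) p₀ (e k) (e l) := fun k l =>
    matForm_coordMatrix_mfderiv hψ Shat.inner hfψ _ _
  obtain ⟨χ, hχ, hpχ, hχp, hχe, hχE, hnormal⟩ := exists_normal_chart hf hψ hfψ e
    (chrMap_symm (hG1 _ hy₀) (Eventually.of_forall hGsy)) (fun k => rfl) hGE
  set F := localRep f χ ψ with hFdef
  have hχ0 : χ.symm 0 = p₀ := by rw [← hχp]; exact χ.left_inv hpχ
  have h0t : (0 : Eu n) ∈ χ.target := by rw [← hχp]; exact χ.map_source hpχ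
  have hF0 : F 0 = ψ (f p₀) := by simp only [hFdef, localRep, hχ0]
  have hev : ∀ᶠ x in 𝓝 (0 : Eu n), x ∈ χ.target ∧ f (χ.symm x) ∈ ψ.source := by
    refine Filter.Eventually.and (χ.open_target.mem_nhds h0t) ?_
    have hc : ContinuousAt (fun x => f (χ.symm x)) 0 :=
      hf.continuous.continuousAt.comp (χ.symm.continuousAt h0t)
    exact hc.eventually (ψ.open_source.mem_nhds (by simpa only [hχ0] using hfψ))
  have hFs : ∀ x, x ∈ χ.target ∧ f (χ.symm x) ∈ ψ.source → ContDiffAt ℝ ∞ F x := fun x hx =>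
    contDiffAt_localRep hf hχ hψ hx.1 hx.2
  have hFs0 : ContDiffAt ℝ ∞ F 0 := hFs 0 hev.self_of_nhds
  -- the induced metric in the chart `χ`
  set M := coordMatrix χ (pullback f ghat.form) with hM
  have hMeq : ∀ᶠ x in 𝓝 (0 : Eu n), ∀ i j, M x i j =
      matForm (G (F x)) (fderiv ℝ F x (basisVec i)) (fderiv ℝ F x (basisVec j)) := by
    filter_upwards [hev] with x hx i j
    exact coordMatrix_pullback hfd hχ hψ ghat.val hx.1 hx.2 i j
  have hF0t : F 0 ∈ ψ.target := by rw [hF0]; exact hy₀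
  have hMs : ∀ i j, ContDiffAt ℝ 2 (fun x => M x i j) 0 := fun i j => by
    have h1 : ContDiffAt ℝ 2 (fun x => matForm (G (F x)) (fderiv ℝ F x (basisVec i))
        (fderiv ℝ F x (basisVec j))) 0 := by
      have hF3 : ContDiffAt ℝ 3 F 0 := hFs0.of_le ENat.LEInfty.out
      have hF' : ContDiffAt ℝ 2 (fderiv ℝ F) 0 := hF3.fderiv_right (by norm_num)
      have hGF : ContDiffAt ℝ 2 (fun x => matForm (G (F x))) 0 :=
        (contDiffAt_matForm (hG2 _ hF0t)).comp 0 (hF3.of_le (by norm_num))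
      exact (hGF.clm_apply (hF'.clm_apply contDiffAt_const)).clm_apply
        (hF'.clm_apply contDiffAt_const)
    exact h1.congr_of_eventuallyEq (hMeq.mono fun x hx => hx i j)
  have hM0 : M 0 = 1 := by
    ext i j
    rw [hMeq.self_of_nhds i j, hF0, hχE, hχE, hGE, Matrix.one_apply]
  have hMd : ∀ i j, fderiv ℝ (fun x => M x i j) 0 = 0 :=
    fderiv_induced_metric_eq_zero (hFs0.of_le ENat.LEInfty.out) (hG1 _ hF0t)
      (Eventually.of_forall hGsy) (hdet _ hF0t) hMeq fun i j l => by
        rw [hF0, hχE, hχE, hχE]; exact hnormal i j l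
  have hMdet : (M 0).det ≠ 0 := by rw [hM0]; simp
  -- Hence the tangential coefficients `τ` vanish at the point. Their derivatives are not
  -- controlled, and need not be.
  have hchr0 : ∀ k i j, christoffel M 0 k i j = 0 := fun k i j => by
    simp only [christoffel, pd, hMd]
    simp
  have hchrd : ∀ k i j, DifferentiableAt ℝ (fun x => christoffel M x k i j) 0 := fun k i j =>
    (contDiffAt_christoffel (k := 1) (by simpa only [one_add_one_eq_two] using hMs) hMdet
      k i j).differentiableAt (by simp)
  have hinv := hasFDerivAt_inv_of_eq_one (fun i j => (hMs i j).of_le (by norm_num)) hM0 hMd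
  -- the bounds
  have hC := hC2
  obtain ⟨bG, bGi, bA, bφ⟩ := hC
  have hφK : φhat (f p₀) ≤ K := by
    have : |φhat (ψ.symm (ψ (f p₀)))| ≤ K := bφ.1
    rw [ψ.left_inv hfψ] at this
    exact (le_abs_self _).trans this
  have hK : 0 ≤ K := hφp.le.trans hφK
  simp only [← matForm_apply] at bG bGi bA
  have sB := scaleBound_unitBall hApos
  have hAsm : ContDiffAt ℝ 2 (fun z => matForm (A z)) (ψ (f p₀)) :=
    contDiffAt_matForm fun i j => (hAs _ hy₀ i j).of_le ENat.LEInfty.out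
  have hφs : ContDiffAt ℝ 2 (fun z => φhat (ψ.symm z)) (ψ (f p₀)) := by
    have : ContMDiffAt (𝓡 (n + m)) 𝓘(ℝ, ℝ) ∞ (fun z => φhat (ψ.symm z)) (ψ (f p₀)) :=
      hφ.contMDiffAt.comp _ (contMDiffAt_symm_of_mem_maximalAtlas hψ hy₀)
    exact (contMDiffAt_iff_contDiffAt.mp this).of_le ENat.LEInfty.out
  -- the Rayleigh quotients
  have hbsy : ∀ p v w, ghat.val p v w = ghat.val p w v := ghat.symm
  have hssy : ∀ p v w, Shat.inner p v w = Shat.inner p w v := Shat.symm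
  have hspec := fun q r => largestEigenvalue_pullback_spec hbsy hssy hsp q hn r
  have hray1 : ∀ w : TangentSpace (𝓡 n) p₀, pullback f (riemForm Shat) p₀ w w ≤
      pullback f (riemForm Shat) p₀ (e top) (e top) * pullback f ghat.form p₀ w w := fun w => by
    have := (hspec p₀ 1).1 w
    simp only [one_mul] at this
    rw [htop]
    exact this
  -- Only this inequality between the eigenvalue of the scaled form and the scaled eigenvalue is
  -- needed; it is tested on an eigenvector of the former.
  have hrayP : largestEigenvalue (pullback (n := n) f ghat.form p₀)
      (fun v w => φhat (f p₀) ^ P * pullback (n := n) f (riemForm Shat) p₀ v w) ≤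
      φhat (f p₀) ^ P * pullback f (riemForm Shat) p₀ (e top) (e top) := by
    obtain ⟨v, hv, hveq⟩ := (hspec p₀ (φhat (f p₀) ^ P)).2
    have h1 := hveq v
    have h2 := mul_le_mul_of_nonneg_left (hray1 v) (pow_nonneg hφp.le P)
    have h3 := hsp p₀ v hv
    rw [← mul_assoc] at h2
    exact le_of_mul_le_mul_right (h1.symm.trans_le h2) h3
  -- `∂_top` need not be an eigenvector away from `p₀`: its Rayleigh quotient is at most the largest
  -- eigenvalue at `x`, which is at most the one at `p₀`.
  have hmaxF : ∀ᶠ x in 𝓝 (0 : Eu n), φhat (ψ.symm (F x)) ^ P * matForm (A (F x))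
      (fderiv ℝ F x (basisVec top)) (fderiv ℝ F x (basisVec top)) ≤
        φhat (ψ.symm (F 0)) ^ P * matForm (A (F 0)) (E top) (E top)
          * matForm (G (F x)) (fderiv ℝ F x (basisVec top)) (fderiv ℝ F x (basisVec top)) := by
    filter_upwards [hev] with x hx
    have h1 := pullback_eq_matForm hfd hχ hψ ghat.val hx.1 hx.2 (basisVec top) (basisVec top)
    have h2 := pullback_eq_matForm hfd hχ hψ Shat.inner hx.1 hx.2 (basisVec top) (basisVec top)
    have e1 : ψ.symm (F x) = f (χ.symm x) := ψ.left_inv hx.2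
    have e2 : ψ.symm (F 0) = f p₀ := by rw [hF0]; exact ψ.left_inv hfψ
    have h3 := (hspec (χ.symm x) (φhat (f (χ.symm x)) ^ P)).1
      (mfderiv (𝓡 n) (𝓡 n) χ.symm x (basisVec top))
    have h5 : 0 ≤ pullback f ghat.form (χ.symm x)
        (mfderiv (𝓡 n) (𝓡 n) χ.symm x (basisVec top))
        (mfderiv (𝓡 n) (𝓡 n) χ.symm x (basisVec top)) := by
      by_cases h0 : (mfderiv (𝓡 n) (𝓡 n) χ.symm x (basisVec top) :
          TangentSpace (𝓡 n) (χ.symm x)) = 0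
      · rw [h0]
        simp [pullback, hgf, toTwoForm]
      · exact (hsp _ _ h0).le
    have h4 := h3.trans (mul_le_mul_of_nonneg_right ((hmax (χ.symm x)).trans hrayP) h5)
    rw [e1, e2, hF0, hAE]
    refine le_trans (le_of_eq ?_) (h4.trans (le_of_eq ?_))
    · exact congrArg (fun x => φhat (f (χ.symm _)) ^ P * x) h2.symm
    · exact congrArg (fun x => φhat (f p₀) ^ P * pullback f (riemForm Shat) p₀ (e top) (e top) * x) h1
  -- `E top` is nonzero because its `G`-square is `1`.
  have hAtop : 0 < matForm (A (F 0)) (E top) (E top) := by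
    rw [hF0]
    refine hApos _ fun h => ?_
    have := hGE top top
    rw [h] at this
    simp at this
  have hΓd : ∀ a b c, ContDiffAt ℝ 1 (fun z => christoffel G z a b c) (ψ (f p₀)) := fun a b c =>
    contDiffAt_christoffel (k := 1) (by simpa only [one_add_one_eq_two] using hG2 _ hy₀)
      (hdet _ hy₀) a b c
  have htgt : ∀ᶠ z in 𝓝 (F 0), z ∈ ψ.target := ψ.open_target.mem_nhds hF0t
  have key := sum_curvTerm_le_of_isLocalMax (n := n) P (F := F) (G := fun z => matForm (G z))
    (A := fun z => matForm (A z)) (Γ := chrMap G) (φ := fun z => φhat (ψ.symm z)) (K := K)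
    (c₁ := 3 / 2 * K ^ 2) (c₂ := 3 * K ^ 2) (e := basisVec) (top := top) (E := E)
    (a := fun i j x => (M x)⁻¹ i j)
    (τ := fun k x => ∑ i, ∑ j, (M x)⁻¹ i j * christoffel M x k i j)
    (hFs0.of_le ENat.LEInfty.out) (contDiffAt_matForm (hG2 _ hF0t))
    (by rw [hF0]; exact hAsm) (by rw [hF0]; exact hφs)
    (by
      rw [hF0]
      exact (contDiffAt_chrMap (k := 1) (by simpa only [one_add_one_eq_two] using hG2 _ hy₀)
        (hdet _ hy₀)).differentiableAt (by simp))
    (htgt.mono fun z hz => fderiv_matForm_eq (hG1 z hz) (Eventually.of_forall hGsy) (hdet z hz))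
    (matForm_symm (hGsy _)) (Eventually.of_forall fun z => matForm_symm (hAsy z))
    (htgt.mono fun z hz => chrMap_symm (hG1 z hz) (Eventually.of_forall hGsy))
    (fun v => by
      rw [hF0]
      by_cases hv : v = 0
      · simp [hv]
      · exact (hApos v hv).le)
    hχE (by rw [hF0]; exact hGE)
    (fun l hl => by rw [hF0, hAE]; exact hS l top hl)
    (fun l => by
      rw [hF0, hAE, hAE]
      have := hray1 (e l)
      rwa [he, if_pos rfl, mul_one] at this)
    hAtop (fun k l => by rw [hF0]; exact hnormal k top l)
    (fun v hv => by
      rw [hF0] at hv ⊢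
      exact ghat.matForm_nonpos_of_orthogonal hGE hv)
    hinv (fun i j => by simp only [hM0, inv_one, Matrix.one_apply])
    (fun l => DifferentiableAt.fun_sum fun i _ => DifferentiableAt.fun_sum fun j _ =>
      (hinv i j).differentiableAt.mul (hchrd l i j))
    (fun l => by simp [hchr0])
    (by
      filter_upwards [hev] with x hx
      refine sum_eq_of_meanCurvature_eq_zero ((hFs x hx).of_le ENat.LEInfty.out) fun α => ?_
      have := hH χ hχ ψ hψ (χ.symm x) (χ.map_target hx.1) hx.2 α
      rwa [χ.right_inv hx.1] at this)
    hmaxF (by rw [hF0, ψ.left_inv hfψ]; exact hφp) (by rw [hF0, ψ.left_inv hfψ]; exact hφK)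
    (by positivity) (by positivity)
    (by rw [hF0]; exact abs_chrMap_le hK (hG2 _ hy₀) hApos (hAsy _) bG bGi)
    (by rw [hF0]; exact abs_fderiv_chrMap_le hK (hG2 _ hy₀) (hdet _ hy₀) hApos (hAsy _) bG bGi)
    (by rw [hF0]; exact fun u v w => abs_fderiv_bilin_le hK hAsm bA (sB u) (sB v) (sB w))
    (by
      rw [hF0]
      exact fun u v w z => abs_fderiv_fderiv_bilin_le hK hAsm bA (sB u) (sB v) (sB w) (sB z))
    (by rw [hF0]; exact fun u => abs_fderiv_le hK bφ (sB u))
    (by rw [hF0]; exact fun u v => abs_fderiv_fderiv_le hK hφs bφ (sB u) (sB v))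
  rw [hF0, ψ.left_inv hfψ, hAE] at key
  refine (Finset.sum_le_sum fun l _ => le_of_eq ?_).trans key
  exact riemann_eq_curvTerm hΓd rfl rfl

end MainEstimate

end MaximalSpacelike

end

theorem proposition2p3 (n m : ℕ) (K : ℝ) :
    ∃ C : ℝ, ∀ (Mhat : Type u) [TopologicalSpace Mhat]
      [ChartedSpace (MaximalSpacelike.Eu (n + m)) Mhat] [IsManifold (𝓡 (n + m)) ∞ Mhat]
      (ghat : MaximalSpacelike.PseudoMetric n m Mhat)
      (Shat : MaximalSpacelike.RiemMetric (n + m) Mhat)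
      (φhat : Mhat → ℝ) (_ : ContMDiff (𝓡 (n + m)) 𝓘(ℝ, ℝ) ∞ φhat) (_ : ∀ p, 0 ≤ φhat p)
      (M : Type v) [TopologicalSpace M]
      [ChartedSpace (MaximalSpacelike.Eu n) M] [IsManifold (𝓡 n) ∞ M]
      (f : M → Mhat) (_ : ContMDiff (𝓡 n) (𝓡 (n + m)) ∞ f)
      (_ : MaximalSpacelike.Spacelike (n := n) f ghat.form)
      (_ : MaximalSpacelike.ZeroMeanCurvature (n := n) f ghat.form)
      (g S : MaximalSpacelike.TwoForm n M)
      (_ : g = MaximalSpacelike.pullback (n := n) f ghat.form)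
      (_ : S = MaximalSpacelike.pullback (n := n) f (MaximalSpacelike.riemForm Shat))
      (φ : M → ℝ) (_ : φ = φhat ∘ f)
      (p₀ : M) (_ : 0 < φ p₀)
      (_ : ∀ q : M,
        MaximalSpacelike.largestEigenvalue (g q) (fun v w => φ q ^ (2 * n - 2) * S q v w) ≤
        MaximalSpacelike.largestEigenvalue (g p₀) (fun v w => φ p₀ ^ (2 * n - 2) * S p₀ v w))
      (e : Module.Basis (Fin n) ℝ (TangentSpace (𝓡 n) p₀))
      (_ : ∀ k l, g p₀ (e k) (e l) = if k = l then 1 else 0)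
      (_ : ∀ k l, k ≠ l → S p₀ (e k) (e l) = 0)
      (top : Fin n)
      (_ : S p₀ (e top) (e top) = MaximalSpacelike.largestEigenvalue (g p₀) (S p₀))
      (ψ : OpenPartialHomeomorph Mhat (MaximalSpacelike.Eu (n + m)))
      (_ : ψ ∈ IsManifold.maximalAtlas (𝓡 (n + m)) ∞ Mhat) (_ : f p₀ ∈ ψ.source)
      (_ : MaximalSpacelike.C2Bound ghat.form (MaximalSpacelike.riemForm Shat) φhat ψ (f p₀) K),
      let E : Fin n → TangentSpace (𝓡 (n + m)) (f p₀) :=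
        fun l => mfderiv (𝓡 n) (𝓡 (n + m)) f p₀ (e l)
      ∑ l, MaximalSpacelike.riemann ghat.form ψ (f p₀) (E l) (E top) (E l) (E top) ≤
        C * (φ p₀ ^ 2)⁻¹ * S p₀ (e top) (e top) := by
  -- The last two arguments are the bounds for the Christoffel symbols and their derivatives. The
  -- truncated subtraction is harmless, since `top : Fin n` forces `n ≥ 1`.
  refine ⟨MaximalSpacelike.curvConst n (2 * n - 2) K (3 / 2 * K ^ 2) (3 * K ^ 2), ?_⟩
  intro Mhat _ _ _ ghat Shat φhat hφ hφ0 M _ _ _ f hf hsp hH g S hg hS φ hφf p₀ hp hmax e he hSe top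
    htop ψ hψ hfψ hC2
  subst hg hS hφf
  exact MaximalSpacelike.sum_riemann_le (2 * n - 2) ghat Shat hφ hf hsp hH hp hmax e he hSe top htop
    hψ hfψ hC2
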